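/- Let $m\ge 1$ and $n>4m$ be integers. For $\lambda>0$ let $\mathcal R_0^+(\lambda^{2m})=\lim_{\delta\to0+}\big((-\Delta)^m-(\lambda^{2m}+i\delta)\big)^{-1}$ be the limiting free resolvent on $\mathbb R^n$. It has an integral kernel $\mathcal R_0^+(\lambda^{2m})(x,y)$, continuous for $x\neq y$, in the sense that for every Schwartz function $f$ and every $x\in\mathbb R^n$ the function $y\mapsto\mathcal R_0^+(\lambda^{2m})(x,y)f(y)$ is integrable and $$\lim_{\delta\to0+}\Big[\big((-\Delta)^m-(\lambda^{2m}+i\delta)\big)^{-1}f\Big](x)=\int_{\mathbb R^n}\mathcal R_0^+(\lambda^{2m})(x,y)f(y)\,dy .$$ Set $$G_0(x,y)=\gamma_{2m}|x-y|^{2m-n},\qquad G_1(x,y)=\gamma_{4m}|x-y|^{4m-n},\qquad \gamma_s=\frac{\Gamma(\frac{n-s}{2})}{2^s\pi^{n/2}\Gamma(\frac s2)},$$ and define $E(\lambda)(x,y)$ for $x\ne y$ by $$\mathcal R_0^+(\lambda^{2m})(x,y)=G_0(x,y)+\lambda^{2m}G_1(x,y)+E(\lambda)(x,y).$$ Then for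 all $x\neq y$ the function $\lambda\mapsto E(\lambda)(x,y)$ is $\lceil n/2\rceil+1$ times continuously differentiable on $(0,\infty)$, and for every $\lambda_0>0$ and every $0<\epsilon<1$ there is a constant $C$, depending only on $m,n,\lambda_0,\epsilon$, such that for all integers $0\le\ell\le\lceil n/2\rceil+1$, all $0<\lambda<\lambda_0$ and all $x\ne y$ in $\mathbb R^n$, $$\lambda^{\ell}\big|\partial_\lambda^{\ell}E(\lambda)(x,y)\big|\le C\,\lambda^{2m+\epsilon}\Big(|x-y|^{\{n/2\}+\frac32}+|x-y|^{4m-n+\epsilon}\Big),\qquad \{n/2\}=\lceil n/2\rceil-n/2 .$$ -/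

import Mathlib

open Real Set Filter Topology MeasureTheory
open scoped SchwartzMap Laplacian

noncomputable section

/-- The free operator `(-Δ)^m` on Schwartz functions on `ℝⁿ`. -/
def freeHamiltonian {n : ℕ} (m : ℕ) (f : 𝓢(EuclideanSpace ℝ (Fin n), ℂ)) :
    𝓢(EuclideanSpace ℝ (Fin n), ℂ) :=
  (fun g : 𝓢(EuclideanSpace ℝ (Fin n), ℂ) => -(Δ g))^[m] f

/-- The free resolvent `((-Δ)^m - z)⁻¹` (for `z` off the real line), as the Fourier multiplier with
symbol `((4π²|ξ|²)^m - z)⁻¹`; Mathlib's Fourier transform has the kernel `e^{-2πi⟨x,ξ⟩}`, so that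
`-Δ` has the symbol `4π²|ξ|²`.  The two theorems `freeResolvent_left_inverse` and
`freeResolvent_right_inverse` below say that this is the inverse of `(-Δ)^m - z`. -/
def freeResolvent {n : ℕ} (m : ℕ) (z : ℂ) (f : 𝓢(EuclideanSpace ℝ (Fin n), ℂ)) :
    𝓢(EuclideanSpace ℝ (Fin n), ℂ) :=
  SchwartzMap.fourierMultiplierCLM ℂ
    (fun ξ : EuclideanSpace ℝ (Fin n) => ((((2 * π * ‖ξ‖) ^ (2 * m) : ℝ) : ℂ) - z)⁻¹) f

theorem iteratedDeriv_ofReal_sub_inv (z : ℂ) (hz : z.im ≠ 0) (k : ℕ) :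
    iteratedDeriv k (fun t : ℝ => ((t : ℂ) - z)⁻¹) =
      fun t : ℝ => (-1) ^ k * (k.factorial : ℂ) * (((t : ℂ) - z)⁻¹) ^ (k + 1) := by
  have hne : ∀ t : ℝ, (t : ℂ) - z ≠ 0 := by
    intro t h
    apply hz
    have := congrArg Complex.im h
    simpa using this
  have hd : ∀ t : ℝ, HasDerivAt (fun t : ℝ => ((t : ℂ) - z)⁻¹) (-(((t : ℂ) - z)⁻¹) ^ 2) t := by
    intro t
    have h1 : HasDerivAt (fun t : ℝ => (t : ℂ) - z) 1 t :=
      (Complex.ofRealCLM.hasDerivAt (x := t)).sub_const z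
    have h2 := h1.fun_inv (hne t)
    have h3 : -(((t : ℂ) - z)⁻¹) ^ 2 = -1 / ((t : ℂ) - z) ^ 2 := by
      rw [inv_pow, div_eq_mul_inv, neg_one_mul]
    rw [h3]
    exact h2
  induction k with
  | zero => ext t; simp
  | succ k ih =>
    rw [iteratedDeriv_succ, ih]
    ext t
    have h3 : HasDerivAt
        (fun t : ℝ => (-1) ^ k * (k.factorial : ℂ) * (((t : ℂ) - z)⁻¹) ^ (k + 1)) _ t :=
      ((hd t).pow (k + 1)).const_mul ((-1) ^ k * (k.factorial : ℂ))
    rw [h3.deriv]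
    push_cast [Nat.factorial_succ, Nat.add_sub_cancel]
    ring

theorem hasTemperateGrowth_ofReal_sub_inv (z : ℂ) (hz : z.im ≠ 0) :
    (fun t : ℝ => ((t : ℂ) - z)⁻¹).HasTemperateGrowth := by
  have hne : ∀ t : ℝ, (t : ℂ) - z ≠ 0 := by
    intro t h
    apply hz
    have := congrArg Complex.im h
    simpa using this
  refine ⟨?_, fun k => ⟨0, (k.factorial : ℝ) * (|z.im|⁻¹) ^ (k + 1), fun t => ?_⟩⟩
  · exact (Complex.ofRealCLM.contDiff.sub contDiff_const).inv hne
  · rw [norm_iteratedFDeriv_eq_norm_iteratedDeriv, iteratedDeriv_ofReal_sub_inv z hz]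
    have h1 : |z.im| ≤ ‖(t : ℂ) - z‖ := by
      have := Complex.abs_im_le_norm ((t : ℂ) - z)
      simpa using this
    have h2 : 0 < |z.im| := abs_pos.mpr hz
    simp only [norm_mul, norm_pow, norm_neg, norm_one, one_pow, one_mul, norm_inv,
      Complex.norm_natCast, pow_zero, mul_one]
    gcongr

theorem hasTemperateGrowth_freeSymbol {n : ℕ} (m : ℕ) :
    (fun ξ : EuclideanSpace ℝ (Fin n) => (2 * π * ‖ξ‖) ^ (2 * m)).HasTemperateGrowth := by
  have h : (fun ξ : EuclideanSpace ℝ (Fin n) => (2 * π * ‖ξ‖) ^ (2 * m)) =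
      fun ξ => ((2 * π) ^ 2 * ‖ξ‖ ^ 2) ^ m := by
    ext ξ; rw [pow_mul, mul_pow]
  rw [h]
  fun_prop

theorem hasTemperateGrowth_freeSymbol_inv {n : ℕ} (m : ℕ) (z : ℂ) (hz : z.im ≠ 0) :
    (fun ξ : EuclideanSpace ℝ (Fin n) =>
      ((((2 * π * ‖ξ‖) ^ (2 * m) : ℝ) : ℂ) - z)⁻¹).HasTemperateGrowth :=
  (hasTemperateGrowth_ofReal_sub_inv z hz).comp (hasTemperateGrowth_freeSymbol m)

theorem freeHamiltonian_eq_fourierMultiplierCLM {n : ℕ} (m : ℕ)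
    (f : 𝓢(EuclideanSpace ℝ (Fin n), ℂ)) :
    freeHamiltonian m f = SchwartzMap.fourierMultiplierCLM ℂ
      (fun ξ : EuclideanSpace ℝ (Fin n) => (((2 * π * ‖ξ‖) ^ (2 * m) : ℝ) : ℂ)) f := by
  induction m with
  | zero => simp [freeHamiltonian]
  | succ m ih =>
    have h1 : freeHamiltonian (m + 1) f = -(Δ (freeHamiltonian m f)) := by
      simp only [freeHamiltonian, Function.iterate_succ_apply']
    have ht := hasTemperateGrowth_freeSymbol (n := n) m
    have ht' := hasTemperateGrowth_freeSymbol (n := n) (m + 1)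
    have hs : (fun ξ : EuclideanSpace ℝ (Fin n) => ‖ξ‖ ^ 2).HasTemperateGrowth := by fun_prop
    rw [h1, ih, SchwartzMap.laplacian_eq_fourierMultiplierCLM]
    have e1 := SchwartzMap.fourierMultiplierCLM_ofReal (F := ℂ) ℂ ht f
    have e2 := SchwartzMap.fourierMultiplierCLM_ofReal (F := ℂ) ℂ ht' f
    simp only [Complex.coe_algebraMap] at e1 e2
    rw [e1, e2]
    have hs' : ((‖·‖ ^ 2 : EuclideanSpace ℝ (Fin n) → ℝ)).HasTemperateGrowth := hs
    rw [SchwartzMap.fourierMultiplierCLM_fourierMultiplierCLM_apply hs' ht]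
    have hm : ((‖·‖ ^ 2 : EuclideanSpace ℝ (Fin n) → ℝ) *
        fun ξ => (2 * π * ‖ξ‖) ^ (2 * m)).HasTemperateGrowth := hs'.mul ht
    have hfun : (fun ξ : EuclideanSpace ℝ (Fin n) => (2 * π * ‖ξ‖) ^ (2 * (m + 1))) =
        ((2 * π) ^ 2) • ((‖·‖ ^ 2 : EuclideanSpace ℝ (Fin n) → ℝ) *
          fun ξ => (2 * π * ‖ξ‖) ^ (2 * m)) := by
      ext ξ
      simp only [Pi.smul_apply, Pi.mul_apply, smul_eq_mul]
      ring
    rw [hfun, SchwartzMap.fourierMultiplierCLM_smul hm]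
    simp

theorem freeHamiltonian_sub_smul {n : ℕ} (m : ℕ) (z : ℂ)
    (f : 𝓢(EuclideanSpace ℝ (Fin n), ℂ)) :
    freeHamiltonian m f - z • f = SchwartzMap.fourierMultiplierCLM ℂ
      (fun ξ : EuclideanSpace ℝ (Fin n) => (((2 * π * ‖ξ‖) ^ (2 * m) : ℝ) : ℂ) - z) f := by
  have h1 := Function.Complex.hasTemperateGrowth_ofReal.comp (hasTemperateGrowth_freeSymbol (n := n) m)
  have h2 := Function.HasTemperateGrowth.const (E := EuclideanSpace ℝ (Fin n)) (-z)
  have h := SchwartzMap.fourierMultiplierCLM_sum (𝕜 := ℂ) ℂ (s := (Finset.univ : Finset (Fin 2)))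
    (g := ![fun ξ : EuclideanSpace ℝ (Fin n) => (((2 * π * ‖ξ‖) ^ (2 * m) : ℝ) : ℂ),
      fun _ => -z]) (by
        intro i _
        fin_cases i
        · exact h1
        · exact h2)
  simp only [Fin.sum_univ_two, Matrix.cons_val_zero, Matrix.cons_val_one] at h
  rw [freeHamiltonian_eq_fourierMultiplierCLM]
  simp only [sub_eq_add_neg]
  rw [h]
  simp [SchwartzMap.fourierMultiplierCLM_const]

theorem freeResolvent_left_inverse {n : ℕ} (m : ℕ) (z : ℂ) (hz : z.im ≠ 0)
    (f : 𝓢(EuclideanSpace ℝ (Fin n), ℂ)) :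
    freeResolvent m z (freeHamiltonian m f - z • f) = f := by
  have h1 := hasTemperateGrowth_freeSymbol_inv (n := n) m z hz
  have h2 : (fun ξ : EuclideanSpace ℝ (Fin n) =>
      (((2 * π * ‖ξ‖) ^ (2 * m) : ℝ) : ℂ) - z).HasTemperateGrowth :=
    (Function.Complex.hasTemperateGrowth_ofReal.comp (hasTemperateGrowth_freeSymbol (n := n) m)).sub
      (Function.HasTemperateGrowth.const z)
  rw [freeHamiltonian_sub_smul, freeResolvent,
    SchwartzMap.fourierMultiplierCLM_fourierMultiplierCLM_apply h1 h2]
  have : ((fun ξ : EuclideanSpace ℝ (Fin n) => ((((2 * π * ‖ξ‖) ^ (2 * m) : ℝ) : ℂ) - z)⁻¹) *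
      fun ξ : EuclideanSpace ℝ (Fin n) => (((2 * π * ‖ξ‖) ^ (2 * m) : ℝ) : ℂ) - z) =
      fun _ => (1 : ℂ) := by
    ext ξ
    refine inv_mul_cancel₀ fun h => hz ?_
    have := congrArg Complex.im h
    simpa only [Complex.sub_im, Complex.ofReal_im, zero_sub, neg_eq_zero, Complex.zero_im]
      using this
  rw [this]
  simp

theorem freeResolvent_right_inverse {n : ℕ} (m : ℕ) (z : ℂ) (hz : z.im ≠ 0)
    (f : 𝓢(EuclideanSpace ℝ (Fin n), ℂ)) :
    freeHamiltonian m (freeResolvent m z f) - z • freeResolvent m z f = f := by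
  have h1 := hasTemperateGrowth_freeSymbol_inv (n := n) m z hz
  have h2 : (fun ξ : EuclideanSpace ℝ (Fin n) =>
      (((2 * π * ‖ξ‖) ^ (2 * m) : ℝ) : ℂ) - z).HasTemperateGrowth :=
    (Function.Complex.hasTemperateGrowth_ofReal.comp (hasTemperateGrowth_freeSymbol (n := n) m)).sub
      (Function.HasTemperateGrowth.const z)
  rw [freeHamiltonian_sub_smul, freeResolvent,
    SchwartzMap.fourierMultiplierCLM_fourierMultiplierCLM_apply h2 h1]
  have : ((fun ξ : EuclideanSpace ℝ (Fin n) => (((2 * π * ‖ξ‖) ^ (2 * m) : ℝ) : ℂ) - z) *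
      fun ξ : EuclideanSpace ℝ (Fin n) => ((((2 * π * ‖ξ‖) ^ (2 * m) : ℝ) : ℂ) - z)⁻¹) =
      fun _ => (1 : ℂ) := by
    ext ξ
    refine mul_inv_cancel₀ fun h => hz ?_
    have := congrArg Complex.im h
    simpa only [Complex.sub_im, Complex.ofReal_im, zero_sub, neg_eq_zero, Complex.zero_im]
      using this
  rw [this]
  simp

/-- `K` is the integral kernel of the limiting free resolvent
`R₀⁺(λ^{2m}) = lim_{ε → 0+} ((-Δ)^m - (λ^{2m} + iε))⁻¹` on `ℝⁿ`: for every Schwartz function `f`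
the limit exists at every point and is given by integration of `f` against `K`.  Continuity away
from the diagonal selects the usual representative (it makes `K x y` unique for `x ≠ y`);
the values on the diagonal are irrelevant. -/
structure IsFreeResolventKernel {n : ℕ} (m : ℕ) (lam : ℝ)
    (K : EuclideanSpace ℝ (Fin n) → EuclideanSpace ℝ (Fin n) → ℂ) : Prop where
  continuousOn : ContinuousOn
    (fun p : EuclideanSpace ℝ (Fin n) × EuclideanSpace ℝ (Fin n) => K p.1 p.2)
    {p | p.1 ≠ p.2}
  integrable : ∀ (f : 𝓢(EuclideanSpace ℝ (Fin n), ℂ)) (x : EuclideanSpace ℝ (Fin n)),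
    Integrable (fun y => K x y * f y)
  tendsto : ∀ (f : 𝓢(EuclideanSpace ℝ (Fin n), ℂ)) (x : EuclideanSpace ℝ (Fin n)),
    Tendsto (fun ε : ℝ => freeResolvent m (((lam ^ (2 * m) : ℝ) : ℂ) + ε * Complex.I) f x)
      (𝓝[>] 0) (𝓝 (∫ y, K x y * f y))

/-- The Riesz kernel
`Γ((n-s)/2) / (2^s π^{n/2} Γ(s/2)) · |x-y|^{s-n}`, the kernel of `(-Δ)^{-s/2}` for `0 < s < n`. -/
def rieszKernel {n : ℕ} (s : ℝ) (x y : EuclideanSpace ℝ (Fin n)) : ℝ :=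
  Real.Gamma (((n : ℝ) - s) / 2) / (2 ^ s * π ^ ((n : ℝ) / 2) * Real.Gamma (s / 2)) *
    ‖x - y‖ ^ (s - (n : ℝ))

/-- `G₀(x,y) = a₀ |x-y|^{2m-n}`, the kernel of `R₀(0) = (-Δ)^{-m}`. -/
def kernelG0 {n : ℕ} (m : ℕ) (x y : EuclideanSpace ℝ (Fin n)) : ℝ :=
  rieszKernel (2 * (m : ℝ)) x y

/-- `G₁(x,y) = a₁ |x-y|^{4m-n}`, the kernel of `(-Δ)^{-2m}`. -/
def kernelG1 {n : ℕ} (m : ℕ) (x y : EuclideanSpace ℝ (Fin n)) : ℝ :=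
  rieszKernel (4 * (m : ℝ)) x y

/-- The error term `E(λ)(x,y) = R₀⁺(λ^{2m})(x,y) - G₀(x,y) - λ^{2m} G₁(x,y)`, where
`K lam` is the kernel of `R₀⁺(λ^{2m})`. -/
def errorKernel {n : ℕ} (m : ℕ)
    (K : ℝ → EuclideanSpace ℝ (Fin n) → EuclideanSpace ℝ (Fin n) → ℂ)
    (lam : ℝ) (x y : EuclideanSpace ℝ (Fin n)) : ℂ :=
  K lam x y - (kernelG0 m x y : ℂ) - ((lam ^ (2 * m) : ℝ) : ℂ) * (kernelG1 m x y : ℂ)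

end

/-! The expansion of the limiting resolvent `((-Δ)^m - λ^{2m} - i0)⁻¹` at low energy.

Partial fractions over the roots `(ζ e^{iπk/m})²` of `s^m = ζ^{2m}` (`inv_pow_sub_pow_eq_sum`) write
the resolvent as a combination of second-order resolvents `(-Δ + μ²)⁻¹`, `μ = -iζ e^{iπk/m}`. The
kernel of such a resolvent is `|x-y|^{2-n} H(μ|x-y|)` for a function `H` (`resolventProfile`), which
is given here by a Hankel-type integral `e^{-w} ∫ e^{-t} t^a (t + 2w)^a dt`, `a = (n-3)/2`. In
contrast with the Laplace transform of the heat kernel, this integral makes sense on the whole slit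
plane, and it yields holomorphy together with the bound `C e^{-Re w} (1 + |w|)^a`
(`exists_norm_resolventProfile_le`).

The heat kernel enters for `w > 0` only, where the subordination formula turns the Hankel integral
into the Laplace transform of the heat kernel (`resolventProfile_ofReal`). This has two consequences.
By Fubini's theorem, the integral operator agrees with the Fourier multiplier for `μ > 0`, hence by
the identity theorem for `Re μ > 0` (`fourierResolvent_eq_kernelResolvent`), and by dominated
convergence the limiting resolvent has the kernel `limitingKernel`
(`isFreeResolventKernel_limitingKernel`); any other kernel agrees with it off the diagonal
(`IsFreeResolventKernel.eq_of_ne`). And the Taylor polynomial of `H` at `0` up to degree `4m - 2` is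
even with explicit coefficients (`exists_norm_resolventProfile_sub_le`). Summation over `k` kills
all of its terms except those of degree `2m - 2` and `4m - 2`, which are exactly `G₀` and
`λ^{2m} G₁` (`leadingPart_eq`).

The error term is therefore holomorphic in `λ` on the right half-plane and its derivatives are
controlled by Cauchy's estimate (`exists_pow_mul_norm_iteratedDeriv_le`). With `r = |x-y|`: if
`λr ≤ 1`, the Taylor remainder of `H` is used on a disc of radius `λ/4`; if `λr ≥ 1`, the size of
`H` is used on a disc of radius `1/(4r)`, on which the growth of `e^{iζr}` is bounded. -/

/-! ### Holomorphic parameter integrals -/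

/-- A locally dominated integral of holomorphic functions is holomorphic; Cauchy's estimate turns
the bound on the functions into the bound on their derivatives. -/
theorem differentiableOn_integral_of_locally_dominated {α : Type*} [MeasurableSpace α]
    {μ : Measure α} {U : Set ℂ} (hU : IsOpen U) {F : ℂ → α → ℂ}
    (hmeas : ∀ w ∈ U, AEStronglyMeasurable (F w) μ)
    (hdiff : ∀ᵐ a ∂μ, DifferentiableOn ℂ (fun w => F w a) U)
    (hbound : ∀ w ∈ U, ∃ r : ℝ, 0 < r ∧ ∃ g : α → ℝ, Integrable g μ ∧
      ∀ᵐ a ∂μ, ∀ w' ∈ U, dist w' w < r → ‖F w' a‖ ≤ g a) :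
    DifferentiableOn ℂ (fun w => ∫ a, F w a ∂μ) U := by
  intro w hw
  obtain ⟨r, hr, g, hg, hgb⟩ := hbound w hw
  obtain ⟨R, hR, hRU⟩ := Metric.isOpen_iff.1 hU w hw
  set s := min r R / 3 with hs
  have hs0 : 0 < s := by positivity
  have hsr : s + s < r := by have := min_le_left r R; linarith
  have hsR : s + s < R := by have := min_le_right r R; linarith
  have hball : ∀ w', dist w' w < R → w' ∈ U := fun w' h => hRU h
  have key : ∀ᵐ a ∂μ, ∀ x ∈ Metric.ball w s, ‖deriv (fun w => F w a) x‖ ≤ g a / s := by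
    filter_upwards [hdiff, hgb] with a hda hba x hx
    have hx' : dist x w < s := hx
    apply Complex.norm_deriv_le_of_forall_mem_sphere_norm_le hs0
    · apply DifferentiableOn.diffContOnCl_ball (U := U) hda
      intro z hz
      apply hball
      have := dist_triangle z x w
      have hz' : dist z x ≤ s := hz
      linarith
    · intro z hz
      have hz' : dist z x = s := hz
      have := dist_triangle z x w
      exact hba z (hball z (by linarith)) (by linarith)
  have hderiv : ∀ᵐ a ∂μ, ∀ x ∈ Metric.ball w s,
      HasDerivAt (fun w => F w a) (deriv (fun w => F w a) x) x := by
    filter_upwards [hdiff] with a hda x hx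
    have hx' : dist x w < s := hx
    exact (hda.differentiableAt (hU.mem_nhds (hball x (by linarith)))).hasDerivAt
  have hseq : Tendsto (fun k : ℕ => ((s / 2 / ((k : ℝ) + 1) : ℝ) : ℂ)) atTop (𝓝[≠] 0) := by
    apply tendsto_nhdsWithin_iff.2 ⟨?_, ?_⟩
    · have : Tendsto (fun k : ℕ => s / 2 / ((k : ℝ) + 1)) atTop (𝓝 0) :=
        tendsto_const_nhds.div_atTop
          (tendsto_atTop_add_const_right _ _ tendsto_natCast_atTop_atTop)
      have h2 := (Complex.continuous_ofReal.tendsto 0).comp this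
      rw [Complex.ofReal_zero] at h2
      exact h2
    · refine Eventually.of_forall fun k => ?_
      have : s / 2 / ((k : ℝ) + 1) ≠ 0 := by positivity
      simpa only [mem_compl_iff, mem_singleton_iff, Complex.ofReal_eq_zero] using this
  have hmeas' : AEStronglyMeasurable (fun a => deriv (fun w => F w a) w) μ := by
    refine aestronglyMeasurable_of_tendsto_ae atTop
      (f := fun (k : ℕ) a => ((s / 2 / ((k : ℝ) + 1) : ℝ) : ℂ)⁻¹ •
        (F (w + ((s / 2 / ((k : ℝ) + 1) : ℝ) : ℂ)) a - F w a)) ?_ ?_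
    · intro k
      suffices h : AEStronglyMeasurable
          (F (w + ((s / 2 / ((k : ℝ) + 1) : ℝ) : ℂ)) - F w) μ from
        h.const_smul (((s / 2 / ((k : ℝ) + 1) : ℝ) : ℂ)⁻¹)
      refine (hmeas _ (hball _ ?_)).sub (hmeas w hw)
      have h1 : s / 2 / ((k : ℝ) + 1) ≤ s / 2 := div_le_self (by positivity) (by simp)
      have h0 : 0 ≤ s / 2 / ((k : ℝ) + 1) := by positivity
      rw [dist_eq_norm, add_sub_cancel_left, Complex.norm_real, Real.norm_of_nonneg h0]
      linarith
    · filter_upwards [hderiv] with a ha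
      exact (ha w (Metric.mem_ball_self hs0)).tendsto_slope_zero.comp hseq
  refine (hasDerivAt_integral_of_dominated_loc_of_deriv_le (bound := fun a => g a / s)
    (F' := fun x a => deriv (fun w => F w a) x) (Metric.ball_mem_nhds w hs0)
    ?_ ?_ hmeas' key (hg.div_const s) hderiv).2.differentiableAt.differentiableWithinAt
  · filter_upwards [hU.mem_nhds hw] with x hx using hmeas x hx
  · refine hg.mono' (hmeas w hw) ?_
    filter_upwards [hgb] with a ha
    exact ha w hw (by simpa using hr)

/-! ### The radial profile of the free resolvent -/

/-- The Hankel-type integral `∫₀^∞ e^{-t} t^a (t + 2w)^a dt`, with the principal branch of the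
complex power. -/
noncomputable def hankelIntegral (a : ℝ) (w : ℂ) : ℂ :=
  ∫ t in Ioi (0 : ℝ), ((rexp (-t) * t ^ a : ℝ) : ℂ) * ((t : ℂ) + 2 * w) ^ (a : ℂ)

theorem norm_ofReal_add_cpow_le {a : ℝ} (ha : 0 ≤ a) {t : ℝ} (ht : 0 ≤ t) (w : ℂ) :
    ‖((t : ℂ) + 2 * w) ^ (a : ℂ)‖ ≤ (t + 2 * ‖w‖) ^ a := by
  rw [Complex.norm_cpow_real]
  refine Real.rpow_le_rpow (norm_nonneg _) ?_ ha
  refine (norm_add_le _ _).trans ?_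
  rw [Complex.norm_real, Real.norm_of_nonneg ht, norm_mul, Complex.norm_ofNat]

theorem norm_hankelIntegrand_le {a : ℝ} (ha : 0 ≤ a) {t : ℝ} (ht : 0 ≤ t) (w : ℂ) :
    ‖((rexp (-t) * t ^ a : ℝ) : ℂ) * ((t : ℂ) + 2 * w) ^ (a : ℂ)‖ ≤
      rexp (-t) * t ^ a * (t + 2 * ‖w‖) ^ a := by
  rw [norm_mul, Complex.norm_real, Real.norm_of_nonneg (by positivity)]
  exact mul_le_mul_of_nonneg_left (norm_ofReal_add_cpow_le ha ht w) (by positivity)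

theorem integrableOn_exp_neg_mul_rpow {s : ℝ} (hs : -1 < s) :
    IntegrableOn (fun t : ℝ => rexp (-t) * t ^ s) (Ioi 0) := by
  have := Real.GammaIntegral_convergent (s := s + 1) (by linarith)
  simpa using this

theorem integrableOn_hankelMajorant {a : ℝ} (ha : 0 ≤ a) {c : ℝ} (hc : 0 ≤ c) :
    IntegrableOn (fun t : ℝ => rexp (-t) * t ^ a * (t + c) ^ a) (Ioi 0) := by
  have h1 := (integrableOn_exp_neg_mul_rpow (s := a + a) (by linarith)).const_mul (2 ^ a)
  have h2 := (integrableOn_exp_neg_mul_rpow (s := a) (by linarith)).const_mul ((2 * c) ^ a)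
  refine (h1.add h2).mono' (by fun_prop) ?_
  refine (ae_restrict_iff' measurableSet_Ioi).2 (Eventually.of_forall fun t ht => ?_)
  have ht0 : 0 < t := ht
  rw [Real.norm_of_nonneg (by positivity)]
  have hsum : (t + c) ^ a ≤ (2 * t) ^ a + (2 * c) ^ a := by
    rcases le_total t c with h | h
    · have : (t + c) ^ a ≤ (2 * c) ^ a := Real.rpow_le_rpow (by positivity) (by linarith) ha
      have h0 : 0 ≤ (2 * t) ^ a := by positivity
      linarith
    · have : (t + c) ^ a ≤ (2 * t) ^ a := Real.rpow_le_rpow (by positivity) (by linarith) ha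
      have h0 : 0 ≤ (2 * c) ^ a := by positivity
      linarith
  calc rexp (-t) * t ^ a * (t + c) ^ a
      ≤ rexp (-t) * t ^ a * ((2 * t) ^ a + (2 * c) ^ a) := by gcongr
    _ = _ := by
      simp only [Pi.add_apply]
      rw [Real.mul_rpow (by norm_num) ht0.le, Real.rpow_add ht0]
      ring

theorem measurable_hankelIntegrand (a : ℝ) (w : ℂ) :
    Measurable fun t : ℝ => ((rexp (-t) * t ^ a : ℝ) : ℂ) * ((t : ℂ) + 2 * w) ^ (a : ℂ) := by
  fun_prop

theorem integrableOn_hankelIntegrand {a : ℝ} (ha : 0 ≤ a) (w : ℂ) :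
    IntegrableOn (fun t : ℝ => ((rexp (-t) * t ^ a : ℝ) : ℂ) * ((t : ℂ) + 2 * w) ^ (a : ℂ))
      (Ioi 0) := by
  refine (integrableOn_hankelMajorant ha (c := 2 * ‖w‖) (by positivity)).mono'
    (measurable_hankelIntegrand a w).aestronglyMeasurable ?_
  refine (ae_restrict_iff' measurableSet_Ioi).2 (Eventually.of_forall fun t ht => ?_)
  exact norm_hankelIntegrand_le ha (le_of_lt ht) w

theorem exists_norm_hankelIntegral_le {a : ℝ} (ha : 0 ≤ a) :
    ∃ C : ℝ, 0 < C ∧ ∀ w : ℂ, ‖hankelIntegral a w‖ ≤ C * (1 + ‖w‖) ^ a := by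
  set I := ∫ t in Ioi (0 : ℝ), rexp (-t) * t ^ a * (t + 2) ^ a with hI
  have hI0 : 0 ≤ I := setIntegral_nonneg measurableSet_Ioi fun t ht => by
    have ht0 : 0 < t := ht
    positivity
  refine ⟨I + 1, by positivity, fun w => ?_⟩
  have hint := (integrableOn_hankelMajorant ha (c := 2) (by norm_num)).mul_const ((1 + ‖w‖) ^ a)
  refine (norm_integral_le_of_norm_le hint ?_).trans ?_
  · refine (ae_restrict_iff' measurableSet_Ioi).2 (Eventually.of_forall fun t ht => ?_)
    have ht0 : 0 < t := ht
    refine (norm_hankelIntegrand_le ha ht0.le w).trans ?_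
    rw [mul_assoc (rexp (-t) * t ^ a), ← Real.mul_rpow (by positivity) (by positivity)]
    refine mul_le_mul_of_nonneg_left (Real.rpow_le_rpow (by positivity) ?_ ha) (by positivity)
    have := mul_nonneg ht0.le (norm_nonneg w)
    linarith
  · rw [integral_mul_const]
    gcongr
    linarith

theorem ofReal_add_mem_slitPlane {w : ℂ} (hw : w ∈ Complex.slitPlane) {t : ℝ} (ht : 0 < t) :
    (t : ℂ) + 2 * w ∈ Complex.slitPlane := by
  rw [Complex.mem_slitPlane_iff] at hw ⊢
  rcases hw with h | h
  · left
    simp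
    linarith
  · right
    simpa using h

theorem differentiableOn_hankelIntegral {a : ℝ} (ha : 0 ≤ a) :
    DifferentiableOn ℂ (hankelIntegral a) Complex.slitPlane := by
  refine differentiableOn_integral_of_locally_dominated Complex.isOpen_slitPlane ?_ ?_ ?_
  · exact fun w _ => (measurable_hankelIntegrand a w).aestronglyMeasurable
  · refine (ae_restrict_iff' measurableSet_Ioi).2 (Eventually.of_forall fun t ht w hw => ?_)
    have hd : DifferentiableAt ℂ (fun w : ℂ => (t : ℂ) + 2 * w) w := by fun_prop
    exact ((hd.cpow_const (ofReal_add_mem_slitPlane hw ht)).const_mul _).differentiableWithinAt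
  · intro w _
    refine ⟨1, one_pos, fun t => rexp (-t) * t ^ a * (t + 2 * (‖w‖ + 1)) ^ a,
      integrableOn_hankelMajorant ha (by positivity), ?_⟩
    refine (ae_restrict_iff' measurableSet_Ioi).2 (Eventually.of_forall fun t ht w' _ hd => ?_)
    have ht0 : 0 < t := ht
    refine (norm_hankelIntegrand_le ha ht0.le w').trans ?_
    have : ‖w'‖ ≤ ‖w‖ + 1 := by
      have := norm_le_norm_add_norm_sub' w' w
      rw [← dist_eq_norm] at this
      linarith
    refine mul_le_mul_of_nonneg_left (Real.rpow_le_rpow (by positivity) ?_ ha) (by positivity)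
    linarith

/-- The normalization that makes `resolventProfile` the profile of the resolvent kernel. -/
noncomputable def profileConst (n : ℕ) : ℝ :=
  (4 * π) ^ (-((n : ℝ) / 2)) * (2 * √π) / Real.Gamma (((n : ℝ) - 1) / 2)

/-- The profile `H` of the free resolvent on `ℝⁿ`: the kernel of `(-Δ + μ²)⁻¹`, `Re μ > 0`, is
`|x-y|^{2-n} H(μ|x-y|)`. -/
noncomputable def resolventProfile (n : ℕ) (w : ℂ) : ℂ :=
  (profileConst n : ℂ) * Complex.exp (-w) * hankelIntegral (((n : ℝ) - 3) / 2) w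

theorem profileConst_pos {n : ℕ} (hn : 3 ≤ n) : 0 < profileConst n := by
  have hn' : (3 : ℝ) ≤ n := by exact_mod_cast hn
  have : 0 < Real.Gamma (((n : ℝ) - 1) / 2) := Real.Gamma_pos_of_pos (by linarith)
  unfold profileConst
  positivity

theorem profileExponent_nonneg {n : ℕ} (hn : 3 ≤ n) : 0 ≤ ((n : ℝ) - 3) / 2 := by
  have hn' : (3 : ℝ) ≤ n := by exact_mod_cast hn
  linarith

theorem differentiableOn_resolventProfile {n : ℕ} (hn : 3 ≤ n) :
    DifferentiableOn ℂ (resolventProfile n) Complex.slitPlane := by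
  have h := differentiableOn_hankelIntegral (profileExponent_nonneg hn)
  unfold resolventProfile
  fun_prop

/-- The bound holds on the whole plane, including the cut of the principal branch. -/
theorem exists_norm_resolventProfile_le {n : ℕ} (hn : 3 ≤ n) :
    ∃ C : ℝ, 0 < C ∧ ∀ w : ℂ,
      ‖resolventProfile n w‖ ≤ C * rexp (-w.re) * (1 + ‖w‖) ^ (((n : ℝ) - 3) / 2) := by
  obtain ⟨C, hC, h⟩ := exists_norm_hankelIntegral_le (profileExponent_nonneg hn)
  refine ⟨profileConst n * C, mul_pos (profileConst_pos hn) hC, fun w => ?_⟩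
  rw [resolventProfile, norm_mul, norm_mul, Complex.norm_real,
    Real.norm_of_nonneg (profileConst_pos hn).le, Complex.norm_exp, Complex.neg_re]
  have := mul_le_mul_of_nonneg_left (h w)
    (mul_nonneg (profileConst_pos hn).le (Real.exp_pos (-w.re)).le)
  refine this.trans (le_of_eq ?_)
  ring

/-! ### The heat kernel representation of the profile -/

theorem integral_mul_div_sqrt_eq_zero {c : ℝ} :
    ∫ s : ℝ, s / √(s ^ 2 + c) * rexp (-s ^ 2) = 0 := by
  have h := integral_neg_eq_self (fun s : ℝ => s / √(s ^ 2 + c) * rexp (-s ^ 2)) volume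
  have h2 : ∀ s : ℝ, (-s) / √((-s) ^ 2 + c) * rexp (-(-s) ^ 2) =
      -(s / √(s ^ 2 + c) * rexp (-s ^ 2)) := by
    intro s
    rw [neg_sq]
    ring
  simp only [h2, integral_neg] at h
  linarith

theorem integrable_mul_div_sqrt {c : ℝ} (hc : 0 < c) :
    Integrable fun s : ℝ => s / √(s ^ 2 + c) * rexp (-s ^ 2) := by
  have hg : Integrable fun s : ℝ => rexp (-s ^ 2) := by
    simpa using integrable_exp_neg_mul_sq (b := 1) one_pos
  refine hg.mono' (by fun_prop) (Eventually.of_forall fun s => ?_)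
  rw [norm_mul, Real.norm_of_nonneg (Real.exp_pos _).le]
  refine mul_le_of_le_one_left (Real.exp_pos _).le ?_
  rw [norm_div, Real.norm_of_nonneg (Real.sqrt_nonneg _), Real.norm_eq_abs]
  refine div_le_one_of_le₀ ?_ (Real.sqrt_nonneg _)
  rw [← Real.sqrt_sq_eq_abs]
  exact Real.sqrt_le_sqrt (by linarith)

/-- The subordination formula that writes `e^{-u}/u` as a superposition of Gaussians `e^{-tu²}`.
The substitution `√t = (s + √(s² + 2u)) / (2u)`, that is `s = u√t - 1/(2√t)`, turns the exponent
into `-s² - u`; the Jacobian is a constant plus an odd function. -/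
theorem integrableOn_and_integral_subordination {u : ℝ} (hu : 0 < u) :
    IntegrableOn (fun t : ℝ => t ^ (-(1 / 2) : ℝ) * rexp (-1 / (4 * t)) * rexp (-t * u ^ 2))
      (Ioi 0) ∧
    ∫ t in Ioi (0 : ℝ), t ^ (-(1 / 2) : ℝ) * rexp (-1 / (4 * t)) * rexp (-t * u ^ 2) =
      √π * rexp (-u) / u := by
  set R : ℝ → ℝ := fun s => √(s ^ 2 + 2 * u) with hR
  have hRpos : ∀ s, 0 < R s := fun s => Real.sqrt_pos.2 (by positivity)
  have hRsq : ∀ s, R s ^ 2 = s ^ 2 + 2 * u := fun s => Real.sq_sqrt (by positivity)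
  set X : ℝ → ℝ := fun s => (s + R s) / (2 * u) with hX
  have hXpos : ∀ s, 0 < X s := by
    intro s
    have : |s| < R s := by
      rw [← Real.sqrt_sq_eq_abs]
      exact Real.sqrt_lt_sqrt (sq_nonneg s) (by linarith)
    have := neg_abs_le s
    refine div_pos (by linarith) (by linarith)
  have hquad : ∀ s, u * X s ^ 2 = s * X s + 1 / 2 := by
    intro s
    have h := hRsq s
    simp only [hX]
    field_simp
    linear_combination h
  have hRd : ∀ s, HasDerivAt R (s / R s) s := by
    intro s
    have h1 : HasDerivAt (fun s : ℝ => s ^ 2 + 2 * u) (2 * s) s := by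
      simpa using (hasDerivAt_pow 2 s).add_const (2 * u)
    have h2 := h1.sqrt (by positivity)
    convert h2 using 1
    have := (hRpos s).ne'
    change s / R s = 2 * s / (2 * R s)
    field_simp
  have hXd : ∀ s, HasDerivAt X (X s / R s) s := by
    intro s
    have h := ((hasDerivAt_id s).add (hRd s)).div_const (2 * u)
    refine h.congr_deriv ?_
    have := (hRpos s).ne'
    change (1 + s / R s) / (2 * u) = (s + R s) / (2 * u) / R s
    field_simp
    ring
  have hTd : ∀ s ∈ (univ : Set ℝ), HasDerivWithinAt (fun s => X s ^ 2) (2 * X s ^ 2 / R s) univ s := by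
    intro s _
    have h := (hXd s).pow 2
    refine (h.congr_deriv ?_).hasDerivWithinAt
    simp
    ring
  have hinv : ∀ s, s = u * X s - 1 / (2 * X s) := by
    intro s
    have h := hquad s
    have h0 := (hXpos s).ne'
    field_simp
    linear_combination -2 * h
  have hinj : InjOn (fun s => X s ^ 2) univ := by
    intro s _ s' _ h
    have h' : X s = X s' := (pow_left_inj₀ (hXpos s).le (hXpos s').le (by norm_num)).1 h
    rw [hinv s, hinv s', h']
  have himg : (fun s => X s ^ 2) '' univ = Ioi 0 := by
    ext t
    constructor
    · rintro ⟨s, _, rfl⟩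
      exact pow_pos (hXpos s) 2
    · intro ht
      have ht0 : 0 < √t := Real.sqrt_pos.2 ht
      refine ⟨u * √t - 1 / (2 * √t), mem_univ _, ?_⟩
      have hRs : R (u * √t - 1 / (2 * √t)) = u * √t + 1 / (2 * √t) := by
        simp only [hR]
        rw [Real.sqrt_eq_iff_mul_self_eq (by positivity) (by positivity)]
        field_simp
        ring
      simp only [hX]
      rw [hRs]
      have : (u * √t - 1 / (2 * √t) + (u * √t + 1 / (2 * √t))) / (2 * u) = √t := by
        field_simp
        ring
      rw [this, Real.sq_sqrt (le_of_lt ht)]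
  have hpull : ∀ s, |2 * X s ^ 2 / R s| • ((X s ^ 2) ^ (-(1 / 2) : ℝ) *
      rexp (-1 / (4 * X s ^ 2)) * rexp (-(X s ^ 2) * u ^ 2)) =
      rexp (-u) / u * (rexp (-s ^ 2) + s / √(s ^ 2 + 2 * u) * rexp (-s ^ 2)) := by
    intro s
    have hx := hXpos s
    have hr := hRpos s
    rw [abs_of_pos (by positivity), smul_eq_mul]
    have e1 : (X s ^ 2) ^ (-(1 / 2) : ℝ) = (X s)⁻¹ := by
      rw [← Real.rpow_natCast, ← Real.rpow_mul hx.le, ← Real.rpow_neg_one]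
      norm_num
    have e2 : rexp (-1 / (4 * X s ^ 2)) * rexp (-(X s ^ 2) * u ^ 2) =
        rexp (-u) * rexp (-s ^ 2) := by
      rw [← Real.exp_add, ← Real.exp_add]
      congr 1
      have h := hinv s
      have h2 : s ^ 2 = (u * X s - 1 / (2 * X s)) ^ 2 := by rw [← h]
      rw [h2]
      field_simp
      ring
    have e3 : 2 * X s / R s = (1 + s / R s) / u := by
      simp only [hX]
      field_simp
      ring
    calc 2 * X s ^ 2 / R s * ((X s ^ 2) ^ (-(1 / 2) : ℝ) *
          rexp (-1 / (4 * X s ^ 2)) * rexp (-(X s ^ 2) * u ^ 2))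
        = 2 * X s ^ 2 / R s * (X s)⁻¹ * (rexp (-1 / (4 * X s ^ 2)) * rexp (-(X s ^ 2) * u ^ 2)) := by
          rw [e1]; ring
      _ = (2 * X s / R s) * (rexp (-u) * rexp (-s ^ 2)) := by
          rw [e2]
          field_simp
      _ = _ := by
          rw [e3]
          ring
  have hgi : Integrable fun s : ℝ => rexp (-s ^ 2) := by
    simpa using integrable_exp_neg_mul_sq (b := 1) one_pos
  have hg : ∫ s : ℝ, rexp (-s ^ 2) = √π := by simpa using integral_gaussian 1
  have hoi := integrable_mul_div_sqrt (c := 2 * u) (by positivity)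
  constructor
  · rw [← himg, integrableOn_image_iff_integrableOn_abs_deriv_smul MeasurableSet.univ hTd hinj,
      integrableOn_univ]
    simp only [hpull]
    exact (hgi.add hoi).const_mul _
  · rw [← himg, integral_image_eq_integral_abs_deriv_smul MeasurableSet.univ hTd hinj]
    simp only [hpull, Measure.restrict_univ]
    rw [integral_const_mul, integral_add hgi hoi, hg, integral_mul_div_sqrt_eq_zero]
    ring

/-- The substitution `q = v(v + 2w)`, `q + w² = (v + w)²`. -/
theorem integral_gaussian_mul_rpow {a : ℝ} (ha : 0 ≤ a) {w : ℝ} (hw : 0 < w) {t : ℝ} (ht : 0 < t) :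
    ∫ v in Ioi (0 : ℝ), (v + w) * (v * (v + 2 * w)) ^ a * rexp (-t * (v + w) ^ 2) =
      1 / 2 * rexp (-t * w ^ 2) * ((1 / t) ^ (a + 1) * Real.Gamma (a + 1)) := by
  have hd : ∀ v ∈ Ioi (0 : ℝ), HasDerivWithinAt (fun v => v * (v + 2 * w)) (2 * (v + w))
      (Ioi 0) v := by
    intro v _
    refine (((hasDerivAt_id' v).mul ((hasDerivAt_id' v).add_const (2 * w))).congr_deriv
      ?_).hasDerivWithinAt
    ring
  have hinj : InjOn (fun v => v * (v + 2 * w)) (Ioi 0) := by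
    intro v hv v' hv' h
    have hv0 : 0 < v := hv
    have hv0' : 0 < v' := hv'
    have h1 : v * (v + 2 * w) = v' * (v' + 2 * w) := h
    have h2 : (v - v') * (v + v' + 2 * w) = 0 := by linear_combination h1
    rcases mul_eq_zero.1 h2 with h3 | h3
    · linarith
    · linarith
  have himg : (fun v => v * (v + 2 * w)) '' Ioi 0 = Ioi 0 := by
    ext q
    constructor
    · rintro ⟨v, hv, rfl⟩
      have hv0 : 0 < v := hv
      show 0 < v * (v + 2 * w)
      positivity
    · intro hq
      have hq0 : 0 < q := hq
      have hs : √(q + w ^ 2) ^ 2 = q + w ^ 2 := Real.sq_sqrt (by positivity)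
      refine ⟨√(q + w ^ 2) - w, ?_, ?_⟩
      · show 0 < √(q + w ^ 2) - w
        have : w < √(q + w ^ 2) := Real.lt_sqrt_of_sq_lt (by linarith)
        linarith
      · show (√(q + w ^ 2) - w) * (√(q + w ^ 2) - w + 2 * w) = q
        linear_combination hs
  have h := integral_image_eq_integral_abs_deriv_smul measurableSet_Ioi hd hinj
    (fun q => q ^ (a + 1 - 1) * rexp (-(t * q)))
  rw [himg, Real.integral_rpow_mul_exp_neg_mul_Ioi (by linarith) ht] at h
  rw [h, ← integral_const_mul]
  refine setIntegral_congr_fun measurableSet_Ioi fun v hv => ?_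
  have hv0 : 0 < v := hv
  simp only [smul_eq_mul]
  rw [abs_of_pos (by positivity), add_sub_cancel_right]
  have : rexp (-t * (v + w) ^ 2) = rexp (-t * w ^ 2) * rexp (-(t * (v * (v + 2 * w)))) := by
    rw [← Real.exp_add]
    congr 1
    ring
  rw [this]
  ring

/-- The heat kernel `(4πt)^{-n/2} e^{-r²/(4t)}` of `ℝⁿ` at distance `r = 1`. -/
noncomputable def heatProfile (n : ℕ) (t : ℝ) : ℝ :=
  (4 * π * t) ^ (-((n : ℝ) / 2)) * rexp (-1 / (4 * t))

theorem integral_exp_neg_mul_hankelMajorant {a : ℝ} (ha : 0 ≤ a) {w : ℝ} (hw : 0 < w) :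
    √π * rexp (-w) * ∫ v in Ioi (0 : ℝ), rexp (-v) * v ^ a * (v + 2 * w) ^ a =
      Real.Gamma (a + 1) / 2 * ∫ t in Ioi (0 : ℝ),
        t ^ (-(a + 3 / 2)) * rexp (-1 / (4 * t)) * rexp (-t * w ^ 2) := by
  set F : ℝ → ℝ → ℝ := fun v t => (v + w) * (v * (v + 2 * w)) ^ a *
    (t ^ (-(1 / 2) : ℝ) * rexp (-1 / (4 * t)) * rexp (-t * (v + w) ^ 2)) with hF
  have hFnn : ∀ v ∈ Ioi (0 : ℝ), ∀ t ∈ Ioi (0 : ℝ), 0 ≤ F v t := by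
    intro v hv t ht
    have hv0 : 0 < v := hv
    have ht0 : 0 < t := ht
    simp only [hF]
    positivity
  have hinner : ∀ v ∈ Ioi (0 : ℝ), ∫ t in Ioi (0 : ℝ), F v t =
      √π * rexp (-w) * (rexp (-v) * v ^ a * (v + 2 * w) ^ a) := by
    intro v hv
    have hv0 : 0 < v := hv
    simp only [hF]
    rw [integral_const_mul, (integrableOn_and_integral_subordination (u := v + w) (by positivity)).2,
      Real.mul_rpow hv0.le (by positivity), neg_add, Real.exp_add]
    field_simp
  have hint : Integrable (Function.uncurry F)
      ((volume.restrict (Ioi (0 : ℝ))).prod (volume.restrict (Ioi (0 : ℝ)))) := by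
    have hmeas : AEStronglyMeasurable (Function.uncurry F)
        ((volume.restrict (Ioi (0 : ℝ))).prod (volume.restrict (Ioi (0 : ℝ)))) := by
      simp only [hF, Function.uncurry_def]
      exact Measurable.aestronglyMeasurable (by fun_prop)
    rw [integrable_prod_iff hmeas]
    constructor
    · refine (ae_restrict_iff' measurableSet_Ioi).2 (Eventually.of_forall fun v hv => ?_)
      have hv0 : 0 < v := hv
      exact (integrableOn_and_integral_subordination (u := v + w) (by positivity)).1.const_mul
        ((v + w) * (v * (v + 2 * w)) ^ a)
    · refine ((integrableOn_hankelMajorant ha (c := 2 * w) (by positivity)).const_mul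
        (√π * rexp (-w))).congr ?_
      refine (ae_restrict_iff' measurableSet_Ioi).2 (Eventually.of_forall fun v hv => ?_)
      refine (hinner v hv).symm.trans ?_
      refine setIntegral_congr_fun measurableSet_Ioi fun t ht => ?_
      exact (Real.norm_of_nonneg (hFnn v hv t ht)).symm
  have hswap := integral_integral_swap hint
  rw [setIntegral_congr_fun measurableSet_Ioi hinner, integral_const_mul] at hswap
  rw [hswap, ← integral_const_mul]
  refine setIntegral_congr_fun measurableSet_Ioi fun t ht => ?_
  have ht0 : 0 < t := ht
  have e1 : ∀ v, F v t = t ^ (-(1 / 2) : ℝ) * rexp (-1 / (4 * t)) *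
      ((v + w) * (v * (v + 2 * w)) ^ a * rexp (-t * (v + w) ^ 2)) := by
    intro v
    simp only [hF]
    ring
  simp only [e1]
  rw [integral_const_mul, integral_gaussian_mul_rpow ha hw ht0]
  have e2 : t ^ (-(a + 3 / 2)) = t ^ (-(1 / 2) : ℝ) * (1 / t) ^ (a + 1) := by
    rw [one_div t, Real.inv_rpow ht0.le, ← Real.rpow_neg ht0.le, ← Real.rpow_add ht0]
    congr 1
    ring
  rw [e2]
  ring

/-- On the positive half-line the profile is the Laplace transform of the heat kernel. -/
theorem resolventProfile_ofReal {n : ℕ} (hn : 3 ≤ n) {w : ℝ} (hw : 0 < w) :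
    resolventProfile n w =
      ((∫ t in Ioi (0 : ℝ), heatProfile n t * rexp (-t * w ^ 2) : ℝ) : ℂ) := by
  have ha := profileExponent_nonneg hn
  have hI : hankelIntegral (((n : ℝ) - 3) / 2) w = ((∫ v in Ioi (0 : ℝ),
      rexp (-v) * v ^ (((n : ℝ) - 3) / 2) * (v + 2 * w) ^ (((n : ℝ) - 3) / 2) : ℝ) : ℂ) := by
    rw [hankelIntegral, ← integral_complex_ofReal]
    refine setIntegral_congr_fun measurableSet_Ioi fun v hv => ?_
    have hv0 : 0 < v := hv
    rw [Complex.ofReal_mul _ ((v + 2 * w) ^ _), Complex.ofReal_cpow (by positivity)]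
    push_cast
    rfl
  have hG : 0 < Real.Gamma (((n : ℝ) - 1) / 2) := Real.Gamma_pos_of_pos (by linarith)
  have hmain := integral_exp_neg_mul_hankelMajorant ha hw
  have e1 : ((n : ℝ) - 3) / 2 + 1 = ((n : ℝ) - 1) / 2 := by ring
  have e2 : -(((n : ℝ) - 3) / 2 + 3 / 2) = -((n : ℝ) / 2) := by ring
  rw [e1, e2] at hmain
  have hheat : ∫ t in Ioi (0 : ℝ), heatProfile n t * rexp (-t * w ^ 2) =
      (4 * π) ^ (-((n : ℝ) / 2)) * ∫ t in Ioi (0 : ℝ),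
        t ^ (-((n : ℝ) / 2)) * rexp (-1 / (4 * t)) * rexp (-t * w ^ 2) := by
    rw [← integral_const_mul]
    refine setIntegral_congr_fun measurableSet_Ioi fun t ht => ?_
    have ht0 : 0 < t := ht
    simp only [heatProfile]
    rw [Real.mul_rpow (by positivity) ht0.le]
    ring
  rw [resolventProfile, hI, hheat, ← Complex.ofReal_neg, ← Complex.ofReal_exp, ← Complex.ofReal_mul,
    ← Complex.ofReal_mul, profileConst]
  congr 1
  have hpi : √π * √π = π := Real.mul_self_sqrt Real.pi_pos.le
  have hpi0 : 0 < √π := Real.sqrt_pos.2 Real.pi_pos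
  set A := (4 * π) ^ (-((n : ℝ) / 2))
  set J := ∫ t in Ioi (0 : ℝ), t ^ (-((n : ℝ) / 2)) * rexp (-1 / (4 * t)) * rexp (-t * w ^ 2)
  field_simp
  linear_combination 2 * A * hmain

/-! ### Expansion of the profile at the origin -/

theorem exists_norm_sub_taylor_le {f : ℂ → ℂ} (hf : AnalyticAt ℂ f 0) (J : ℕ) :
    ∃ b : ℕ → ℂ, ∃ C η : ℝ, 0 < C ∧ 0 < η ∧ η ≤ 1 ∧ ∀ z : ℂ, ‖z‖ < η →
      ‖f z - ∑ j ∈ Finset.range J, b j * z ^ j‖ ≤ C * ‖z‖ ^ J := by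
  obtain ⟨p, hp⟩ := hf
  obtain ⟨C, hC, h⟩ := (hp.isBigO_sub_partialSum_pow J).exists_pos
  rw [Asymptotics.IsBigOWith, Metric.eventually_nhds_iff] at h
  obtain ⟨η, hη, h⟩ := h
  refine ⟨p.coeff, C, min η 1, hC, by positivity, min_le_right _ _, fun z hz => ?_⟩
  have h1 := h (y := z) (by simpa using hz.trans_le (min_le_left _ _))
  have h2 : p.partialSum J z = ∑ j ∈ Finset.range J, p.coeff j * z ^ j := by
    refine Finset.sum_congr rfl fun j _ => ?_
    rw [FormalMultilinearSeries.apply_eq_pow_smul_coeff, smul_eq_mul, mul_comm]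
  rw [zero_add, h2] at h1
  simpa using h1

/-- A polynomial of degree at most `J - 1` that is `O(w^β)` as `w → 0+` with `β > J - 1` vanishes. -/
theorem coeff_eq_zero_of_norm_sum_le {d : ℕ → ℂ} {J : ℕ} {β C η : ℝ} (hβ : (J : ℝ) - 1 < β)
    (hη : 0 < η) (h : ∀ w : ℝ, 0 < w → w < η →
      ‖∑ j ∈ Finset.range J, d j * (w : ℂ) ^ j‖ ≤ C * w ^ β) :
    ∀ j < J, d j = 0 := by
  intro j
  induction j using Nat.strong_induction_on with
  | _ j ih =>
    intro hj
    have hjβ : 0 < β - j := by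
      have : (j : ℝ) + 1 ≤ J := by exact_mod_cast hj
      linarith
    set S : ℝ → ℂ := fun w => ∑ i ∈ Finset.range J, d i * (w : ℂ) ^ (i - j) with hS
    have hScont : Continuous S := by
      simp only [hS]
      fun_prop
    have hS0 : S 0 = d j := by
      simp only [hS]
      rw [Finset.sum_eq_single j]
      · simp
      · intro i hi hij
        rcases lt_or_gt_of_ne hij with h1 | h1
        · rw [ih i h1 (h1.trans hj), zero_mul]
        · have : i - j ≠ 0 := by omega
          simp [this]
      · intro h1
        exact absurd (Finset.mem_range.2 hj) h1
    have hlim : Tendsto S (𝓝[>] 0) (𝓝 (d j)) := by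
      rw [← hS0]
      exact hScont.continuousAt.tendsto.mono_left nhdsWithin_le_nhds
    have hzero : Tendsto S (𝓝[>] 0) (𝓝 0) := by
      have hb : Tendsto (fun w : ℝ => C * w ^ (β - j)) (𝓝[>] 0) (𝓝 0) := by
        have h1 : Tendsto (fun w : ℝ => w ^ (β - j)) (𝓝[>] 0) (𝓝 (0 ^ (β - j))) :=
          (Real.continuousAt_rpow_const 0 (β - j) (Or.inr hjβ.le)).tendsto.mono_left
            nhdsWithin_le_nhds
        rw [Real.zero_rpow hjβ.ne'] at h1
        simpa using h1.const_mul C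
      refine squeeze_zero_norm' ?_ hb
      filter_upwards [Ioo_mem_nhdsGT hη] with w hw
      have hw0 : 0 < w := hw.1
      have e : ∑ i ∈ Finset.range J, d i * (w : ℂ) ^ i = (w : ℂ) ^ j * S w := by
        simp only [hS]
        rw [Finset.mul_sum]
        refine Finset.sum_congr rfl fun i _ => ?_
        rcases lt_or_ge i j with h1 | h1
        · rw [ih i h1 (h1.trans hj)]
          simp
        · rw [mul_left_comm, ← pow_add, Nat.add_sub_cancel' h1]
      have h1 := h w hw0 hw.2
      rw [e, norm_mul, norm_pow, Complex.norm_real, Real.norm_of_nonneg hw0.le] at h1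
      rw [Real.rpow_sub hw0, Real.rpow_natCast, mul_div_assoc']
      rw [le_div_iff₀ (by positivity)]
      linarith
    exact tendsto_nhds_unique hlim hzero

theorem rpow_le_mul_rpow_of_le {η x s γ : ℝ} (hη : 0 < η) (hx : η ≤ x) (hs : s ≤ γ) :
    x ^ s ≤ η ^ (s - γ) * x ^ γ := by
  have hx0 : 0 < x := hη.trans_le hx
  have h := Real.rpow_le_rpow_of_nonpos hη hx (z := s - γ) (by linarith)
  calc x ^ s = x ^ (s - γ) * x ^ γ := by rw [← Real.rpow_add hx0, sub_add_cancel]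
    _ ≤ _ := by gcongr

/-- Taylor expansion of `(1 + 2z)^a` with a remainder estimate on the whole plane. No restriction
to a sector is needed, since the principal branch satisfies `|(1 + 2z)^a| = |1 + 2z|^a`. -/
theorem exists_norm_cpow_sub_taylor_le {a : ℝ} (ha : 0 ≤ a) (J : ℕ) {β : ℝ} (hβ0 : 0 ≤ β)
    (hβ : (J : ℝ) - 1 ≤ β) (hβJ : β ≤ J) :
    ∃ b : ℕ → ℂ, ∃ C : ℝ, 0 < C ∧ ∀ z : ℂ,
      ‖(1 + 2 * z) ^ (a : ℂ) - ∑ j ∈ Finset.range J, b j * z ^ j‖ ≤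
        C * (‖z‖ ^ β + ‖z‖ ^ max a β) := by
  have han : AnalyticAt ℂ (fun z : ℂ => (1 + 2 * z) ^ (a : ℂ)) 0 := by
    refine AnalyticAt.cpow (by fun_prop) (by fun_prop) ?_
    simp
  obtain ⟨b, C, η, hC, hη, hη1, h⟩ := exists_norm_sub_taylor_le han J
  set γ := max a β with hγ
  set B : ℝ := (1 / η + 2) ^ a * η ^ (a - γ) + ∑ j ∈ Finset.range J, ‖b j‖ * η ^ ((j : ℝ) - γ)
    with hB
  have hB0 : 0 ≤ B := by positivity
  refine ⟨b, C + B, by positivity, fun z => ?_⟩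
  have hp1 : 0 ≤ ‖z‖ ^ β := by positivity
  have hp2 : 0 ≤ ‖z‖ ^ γ := by positivity
  rcases lt_or_ge ‖z‖ η with hz | hz
  · refine (h z hz).trans ?_
    have h1 : ‖z‖ ^ J ≤ ‖z‖ ^ β := by
      rw [← Real.rpow_natCast]
      rcases eq_or_lt_of_le (norm_nonneg z) with h0 | h0
      · rw [← h0]
        rcases eq_or_lt_of_le hβ0 with hb | hb
        · rw [← hb, Real.rpow_zero]
          exact Real.rpow_le_one le_rfl zero_le_one (Nat.cast_nonneg J)
        · rw [Real.zero_rpow hb.ne', Real.zero_rpow (hb.trans_le hβJ).ne']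
      · exact Real.rpow_le_rpow_of_exponent_ge h0 (hz.le.trans hη1) hβJ
    have h2 : C * ‖z‖ ^ J ≤ C * ‖z‖ ^ β := by gcongr
    have h3 : 0 ≤ C * ‖z‖ ^ γ := by positivity
    have h4 : 0 ≤ B * (‖z‖ ^ β + ‖z‖ ^ γ) := by positivity
    linarith
  · have h1 : ‖(1 + 2 * z) ^ (a : ℂ)‖ ≤ (1 / η + 2) ^ a * η ^ (a - γ) * ‖z‖ ^ γ := by
      have h2 : ‖(1 + 2 * z) ^ (a : ℂ)‖ ≤ ((1 / η + 2) * ‖z‖) ^ a := by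
        have h3 := norm_ofReal_add_cpow_le ha zero_le_one z
        rw [Complex.ofReal_one] at h3
        refine h3.trans (Real.rpow_le_rpow (by positivity) ?_ ha)
        have : 1 ≤ 1 / η * ‖z‖ := by
          rw [one_div_mul_eq_div, one_le_div hη]
          exact hz
        linarith
      rw [Real.mul_rpow (by positivity) (norm_nonneg z)] at h2
      refine h2.trans ?_
      rw [mul_assoc]
      gcongr
      exact rpow_le_mul_rpow_of_le hη hz (le_max_left _ _)
    have h2 : ‖∑ j ∈ Finset.range J, b j * z ^ j‖ ≤
        (∑ j ∈ Finset.range J, ‖b j‖ * η ^ ((j : ℝ) - γ)) * ‖z‖ ^ γ := by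
      rw [Finset.sum_mul]
      refine norm_sum_le_of_le _ fun j hj => ?_
      rw [norm_mul, norm_pow, mul_assoc, ← Real.rpow_natCast]
      gcongr
      refine rpow_le_mul_rpow_of_le hη hz ((le_trans ?_ hβ).trans (le_max_right _ _))
      have : (j : ℝ) + 1 ≤ J := by exact_mod_cast Finset.mem_range.1 hj
      linarith
    calc _ ≤ _ := norm_sub_le _ _
      _ ≤ B * ‖z‖ ^ γ := by rw [hB, add_mul]; exact add_le_add h1 h2
      _ ≤ _ := by
        have h3 : 0 ≤ B * ‖z‖ ^ β := by positivity
        have h4 : 0 ≤ C * (‖z‖ ^ β + ‖z‖ ^ γ) := by positivity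
        linarith

/-- The Hankel integral is a polynomial up to a remainder of fractional order. The coefficients are
left implicit: they are identified by `exists_norm_resolventProfile_sub_le` through the heat kernel
representation. -/
theorem exists_norm_hankelIntegral_sub_le {a : ℝ} (ha : 0 ≤ a) (J : ℕ) {β : ℝ} (hβ0 : 0 ≤ β)
    (hβ : (J : ℝ) - 1 ≤ β) (hβJ : β ≤ J) (hβa : β < 2 * a + 1) :
    ∃ d : ℕ → ℂ, ∃ C : ℝ, 0 < C ∧ ∀ w : ℂ, ‖w‖ ≤ 2 →
      ‖hankelIntegral a w - ∑ j ∈ Finset.range J, d j * w ^ j‖ ≤ C * ‖w‖ ^ β := by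
  obtain ⟨b, C, hC, h⟩ := exists_norm_cpow_sub_taylor_le ha J hβ0 hβ hβJ
  set γ := max a β with hγ
  have hγa : γ < 2 * a + 1 := max_lt (by linarith) hβa
  have hi : ∀ s : ℝ, s < 2 * a + 1 →
      IntegrableOn (fun t : ℝ => rexp (-t) * t ^ (2 * a - s)) (Ioi 0) := fun s hs =>
    integrableOn_exp_neg_mul_rpow (by linarith)
  have hj : ∀ j ∈ Finset.range J, (j : ℝ) < 2 * a + 1 := by
    intro j hj
    have : (j : ℝ) + 1 ≤ J := by exact_mod_cast Finset.mem_range.1 hj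
    linarith
  set I : ℝ → ℝ := fun s => ∫ t in Ioi (0 : ℝ), rexp (-t) * t ^ (2 * a - s) with hI
  have hI0 : ∀ s, 0 ≤ I s := fun s => setIntegral_nonneg measurableSet_Ioi fun t ht => by
    have ht0 : 0 < t := ht
    positivity
  refine ⟨fun j => b j * (I j : ℂ), C * (I β + I γ * 2 ^ (γ - β)) + 1,
    by have := hI0 β; have := hI0 γ; positivity, fun w hw => ?_⟩
  have hterm : ∀ j ∈ Finset.range J, IntegrableOn
      (fun t : ℝ => ((rexp (-t) * t ^ (2 * a - j) : ℝ) : ℂ) * (b j * w ^ j)) (Ioi 0) :=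
    fun j hj' => ((hi j (hj j hj')).ofReal (𝕜 := ℂ)).mul_const _
  have hsum : ∑ j ∈ Finset.range J, b j * (I j : ℂ) * w ^ j =
      ∫ t in Ioi (0 : ℝ), ∑ j ∈ Finset.range J,
        ((rexp (-t) * t ^ (2 * a - j) : ℝ) : ℂ) * (b j * w ^ j) := by
    rw [integral_finsetSum _ hterm]
    refine Finset.sum_congr rfl fun j _ => ?_
    rw [integral_mul_const, integral_complex_ofReal]
    ring
  rw [hsum, hankelIntegral, ← integral_sub (integrableOn_hankelIntegrand ha w)
    (integrable_finsetSum _ hterm)]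
  have hmaj : IntegrableOn (fun t : ℝ => C * (rexp (-t) * t ^ (2 * a - β) * ‖w‖ ^ β +
      rexp (-t) * t ^ (2 * a - γ) * ‖w‖ ^ γ)) (Ioi 0) :=
    (((hi β hβa).mul_const _).add ((hi γ hγa).mul_const _)).const_mul C
  refine (norm_integral_le_of_norm_le hmaj ?_).trans ?_
  · refine (ae_restrict_iff' measurableSet_Ioi).2 (Eventually.of_forall fun t ht => ?_)
    have ht0 : 0 < t := ht
    have htc : (t : ℂ) ≠ 0 := by exact_mod_cast ht0.ne'
    have hcp : ((t : ℂ) + 2 * w) ^ (a : ℂ) =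
        ((t ^ a : ℝ) : ℂ) * (1 + 2 * (w / t)) ^ (a : ℂ) := by
      have e : (t : ℂ) + 2 * w = (t : ℂ) * (1 + 2 * (w / t)) := by
        field_simp
      rw [e, Complex.ofReal_cpow ht0.le]
      rcases eq_or_ne (1 + 2 * (w / t)) 0 with h0 | h0
      · rw [h0, mul_zero]
        rcases eq_or_ne a 0 with h1 | h1
        · simp [h1]
        · rw [Complex.zero_cpow (by exact_mod_cast h1), mul_zero]
      · rw [Complex.cpow_def_of_ne_zero (mul_ne_zero htc h0), Complex.log_ofReal_mul ht0 h0,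
          Complex.ofReal_log ht0.le, add_mul, Complex.exp_add, ← Complex.cpow_def_of_ne_zero htc,
          ← Complex.cpow_def_of_ne_zero h0]
    have hpow : ∀ j : ℕ, ((rexp (-t) * t ^ (2 * a - j) : ℝ) : ℂ) * (b j * w ^ j) =
        ((rexp (-t) * t ^ (2 * a) : ℝ) : ℂ) * (b j * (w / t) ^ j) := by
      intro j
      rw [Real.rpow_sub ht0, Real.rpow_natCast, div_pow]
      push_cast
      field_simp
    have hdiff : ((rexp (-t) * t ^ a : ℝ) : ℂ) * ((t : ℂ) + 2 * w) ^ (a : ℂ) -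
        ∑ j ∈ Finset.range J, ((rexp (-t) * t ^ (2 * a - j) : ℝ) : ℂ) * (b j * w ^ j) =
        ((rexp (-t) * t ^ (2 * a) : ℝ) : ℂ) * ((1 + 2 * (w / t)) ^ (a : ℂ) -
          ∑ j ∈ Finset.range J, b j * (w / t) ^ j) := by
      rw [Finset.sum_congr rfl fun j _ => hpow j, ← Finset.mul_sum, hcp, mul_sub, two_mul a,
        Real.rpow_add ht0]
      push_cast
      ring
    rw [hdiff, norm_mul, Complex.norm_real, Real.norm_of_nonneg (by positivity)]
    have h1 := mul_le_mul_of_nonneg_left (h (w / t))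
      (show 0 ≤ rexp (-t) * t ^ (2 * a) by positivity)
    refine h1.trans (le_of_eq ?_)
    rw [norm_div, Complex.norm_real, Real.norm_of_nonneg ht0.le,
      Real.div_rpow (norm_nonneg w) ht0.le, Real.div_rpow (norm_nonneg w) ht0.le,
      Real.rpow_sub ht0, Real.rpow_sub ht0]
    field_simp
  · rw [integral_const_mul, integral_add ((hi β hβa).mul_const _) ((hi γ hγa).mul_const _),
      integral_mul_const, integral_mul_const]
    have h1 : ‖w‖ ^ γ ≤ 2 ^ (γ - β) * ‖w‖ ^ β := by
      rcases eq_or_lt_of_le (norm_nonneg w) with h0 | h0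
      · rw [← h0]
        rcases eq_or_lt_of_le hβ0 with hb | hb
        · rw [← hb, Real.rpow_zero, mul_one, sub_zero]
          exact Real.rpow_le_rpow le_rfl (by norm_num) (hβ0.trans (le_max_right _ _))
        · rw [Real.zero_rpow hb.ne', Real.zero_rpow (hb.trans_le (le_max_right _ _)).ne', mul_zero]
      · calc ‖w‖ ^ γ = ‖w‖ ^ (γ - β) * ‖w‖ ^ β := by rw [← Real.rpow_add h0, sub_add_cancel]
          _ ≤ _ := by
            gcongr
            exact sub_nonneg.2 (le_max_right _ _)
    calc C * (I β * ‖w‖ ^ β + I γ * ‖w‖ ^ γ)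
        ≤ C * (I β * ‖w‖ ^ β + I γ * (2 ^ (γ - β) * ‖w‖ ^ β)) := by
          gcongr
          exact hI0 γ
      _ = C * (I β + I γ * 2 ^ (γ - β)) * ‖w‖ ^ β := by ring
      _ ≤ _ := by
          have : 0 ≤ ‖w‖ ^ β := by positivity
          linarith

theorem integrableOn_and_integral_rpow_mul_exp_neg_inv {p : ℝ} (hp : 0 < p) :
    IntegrableOn (fun t : ℝ => t ^ (-p - 1) * rexp (-1 / (4 * t))) (Ioi 0) ∧
    ∫ t in Ioi (0 : ℝ), t ^ (-p - 1) * rexp (-1 / (4 * t)) = 4 ^ p * Real.Gamma p := by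
  have hpt : ∀ t ∈ Ioi (0 : ℝ), (|(-1 : ℝ)| * t ^ ((-1 : ℝ) - 1)) •
      ((t ^ (-1 : ℝ)) ^ (p - 1) * rexp (-(1 / 4 * t ^ (-1 : ℝ)))) =
      t ^ (-p - 1) * rexp (-1 / (4 * t)) := by
    intro t ht
    have ht0 : 0 < t := ht
    rw [abs_neg, abs_one, one_mul, smul_eq_mul, ← Real.rpow_mul ht0.le, ← mul_assoc,
      ← Real.rpow_add ht0, Real.rpow_neg_one]
    congr 2
    · ring
    · field_simp
  constructor
  · have hg : IntegrableOn (fun t : ℝ => t ^ (p - 1) * rexp (-(1 / 4 * t))) (Ioi 0) := by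
      have h := integrableOn_rpow_mul_exp_neg_mul_rpow (p := 1) (s := p - 1) (b := 1 / 4)
        (by linarith) one_pos (by norm_num)
      refine h.congr_fun (fun t _ => ?_) measurableSet_Ioi
      simp only [Real.rpow_one, neg_mul]
    rw [← integrableOn_Ioi_comp_rpow_iff _ (p := -1) (by norm_num)] at hg
    exact hg.congr_fun hpt measurableSet_Ioi
  · rw [← setIntegral_congr_fun measurableSet_Ioi hpt,
      integral_comp_rpow_Ioi (fun t : ℝ => t ^ (p - 1) * rexp (-(1 / 4 * t))) (by norm_num),
      Real.integral_rpow_mul_exp_neg_mul_Ioi hp (by norm_num)]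
    norm_num

/-- Taylor's formula for `e^{-x}` with a remainder of fractional order, valid on the whole half-line:
for `x ≥ 1` every term on the left is at most `x^σ`. -/
theorem exists_abs_exp_neg_sub_sum_le {M : ℕ} (hM : 0 < M) {σ : ℝ} (hσ : (M : ℝ) - 1 ≤ σ)
    (hσM : σ ≤ M) :
    ∃ C : ℝ, 0 < C ∧ ∀ x : ℝ, 0 < x →
      |rexp (-x) - ∑ j ∈ Finset.range M, (-x) ^ j / (j.factorial : ℝ)| ≤ C * x ^ σ := by
  set B : ℝ := (M.succ : ℝ) * ((M.factorial : ℝ) * M)⁻¹ with hB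
  have hB0 : 0 < B := by positivity
  refine ⟨B + (1 + M), by positivity, fun x hx => ?_⟩
  have hxσ : 0 ≤ x ^ σ := by positivity
  rcases le_total x 1 with h1 | h1
  · have h := Real.exp_bound (x := -x) (by rwa [abs_neg, abs_of_pos hx]) hM
    rw [abs_neg, abs_of_pos hx] at h
    have h2 : x ^ M ≤ x ^ σ := by
      rw [← Real.rpow_natCast]
      exact Real.rpow_le_rpow_of_exponent_ge hx h1 hσM
    have h3 : x ^ M * B ≤ x ^ σ * B := by gcongr
    have h4 : 0 ≤ (1 + (M : ℝ)) * x ^ σ := by positivity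
    have h5 : x ^ M * ((M.succ : ℝ) / ((M.factorial : ℝ) * M)) = x ^ M * B := by
      rw [hB, div_eq_mul_inv]
    linarith
  · have hexp : rexp (-x) ≤ x ^ σ := by
      have h2 : rexp (-x) ≤ 1 := Real.exp_le_one_iff.2 (by linarith)
      refine h2.trans (Real.one_le_rpow h1 ?_)
      have : (1 : ℝ) ≤ M := by exact_mod_cast hM
      linarith
    have hsum : |∑ j ∈ Finset.range M, (-x) ^ j / (j.factorial : ℝ)| ≤ M * x ^ σ := by
      have h2 : ∀ j ∈ Finset.range M, |(-x) ^ j / (j.factorial : ℝ)| ≤ x ^ σ := by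
        intro j hj
        rw [abs_div, abs_pow, abs_neg, abs_of_pos hx, Nat.abs_cast]
        have h3 : x ^ j ≤ x ^ σ := by
          rw [← Real.rpow_natCast]
          refine Real.rpow_le_rpow_of_exponent_le h1 ?_
          have : (j : ℝ) + 1 ≤ M := by exact_mod_cast Finset.mem_range.1 hj
          linarith
        refine (div_le_self (by positivity) ?_).trans h3
        exact_mod_cast Nat.one_le_iff_ne_zero.2 (Nat.factorial_ne_zero j)
      refine (Finset.abs_sum_le_sum_abs _ _).trans ((Finset.sum_le_sum h2).trans ?_)
      simp
    calc _ ≤ |rexp (-x)| + |∑ j ∈ Finset.range M, (-x) ^ j / (j.factorial : ℝ)| := abs_sub _ _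
      _ ≤ x ^ σ + M * x ^ σ := by
        rw [abs_of_pos (Real.exp_pos _)]
        exact add_le_add hexp hsum
      _ ≤ _ := by
        have : 0 ≤ B * x ^ σ := by positivity
        linarith

/-- The coefficient of `w^{2j}` in the expansion of `resolventProfile n` at the origin. -/
noncomputable def profileCoeff (n j : ℕ) : ℝ :=
  (-1) ^ j / (j.factorial : ℝ) * ((4 * π) ^ (-((n : ℝ) / 2)) *
    (4 ^ ((n : ℝ) / 2 - j - 1) * Real.Gamma ((n : ℝ) / 2 - j - 1)))

theorem heatProfile_eq (n : ℕ) {t : ℝ} (ht : 0 < t) :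
    heatProfile n t = (4 * π) ^ (-((n : ℝ) / 2)) * (t ^ (-((n : ℝ) / 2)) * rexp (-1 / (4 * t))) := by
  rw [heatProfile, Real.mul_rpow (by positivity) ht.le, mul_assoc]

theorem integrableOn_rpow_mul_heatProfile {n : ℕ} {s : ℝ} (hs : s < (n : ℝ) / 2 - 1) :
    IntegrableOn (fun t : ℝ => heatProfile n t * t ^ s) (Ioi 0) := by
  have h := ((integrableOn_and_integral_rpow_mul_exp_neg_inv
    (p := (n : ℝ) / 2 - s - 1) (by linarith)).1).const_mul ((4 * π) ^ (-((n : ℝ) / 2)))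
  refine IntegrableOn.congr_fun h (fun t ht => ?_) measurableSet_Ioi
  have ht0 : 0 < t := ht
  have e : -((n : ℝ) / 2 - s - 1) - 1 = -((n : ℝ) / 2) + s := by ring
  rw [heatProfile_eq n ht0, e, Real.rpow_add ht0]
  ring

theorem heatProfile_nonneg (n : ℕ) {t : ℝ} (ht : 0 < t) : 0 ≤ heatProfile n t := by
  unfold heatProfile
  positivity

theorem integrableOn_heatProfile_mul_exp {n : ℕ} (hn : 3 ≤ n) (w : ℝ) :
    IntegrableOn (fun t : ℝ => heatProfile n t * rexp (-t * w ^ 2)) (Ioi 0) := by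
  have hn' : (3 : ℝ) ≤ n := by exact_mod_cast hn
  have h0 := integrableOn_rpow_mul_heatProfile (n := n) (s := 0) (by linarith)
  simp only [Real.rpow_zero, mul_one] at h0
  refine h0.mono' (by unfold heatProfile; fun_prop) ?_
  refine (ae_restrict_iff' measurableSet_Ioi).2 (Eventually.of_forall fun t ht => ?_)
  have ht0 : 0 < t := ht
  have hnn := heatProfile_nonneg n ht0
  rw [norm_mul, Real.norm_of_nonneg hnn, Real.norm_of_nonneg (Real.exp_pos _).le]
  refine mul_le_of_le_one_right hnn (Real.exp_le_one_iff.2 ?_)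
  have : 0 ≤ t * w ^ 2 := by positivity
  linarith

theorem integral_pow_mul_heatProfile {n j : ℕ} (hj : (j : ℝ) < (n : ℝ) / 2 - 1) :
    ∫ t in Ioi (0 : ℝ), heatProfile n t * t ^ (j : ℝ) = (4 * π) ^ (-((n : ℝ) / 2)) *
      (4 ^ ((n : ℝ) / 2 - j - 1) * Real.Gamma ((n : ℝ) / 2 - j - 1)) := by
  rw [← (integrableOn_and_integral_rpow_mul_exp_neg_inv
    (p := (n : ℝ) / 2 - j - 1) (by linarith)).2, ← integral_const_mul]
  refine setIntegral_congr_fun measurableSet_Ioi fun t ht => ?_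
  have ht0 : 0 < t := ht
  have e : -((n : ℝ) / 2 - j - 1) - 1 = -((n : ℝ) / 2) + j := by ring
  rw [heatProfile_eq n ht0, e, Real.rpow_add ht0]
  ring

/-- Expanding `e^{-tw²}` under the heat kernel gives the even Taylor polynomial of the profile at the
origin, for `w > 0`. -/
theorem exists_norm_resolventProfile_ofReal_sub_le {n : ℕ} (hn : 3 ≤ n) {M : ℕ} (hM : 0 < M)
    {σ : ℝ} (hσ : (M : ℝ) - 1 ≤ σ) (hσM : σ ≤ M) (hσn : σ < (n : ℝ) / 2 - 1) :
    ∃ C : ℝ, 0 < C ∧ ∀ w : ℝ, 0 < w →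
      ‖resolventProfile n w - ∑ j ∈ Finset.range M, (profileCoeff n j : ℂ) * (w : ℂ) ^ (2 * j)‖ ≤
        C * w ^ (2 * σ) := by
  obtain ⟨C, hC, h⟩ := exists_abs_exp_neg_sub_sum_le hM hσ hσM
  have hnn : ∀ t ∈ Ioi (0 : ℝ), 0 ≤ heatProfile n t := fun t ht => heatProfile_nonneg n ht
  set I := ∫ t in Ioi (0 : ℝ), heatProfile n t * t ^ σ with hI
  have hI0 : 0 ≤ I := setIntegral_nonneg measurableSet_Ioi fun t ht => by
    have ht0 : 0 < t := ht
    have := hnn t ht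
    positivity
  refine ⟨C * I + 1, by positivity, fun w hw => ?_⟩
  have hjn : ∀ j ∈ Finset.range M, (j : ℝ) < (n : ℝ) / 2 - 1 := by
    intro j hj
    have : (j : ℝ) + 1 ≤ M := by exact_mod_cast Finset.mem_range.1 hj
    linarith
  have hterm : ∀ j ∈ Finset.range M, IntegrableOn (fun t : ℝ =>
      (heatProfile n t * t ^ (j : ℝ)) * ((-1) ^ j / (j.factorial : ℝ) * w ^ (2 * j))) (Ioi 0) :=
    fun j hj => (integrableOn_rpow_mul_heatProfile (hjn j hj)).mul_const _
  have hheat := integrableOn_heatProfile_mul_exp hn w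
  have hsum : ∑ j ∈ Finset.range M, profileCoeff n j * w ^ (2 * j) =
      ∫ t in Ioi (0 : ℝ), ∑ j ∈ Finset.range M,
        (heatProfile n t * t ^ (j : ℝ)) * ((-1) ^ j / (j.factorial : ℝ) * w ^ (2 * j)) := by
    rw [integral_finsetSum _ hterm]
    refine Finset.sum_congr rfl fun j hj => ?_
    rw [integral_mul_const, integral_pow_mul_heatProfile (hjn j hj), profileCoeff]
    ring
  have hcast : ∑ j ∈ Finset.range M, (profileCoeff n j : ℂ) * (w : ℂ) ^ (2 * j) =
      ((∑ j ∈ Finset.range M, profileCoeff n j * w ^ (2 * j) : ℝ) : ℂ) := by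
    push_cast
    rfl
  rw [resolventProfile_ofReal hn hw, hcast, ← Complex.ofReal_sub, Complex.norm_real, hsum,
    ← integral_sub hheat (integrable_finsetSum _ hterm)]
  have hmaj : IntegrableOn (fun t : ℝ => heatProfile n t * t ^ σ * (C * w ^ (2 * σ))) (Ioi 0) :=
    (integrableOn_rpow_mul_heatProfile hσn).mul_const _
  refine (norm_integral_le_of_norm_le hmaj ?_).trans ?_
  · refine (ae_restrict_iff' measurableSet_Ioi).2 (Eventually.of_forall fun t ht => ?_)
    have ht0 : 0 < t := ht
    have e : heatProfile n t * rexp (-t * w ^ 2) - ∑ j ∈ Finset.range M,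
        (heatProfile n t * t ^ (j : ℝ)) * ((-1) ^ j / (j.factorial : ℝ) * w ^ (2 * j)) =
        heatProfile n t * (rexp (-(t * w ^ 2)) -
          ∑ j ∈ Finset.range M, (-(t * w ^ 2)) ^ j / (j.factorial : ℝ)) := by
      rw [mul_sub, Finset.mul_sum, neg_mul]
      congr 1
      refine Finset.sum_congr rfl fun j _ => ?_
      rw [Real.rpow_natCast, neg_pow (t * w ^ 2), mul_pow, ← pow_mul]
      ring
    rw [e, norm_mul, Real.norm_of_nonneg (hnn t ht), Real.norm_eq_abs]
    refine (mul_le_mul_of_nonneg_left (h (t * w ^ 2) (by positivity)) (hnn t ht)).trans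
      (le_of_eq ?_)
    rw [Real.mul_rpow ht0.le (by positivity), ← Real.rpow_natCast w 2, ← Real.rpow_mul hw.le]
    push_cast
    ring
  · rw [integral_mul_const]
    have : 0 ≤ w ^ (2 * σ) := by positivity
    linarith

/-- The expansion of the profile at the origin. The Hankel integral supplies some Taylor polynomial, with a remainder valid for all
complex `w`; the heat kernel supplies the coefficients, but only for `w > 0`. Odd powers of `w` below the
order of the remainder are absent, which the Hankel integral alone does not show. -/
theorem exists_norm_resolventProfile_sub_le {m n : ℕ} (hm : 1 ≤ m) (hn : 4 * m < n) {ε : ℝ}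
    (hε : 0 < ε) (hε1 : ε < 1) :
    ∃ C : ℝ, 0 < C ∧ ∀ w : ℂ, ‖w‖ ≤ 2 →
      ‖resolventProfile n w - ∑ j ∈ Finset.range (2 * m), (profileCoeff n j : ℂ) * w ^ (2 * j)‖ ≤
        C * ‖w‖ ^ (4 * (m : ℝ) - 2 + ε) := by
  have hn3 : 3 ≤ n := by omega
  have hm' : (1 : ℝ) ≤ m := by exact_mod_cast hm
  have hn' : 4 * (m : ℝ) + 1 ≤ n := by exact_mod_cast hn
  have hJ : ((4 * m - 1 : ℕ) : ℝ) = 4 * m - 1 := by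
    rw [Nat.cast_sub (by omega)]
    push_cast
    ring
  set J := 4 * m - 1 with hJdef
  set β : ℝ := 4 * (m : ℝ) - 2 + ε with hβ
  set Q : ℂ → ℂ := fun w => ∑ j ∈ Finset.range (2 * m), (profileCoeff n j : ℂ) * w ^ (2 * j) with hQ
  have hβ0 : 0 < β := by linarith
  have hβJ : β ≤ J := by linarith
  have hJβ : (J : ℝ) - 1 < β := by linarith
  set c : ℂ := (profileConst n : ℂ) with hc
  obtain ⟨d, C₁, hC₁, h₁⟩ := exists_norm_hankelIntegral_sub_le (profileExponent_nonneg hn3) J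
    hβ0.le hJβ.le hβJ (by linarith)
  have hQd : Differentiable ℂ Q := by
    simp only [hQ]
    fun_prop
  have hQa : AnalyticAt ℂ (fun w => Complex.exp w * Q w) 0 :=
    (Complex.differentiable_exp.mul hQd).analyticAt 0
  obtain ⟨b, C₂, η, hC₂, hη, hη1, h₂⟩ := exists_norm_sub_taylor_le hQa J
  obtain ⟨C₃, hC₃, h₃⟩ := exists_norm_resolventProfile_ofReal_sub_le hn3 (M := 2 * m) (by omega)
    (σ := β / 2) (by push_cast; linarith) (by push_cast; linarith) (by linarith)
  have hexp : ∀ w, Complex.exp w * resolventProfile n w =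
      c * hankelIntegral (((n : ℝ) - 3) / 2) w := by
    intro w
    have : Complex.exp w * Complex.exp (-w) = 1 := by rw [← Complex.exp_add]; simp
    rw [resolventProfile]
    linear_combination (c * hankelIntegral (((n : ℝ) - 3) / 2) w) * this
  have hpowle : ∀ x : ℝ, 0 ≤ x → x ≤ 1 → x ^ J ≤ x ^ β := by
    intro x hx0 hx1
    rw [← Real.rpow_natCast]
    rcases eq_or_lt_of_le hx0 with h | h
    · rw [← h, Real.zero_rpow hβ0.ne', Real.zero_rpow (hβ0.trans_le hβJ).ne']
    · exact Real.rpow_le_rpow_of_exponent_ge h hx1 hβJ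
  have hA : ∀ w : ℂ, ‖w‖ < η →
      ‖(c * hankelIntegral (((n : ℝ) - 3) / 2) w - Complex.exp w * Q w) -
        ∑ j ∈ Finset.range J, (c * d j - b j) * w ^ j‖ ≤ (‖c‖ * C₁ + C₂) * ‖w‖ ^ β := by
    intro w hw
    have e : (c * hankelIntegral (((n : ℝ) - 3) / 2) w - Complex.exp w * Q w) -
        ∑ j ∈ Finset.range J, (c * d j - b j) * w ^ j =
        c * (hankelIntegral (((n : ℝ) - 3) / 2) w - ∑ j ∈ Finset.range J, d j * w ^ j) -
          (Complex.exp w * Q w - ∑ j ∈ Finset.range J, b j * w ^ j) := by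
      simp only [sub_mul, Finset.sum_sub_distrib, mul_sub, Finset.mul_sum, mul_assoc]
      ring
    rw [e]
    refine (norm_sub_le _ _).trans ?_
    rw [norm_mul, add_mul, mul_assoc]
    refine add_le_add (mul_le_mul_of_nonneg_left (h₁ w (by linarith)) (norm_nonneg _))
      ((h₂ w hw).trans ?_)
    gcongr
    exact hpowle _ (norm_nonneg w) (hw.le.trans hη1)
  -- On the positive half-line the heat kernel identifies the two Taylor polynomials.
  have hcoeff : ∀ j < J, c * d j - b j = 0 := by
    refine coeff_eq_zero_of_norm_sum_le (C := rexp 1 * C₃ + (‖c‖ * C₁ + C₂)) hJβ hη ?_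
    intro w hw0 hwη
    have hwn : ‖(w : ℂ)‖ = w := by rw [Complex.norm_real, Real.norm_of_nonneg hw0.le]
    have h4 := hA w (by rwa [hwn])
    have h5 : ‖c * hankelIntegral (((n : ℝ) - 3) / 2) w - Complex.exp w * Q w‖ ≤
        rexp 1 * C₃ * w ^ β := by
      rw [← hexp, ← mul_sub, norm_mul, Complex.norm_exp, Complex.ofReal_re, mul_assoc]
      have h6 := h₃ w hw0
      rw [mul_div_cancel₀ β two_ne_zero] at h6
      have h7 : rexp w ≤ rexp 1 := Real.exp_le_exp.2 (hwη.le.trans hη1)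
      exact mul_le_mul h7 h6 (norm_nonneg _) (Real.exp_pos _).le
    rw [hwn] at h4
    rw [add_mul]
    set S := ∑ j ∈ Finset.range J, (c * d j - b j) * (w : ℂ) ^ j
    set T := c * hankelIntegral (((n : ℝ) - 3) / 2) w - Complex.exp w * Q w
    calc ‖S‖ = ‖T - (T - S)‖ := by rw [sub_sub_cancel]
      _ ≤ ‖T‖ + ‖T - S‖ := norm_sub_le _ _
      _ ≤ _ := add_le_add h5 h4
  obtain ⟨C₄, hC₄, h₄⟩ := exists_norm_resolventProfile_le hn3
  set D : ℝ := C₄ * rexp 2 * (1 + 2) ^ (((n : ℝ) - 3) / 2) +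
    ∑ j ∈ Finset.range (2 * m), ‖(profileCoeff n j : ℂ)‖ * 2 ^ (2 * j) with hD
  have hD0 : 0 ≤ D := by positivity
  refine ⟨rexp 1 * (‖c‖ * C₁ + C₂) + D * η ^ (-β), by positivity, fun w hw => ?_⟩
  have hwβ : 0 ≤ ‖w‖ ^ β := by positivity
  rcases lt_or_ge ‖w‖ η with hwη | hwη
  · have h5 := hA w hwη
    have h6 : ∑ j ∈ Finset.range J, (c * d j - b j) * w ^ j = 0 :=
      Finset.sum_eq_zero fun j hj => by rw [hcoeff j (Finset.mem_range.1 hj), zero_mul]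
    rw [h6, sub_zero, ← hexp, ← mul_sub, norm_mul] at h5
    have h7 : 1 ≤ rexp 1 * ‖Complex.exp w‖ := by
      rw [Complex.norm_exp, ← Real.exp_add]
      refine Real.one_le_exp ?_
      have := neg_le_of_abs_le (Complex.abs_re_le_norm w)
      linarith
    calc ‖resolventProfile n w - Q w‖
        ≤ rexp 1 * ‖Complex.exp w‖ * ‖resolventProfile n w - Q w‖ :=
          le_mul_of_one_le_left (norm_nonneg _) h7
      _ ≤ rexp 1 * ((‖c‖ * C₁ + C₂) * ‖w‖ ^ β) := by
          rw [mul_assoc]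
          gcongr
      _ ≤ _ := by
          have : 0 ≤ D * η ^ (-β) * ‖w‖ ^ β := by positivity
          linarith
  · have h5 : ‖resolventProfile n w‖ ≤ C₄ * rexp 2 * (1 + 2) ^ (((n : ℝ) - 3) / 2) := by
      refine (h₄ w).trans ?_
      have h6 : -w.re ≤ 2 := by
        have := neg_le_of_abs_le (Complex.abs_re_le_norm w)
        linarith
      have h7 := profileExponent_nonneg hn3
      gcongr
    have h6 : ‖Q w‖ ≤ ∑ j ∈ Finset.range (2 * m), ‖(profileCoeff n j : ℂ)‖ * 2 ^ (2 * j) := by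
      refine norm_sum_le_of_le _ fun j _ => ?_
      rw [norm_mul, norm_pow]
      gcongr
    have h7 : 1 ≤ η ^ (-β) * ‖w‖ ^ β := by
      have := rpow_le_mul_rpow_of_le hη hwη hβ0.le
      rwa [Real.rpow_zero, zero_sub] at this
    calc ‖resolventProfile n w - Q w‖ ≤ D := (norm_sub_le _ _).trans (add_le_add h5 h6)
      _ ≤ D * (η ^ (-β) * ‖w‖ ^ β) := le_mul_of_one_le_right hD0 h7
      _ ≤ _ := by
          have : 0 ≤ rexp 1 * (‖c‖ * C₁ + C₂) * ‖w‖ ^ β := by positivity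
          linarith

/-! ### The kernel of `(-Δ + μ²)⁻¹` -/

theorem integrable_mul_rpow_norm_schwartz {n : ℕ} (f : 𝓢(EuclideanSpace ℝ (Fin n), ℂ))
    (x : EuclideanSpace ℝ (Fin n)) {M a : ℝ} (hM : 0 ≤ M) (ha : 0 ≤ a) :
    Integrable (fun y => (1 + M * ‖x - y‖) ^ a * ‖f y‖) ∧
      ∃ B : ℝ, ∀ y, (1 + M * ‖x - y‖) ^ a * ‖f y‖ ≤ B := by
  obtain ⟨k, hk⟩ := exists_nat_ge a
  set D : ℝ := ((1 + M) * (1 + ‖x‖)) ^ a * 2 ^ k with hD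
  have hD0 : 0 ≤ D := by positivity
  have hle : ∀ y, (1 + M * ‖x - y‖) ^ a * ‖f y‖ ≤ D * (‖f y‖ + ‖y‖ ^ k * ‖f y‖) := by
    intro y
    have h1 : (1 + M * ‖x - y‖) ^ a ≤ ((1 + M) * (1 + ‖x‖) * (1 + ‖y‖)) ^ a := by
      refine Real.rpow_le_rpow (by positivity) ?_ ha
      have h2 : ‖x - y‖ ≤ ‖x‖ + ‖y‖ := norm_sub_le x y
      have h3 : M * ‖x - y‖ ≤ M * (‖x‖ + ‖y‖) := by gcongr
      have h4 : 0 ≤ ‖x‖ * ‖y‖ := by positivity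
      have h5 : 0 ≤ M * (‖x‖ * ‖y‖) := by positivity
      have := norm_nonneg x
      have := norm_nonneg y
      nlinarith
    have h2 : (1 + ‖y‖) ^ a ≤ 2 ^ k * (1 + ‖y‖ ^ k) := by
      calc (1 + ‖y‖) ^ a ≤ (1 + ‖y‖) ^ (k : ℝ) :=
            Real.rpow_le_rpow_of_exponent_le (by linarith [norm_nonneg y]) hk
        _ = (1 + ‖y‖) ^ k := Real.rpow_natCast _ _
        _ ≤ 2 ^ k * (1 + ‖y‖ ^ k) := by
          rcases le_total ‖y‖ 1 with h | h
          · calc (1 + ‖y‖) ^ k ≤ 2 ^ k := by gcongr; linarith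
              _ ≤ _ := le_mul_of_one_le_right (by positivity)
                (by linarith [pow_nonneg (norm_nonneg y) k])
          · calc (1 + ‖y‖) ^ k ≤ (2 * ‖y‖) ^ k := by gcongr; linarith
              _ = 2 ^ k * ‖y‖ ^ k := mul_pow _ _ _
              _ ≤ _ := by gcongr; linarith
    rw [Real.mul_rpow (by positivity) (by positivity)] at h1
    calc (1 + M * ‖x - y‖) ^ a * ‖f y‖
        ≤ ((1 + M) * (1 + ‖x‖)) ^ a * (2 ^ k * (1 + ‖y‖ ^ k)) * ‖f y‖ := by
          gcongr
          exact h1.trans (by gcongr)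
      _ = _ := by rw [hD]; ring
  have hint : Integrable (fun y => D * (‖f y‖ + ‖y‖ ^ k * ‖f y‖)) :=
    (f.integrable.norm.add (f.integrable_pow_mul volume k)).const_mul D
  refine ⟨hint.mono' ?_ (Eventually.of_forall fun y => ?_), ?_⟩
  · refine Continuous.aestronglyMeasurable ?_
    have hf := f.continuous
    refine Continuous.mul (Continuous.rpow_const (by fun_prop) fun y => Or.inr ha) (by fun_prop)
  · rw [Real.norm_of_nonneg (by positivity)]
    exact hle y
  · obtain ⟨B₀, _, hB₀⟩ := f.decay 0 0
    obtain ⟨B₁, _, hB₁⟩ := f.decay k 0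
    refine ⟨D * (B₀ + B₁), fun y => (hle y).trans ?_⟩
    have h0 := hB₀ y
    have h1 := hB₁ y
    simp only [norm_iteratedFDeriv_zero, pow_zero, one_mul] at h0 h1
    gcongr

theorem ae_ne {n : ℕ} (hn : 1 ≤ n) (x : EuclideanSpace ℝ (Fin n)) :
    ∀ᵐ y : EuclideanSpace ℝ (Fin n), x ≠ y := by
  have : Nonempty (Fin n) := ⟨⟨0, hn⟩⟩
  have : Nontrivial (EuclideanSpace ℝ (Fin n)) := inferInstance
  have h := Measure.ae_ne (volume : Measure (EuclideanSpace ℝ (Fin n))) x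
  filter_upwards [h] with y hy using hy.symm

theorem integrable_singular_mul_schwartz {n : ℕ} (hn : 3 ≤ n)
    (f : 𝓢(EuclideanSpace ℝ (Fin n), ℂ)) (x : EuclideanSpace ℝ (Fin n)) {M a : ℝ} (hM : 0 ≤ M)
    (ha : 0 ≤ a) :
    Integrable fun y => (‖x - y‖ ^ (n - 2))⁻¹ * ((1 + M * ‖x - y‖) ^ a * ‖f y‖) := by
  obtain ⟨hint, B, hB⟩ := integrable_mul_rpow_norm_schwartz f x hM ha
  have hmeas : Measurable fun z : EuclideanSpace ℝ (Fin n) => (‖z‖ ^ (n - 2))⁻¹ := by fun_prop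
  have hloc : LocallyIntegrable (fun z : EuclideanSpace ℝ (Fin n) => (‖z‖ ^ (n - 2))⁻¹) := by
    refine locallyIntegrable_of_norm_le_rpow (C := 1) (α := ((n - 2 : ℕ) : ℝ)) ?_ ?_ ?_
      hmeas.aestronglyMeasurable
    · simp; omega
    · simp only [finrank_euclideanSpace, Fintype.card_fin]
      exact_mod_cast (by omega : n - 2 < n)
    · refine Eventually.of_forall fun z => ?_
      rw [Real.norm_of_nonneg (by positivity), Real.rpow_neg (norm_nonneg z), Real.rpow_natCast,
        one_mul]
  have hball : Integrable (indicator (Metric.closedBall 0 1)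
      fun z : EuclideanSpace ℝ (Fin n) => (‖z‖ ^ (n - 2))⁻¹) :=
    (hloc.integrableOn_isCompact (isCompact_closedBall 0 1)).integrable_indicator
      measurableSet_closedBall
  have hball' := (hball.comp_sub_left x).mul_const B
  refine (hball'.add hint).mono' ?_ (Eventually.of_forall fun y => ?_)
  · have h1 : Measurable fun y : EuclideanSpace ℝ (Fin n) => (‖x - y‖ ^ (n - 2))⁻¹ := by fun_prop
    exact h1.aestronglyMeasurable.mul hint.1
  · rw [Real.norm_of_nonneg (by positivity)]
    simp only [Pi.add_apply]
    have h0 : 0 ≤ (1 + M * ‖x - y‖) ^ a * ‖f y‖ := by positivity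
    by_cases hy : x - y ∈ Metric.closedBall (0 : EuclideanSpace ℝ (Fin n)) 1
    · rw [indicator_of_mem hy]
      have : (‖x - y‖ ^ (n - 2))⁻¹ * ((1 + M * ‖x - y‖) ^ a * ‖f y‖) ≤
          (‖x - y‖ ^ (n - 2))⁻¹ * B := by
        gcongr
        exact hB y
      linarith
    · rw [indicator_of_notMem hy, zero_mul, zero_add]
      refine mul_le_of_le_one_left h0 (inv_le_one_of_one_le₀ (one_le_pow₀ ?_))
      rw [mem_closedBall_zero_iff, not_le] at hy
      exact hy.le

/-- The heat kernel at time `t > 0` and distance `r`. -/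
noncomputable def heatKernel (n : ℕ) (t r : ℝ) : ℝ :=
  (4 * π * t) ^ (-((n : ℝ) / 2)) * rexp (-r ^ 2 / (4 * t))

theorem integrableOn_and_integral_heatKernel {n : ℕ} (hn : 3 ≤ n) {r μ : ℝ} (hr : 0 < r)
    (hμ : 0 < μ) :
    IntegrableOn (fun t : ℝ => heatKernel n t r * rexp (-t * μ ^ 2)) (Ioi 0) ∧
    ((∫ t in Ioi (0 : ℝ), heatKernel n t r * rexp (-t * μ ^ 2) : ℝ) : ℂ) =
      (((r ^ (n - 2))⁻¹ : ℝ) : ℂ) * resolventProfile n ((μ * r : ℝ) : ℂ) := by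
  have hn' : (3 : ℝ) ≤ n := by exact_mod_cast hn
  have hr2 : 0 < r ^ 2 := by positivity
  have hpt : ∀ s ∈ Ioi (0 : ℝ), heatKernel n (r ^ 2 * s) r * rexp (-(r ^ 2 * s) * μ ^ 2) =
      r ^ (-(n : ℝ)) * (heatProfile n s * rexp (-s * (μ * r) ^ 2)) := by
    intro s hs
    have hs0 : 0 < s := hs
    have e1 : (4 * π * (r ^ 2 * s)) ^ (-((n : ℝ) / 2)) =
        r ^ (-(n : ℝ)) * (4 * π * s) ^ (-((n : ℝ) / 2)) := by
      have e : 4 * π * (r ^ 2 * s) = r ^ 2 * (4 * π * s) := by ring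
      rw [e, Real.mul_rpow (by positivity) (by positivity), ← Real.rpow_natCast r 2,
        ← Real.rpow_mul hr.le]
      congr 2
      push_cast
      ring
    have e2 : -r ^ 2 / (4 * (r ^ 2 * s)) = -1 / (4 * s) := by field_simp
    have e3 : -(r ^ 2 * s) * μ ^ 2 = -s * (μ * r) ^ 2 := by ring
    rw [heatKernel, heatProfile, e1, e2, e3]
    ring
  have hprof := integrableOn_heatProfile_mul_exp hn (μ * r)
  constructor
  · have h := (integrableOn_Ioi_comp_mul_left_iff
      (fun t : ℝ => heatKernel n t r * rexp (-t * μ ^ 2)) 0 hr2).1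
    rw [mul_zero] at h
    exact h (IntegrableOn.congr_fun (hprof.const_mul _) (fun s hs => (hpt s hs).symm)
      measurableSet_Ioi)
  · have h := integral_comp_mul_left_Ioi' (fun t : ℝ => heatKernel n t r * rexp (-t * μ ^ 2)) 0 hr2
    rw [mul_zero] at h
    rw [← h, setIntegral_congr_fun measurableSet_Ioi hpt, integral_const_mul,
      resolventProfile_ofReal hn (by positivity), ← Complex.ofReal_mul, smul_eq_mul, ← mul_assoc]
    congr 2
    rw [Real.rpow_neg hr.le, Real.rpow_natCast]
    have e : r ^ n = r ^ 2 * r ^ (n - 2) := by rw [← pow_add]; congr 1; omega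
    rw [e]
    field_simp

/-- The heat semigroup on Schwartz functions: Fourier multiplier and heat kernel agree. -/
theorem integral_gaussian_mul_fourier {n : ℕ} (f : 𝓢(EuclideanSpace ℝ (Fin n), ℂ))
    (x : EuclideanSpace ℝ (Fin n)) {t : ℝ} (ht : 0 < t) :
    ∫ ξ, ((rexp (-t * (2 * π * ‖ξ‖) ^ 2) : ℝ) : ℂ) *
        (Complex.exp (((2 * π * inner ℝ ξ x : ℝ) : ℂ) * Complex.I) *
          FourierTransform.fourier (f : EuclideanSpace ℝ (Fin n) → ℂ) ξ) =
      ∫ y, ((heatKernel n t ‖x - y‖ : ℝ) : ℂ) * f y := by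
  set b : ℂ := ((4 * π ^ 2 * t : ℝ) : ℂ) with hb
  have hbre : 0 < b.re := by
    rw [hb, Complex.ofReal_re]
    positivity
  have J : Integrable (fun w : EuclideanSpace ℝ (Fin n) =>
      Complex.exp (-b * ‖w‖ ^ 2 + 2 * π * Complex.I * inner ℝ x w)) :=
    GaussianFourier.integrable_cexp_neg_mul_sq_norm_add hbre _ _
  have h := (VectorFourier.integral_fourierIntegral_smul_eq_flip
    (L := innerₗ (EuclideanSpace ℝ (Fin n)))
    Real.continuous_fourierChar continuous_inner J (f.integrable (μ := volume))).symm
  have h' : ∫ ξ, Complex.exp (-b * ‖ξ‖ ^ 2 + 2 * π * Complex.I * inner ℝ x ξ) *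
      FourierTransform.fourier (f : EuclideanSpace ℝ (Fin n) → ℂ) ξ =
      ∫ y, FourierTransform.fourier (fun w : EuclideanSpace ℝ (Fin n) =>
        Complex.exp (-b * ‖w‖ ^ 2 + 2 * π * Complex.I * inner ℝ x w)) y * f y := by
    simpa using! h
  calc _ = ∫ ξ, Complex.exp (-b * ‖ξ‖ ^ 2 + 2 * π * Complex.I * inner ℝ x ξ) *
      FourierTransform.fourier (f : EuclideanSpace ℝ (Fin n) → ℂ) ξ := by
        refine integral_congr_ae (Eventually.of_forall fun ξ => ?_)
        simp only
        rw [← mul_assoc, Complex.ofReal_exp, ← Complex.exp_add, real_inner_comm, hb]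
        congr 2
        push_cast
        ring
    _ = _ := h'
    _ = _ := by
        refine integral_congr_ae (Eventually.of_forall fun y => ?_)
        simp only
        rw [fourier_gaussian_innerProductSpace' hbre]
        congr 1
        rw [heatKernel, Complex.ofReal_mul, Complex.ofReal_exp,
          Complex.ofReal_cpow (by positivity)]
        have hpi := Real.pi_pos
        congr 1
        · have e1 : (π : ℂ) / b = (((4 * π * t)⁻¹ : ℝ) : ℂ) := by
            rw [hb, ← Complex.ofReal_div]
            congr 1
            field_simp
          have e2 : ((Module.finrank ℝ (EuclideanSpace ℝ (Fin n)) : ℂ) / 2) =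
              (((n : ℝ) / 2 : ℝ) : ℂ) := by
            simp
          rw [e1, e2, ← Complex.ofReal_cpow (by positivity), ← Complex.ofReal_cpow (by positivity)]
          congr 1
          rw [Real.inv_rpow (by positivity), Real.rpow_neg (by positivity)]
        · rw [hb]
          congr 1
          push_cast
          have hpi' : (π : ℂ) ≠ 0 := by exact_mod_cast hpi.ne'
          have ht' : (t : ℂ) ≠ 0 := by exact_mod_cast ht.ne'
          field_simp

/-- `(-Δ + μ²)⁻¹ f` at the point `x`, on the Fourier side. -/
noncomputable def fourierResolvent {n : ℕ} (f : 𝓢(EuclideanSpace ℝ (Fin n), ℂ))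
    (x : EuclideanSpace ℝ (Fin n)) (μ : ℂ) : ℂ :=
  ∫ ξ, (((((2 * π * ‖ξ‖) ^ 2 : ℝ) : ℂ) + μ ^ 2)⁻¹) *
    (Complex.exp (((2 * π * inner ℝ ξ x : ℝ) : ℂ) * Complex.I) *
      FourierTransform.fourier (f : EuclideanSpace ℝ (Fin n) → ℂ) ξ)

/-- `(-Δ + μ²)⁻¹ f` at the point `x`, through the integral kernel. -/
noncomputable def kernelResolvent {n : ℕ} (f : 𝓢(EuclideanSpace ℝ (Fin n), ℂ))
    (x : EuclideanSpace ℝ (Fin n)) (μ : ℂ) : ℂ :=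
  ∫ y, (((‖x - y‖ ^ (n - 2))⁻¹ : ℝ) : ℂ) * resolventProfile n (μ * ‖x - y‖) * f y

theorem integrable_character_mul_fourier {n : ℕ} (f : 𝓢(EuclideanSpace ℝ (Fin n), ℂ))
    (x : EuclideanSpace ℝ (Fin n)) :
    Integrable fun ξ => Complex.exp (((2 * π * inner ℝ ξ x : ℝ) : ℂ) * Complex.I) *
      FourierTransform.fourier (f : EuclideanSpace ℝ (Fin n) → ℂ) ξ := by
  have hf : Integrable (FourierTransform.fourier (f : EuclideanSpace ℝ (Fin n) → ℂ)) := by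
    rw [← SchwartzMap.fourier_coe]
    exact SchwartzMap.integrable _
  refine hf.norm.mono' (Continuous.aestronglyMeasurable (by fun_prop) |>.mul hf.1)
    (Eventually.of_forall fun ξ => ?_)
  rw [norm_mul, Complex.norm_exp_ofReal_mul_I, one_mul]

theorem aestronglyMeasurable_of_continuousOn_ne {n : ℕ} (hn : 1 ≤ n) {x : EuclideanSpace ℝ (Fin n)}
    {g : EuclideanSpace ℝ (Fin n) → ℂ} (hg : ContinuousOn g {x}ᶜ) :
    AEStronglyMeasurable g volume := by
  have h := hg.aestronglyMeasurable (μ := volume) (measurableSet_singleton x).compl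
  have e : (volume : Measure (EuclideanSpace ℝ (Fin n))).restrict {x}ᶜ = volume := by
    refine Measure.restrict_eq_self_of_ae_mem ?_
    filter_upwards [ae_ne hn x] with y hy using hy.symm
  rwa [e] at h

theorem mul_norm_sub_mem_slitPlane {n : ℕ} {μ : ℂ} (hμ : μ ∈ Complex.slitPlane)
    {x y : EuclideanSpace ℝ (Fin n)} (h : x ≠ y) : μ * (‖x - y‖ : ℂ) ∈ Complex.slitPlane := by
  have hr : 0 < ‖x - y‖ := norm_pos_iff.2 (sub_ne_zero.2 h)
  rw [Complex.mem_slitPlane_iff] at hμ ⊢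
  rw [Complex.re_mul_ofReal, Complex.im_mul_ofReal]
  rcases hμ with h1 | h1
  · exact Or.inl (mul_pos h1 hr)
  · exact Or.inr (mul_ne_zero h1 hr.ne')

theorem aestronglyMeasurable_kernel_mul {n : ℕ} (hn : 3 ≤ n)
    (f : 𝓢(EuclideanSpace ℝ (Fin n), ℂ)) (x : EuclideanSpace ℝ (Fin n)) {μ : ℂ}
    (hμ : μ ∈ Complex.slitPlane) :
    AEStronglyMeasurable fun y =>
      (((‖x - y‖ ^ (n - 2))⁻¹ : ℝ) : ℂ) * resolventProfile n (μ * ‖x - y‖) * f y := by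
  refine aestronglyMeasurable_of_continuousOn_ne (x := x) (by omega) ?_
  refine ContinuousOn.mul (ContinuousOn.mul ?_ ?_) f.continuous.continuousOn
  · refine Complex.continuous_ofReal.comp_continuousOn (ContinuousOn.inv₀ (by fun_prop) ?_)
    intro y hy
    have : x ≠ y := fun h => hy h.symm
    exact pow_ne_zero _ (norm_ne_zero_iff.2 (sub_ne_zero.2 this))
  · refine (differentiableOn_resolventProfile hn).continuousOn.comp (by fun_prop) ?_
    intro y hy
    exact mul_norm_sub_mem_slitPlane hμ fun h => hy h.symm

/-- A bound for the integrand of `kernelResolvent`, uniform for `μ` in a bounded part of the closed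
right half-plane. -/
theorem exists_norm_kernel_mul_le {n : ℕ} (hn : 3 ≤ n) :
    ∃ C : ℝ, 0 < C ∧ ∀ (f : 𝓢(EuclideanSpace ℝ (Fin n), ℂ)) (x y : EuclideanSpace ℝ (Fin n))
      (M : ℝ) (μ : ℂ), 0 ≤ μ.re → ‖μ‖ ≤ M →
      ‖(((‖x - y‖ ^ (n - 2))⁻¹ : ℝ) : ℂ) * resolventProfile n (μ * ‖x - y‖) * f y‖ ≤
        C * ((‖x - y‖ ^ (n - 2))⁻¹ * ((1 + M * ‖x - y‖) ^ (((n : ℝ) - 3) / 2) * ‖f y‖)) := by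
  obtain ⟨C, hC, h⟩ := exists_norm_resolventProfile_le hn
  refine ⟨C, hC, fun f x y M μ hμ hM => ?_⟩
  rw [norm_mul, norm_mul, Complex.norm_real, Real.norm_of_nonneg (by positivity)]
  have h1 := h (μ * ‖x - y‖)
  rw [Complex.re_mul_ofReal, norm_mul, Complex.norm_real, norm_norm] at h1
  have h2 : rexp (-(μ.re * ‖x - y‖)) ≤ 1 := by
    rw [Real.exp_le_one_iff]
    have : 0 ≤ μ.re * ‖x - y‖ := by positivity
    linarith
  have h3 : (1 + ‖μ‖ * ‖x - y‖) ^ (((n : ℝ) - 3) / 2) ≤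
      (1 + M * ‖x - y‖) ^ (((n : ℝ) - 3) / 2) := by
    have := profileExponent_nonneg hn
    gcongr
  have h4 : ‖resolventProfile n (μ * ‖x - y‖)‖ ≤
      C * 1 * (1 + M * ‖x - y‖) ^ (((n : ℝ) - 3) / 2) := h1.trans (by gcongr)
  calc _ ≤ (‖x - y‖ ^ (n - 2))⁻¹ * (C * 1 * (1 + M * ‖x - y‖) ^ (((n : ℝ) - 3) / 2)) * ‖f y‖ := by
        gcongr
    _ = _ := by ring

theorem integrable_kernel_mul {n : ℕ} (hn : 3 ≤ n)
    (f : 𝓢(EuclideanSpace ℝ (Fin n), ℂ)) (x : EuclideanSpace ℝ (Fin n)) {μ : ℂ}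
    (hμ : μ ∈ Complex.slitPlane) (hre : 0 ≤ μ.re) :
    Integrable fun y =>
      (((‖x - y‖ ^ (n - 2))⁻¹ : ℝ) : ℂ) * resolventProfile n (μ * ‖x - y‖) * f y := by
  obtain ⟨C, _, h⟩ := exists_norm_kernel_mul_le hn
  exact ((integrable_singular_mul_schwartz hn f x (norm_nonneg μ)
    (profileExponent_nonneg hn)).const_mul C).mono' (aestronglyMeasurable_kernel_mul hn f x hμ)
    (Eventually.of_forall fun y => h f x y ‖μ‖ μ hre le_rfl)

/-- Integrate the identity for the heat semigroup against `e^{-tμ²}` over `t > 0`. -/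
theorem fourierResolvent_eq_kernelResolvent_ofReal {n : ℕ} (hn : 3 ≤ n)
    (f : 𝓢(EuclideanSpace ℝ (Fin n), ℂ)) (x : EuclideanSpace ℝ (Fin n)) {μ : ℝ} (hμ : 0 < μ) :
    fourierResolvent f x μ = kernelResolvent f x μ := by
  have hμ2 : 0 < μ ^ 2 := by positivity
  have hexpint : IntegrableOn (fun t : ℝ => rexp (-t * μ ^ 2)) (Ioi 0) := by
    have := integrableOn_exp_mul_Ioi (a := -μ ^ 2) (by linarith) 0
    refine this.congr_fun (fun t _ => ?_) measurableSet_Ioi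
    change rexp (-μ ^ 2 * t) = rexp (-t * μ ^ 2)
    rw [neg_mul, neg_mul, mul_comm]
  set g : EuclideanSpace ℝ (Fin n) → ℂ := fun ξ =>
    Complex.exp (((2 * π * inner ℝ ξ x : ℝ) : ℂ) * Complex.I) *
      FourierTransform.fourier (f : EuclideanSpace ℝ (Fin n) → ℂ) ξ with hg
  have hgint : Integrable g := integrable_character_mul_fourier f x
  have hlaplace : ∀ ξ : EuclideanSpace ℝ (Fin n),
      ((((2 * π * ‖ξ‖) ^ 2 : ℝ) : ℂ) + (μ : ℂ) ^ 2)⁻¹ =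
        ∫ t in Ioi (0 : ℝ),
          ((rexp (-t * (2 * π * ‖ξ‖) ^ 2) * rexp (-t * μ ^ 2) : ℝ) : ℂ) := by
    intro ξ
    have hp : 0 < (2 * π * ‖ξ‖) ^ 2 + μ ^ 2 := by positivity
    rw [integral_complex_ofReal]
    have h := integral_exp_mul_Ioi (a := -((2 * π * ‖ξ‖) ^ 2 + μ ^ 2)) (by linarith) 0
    rw [mul_zero, Real.exp_zero] at h
    have e : ∀ t : ℝ, rexp (-t * (2 * π * ‖ξ‖) ^ 2) * rexp (-t * μ ^ 2) =
        rexp (-((2 * π * ‖ξ‖) ^ 2 + μ ^ 2) * t) := by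
      intro t
      rw [← Real.exp_add]
      congr 1
      ring
    simp only [e]
    rw [h, neg_div_neg_eq, one_div]
    push_cast
    rfl
  have hfub1 : Integrable (Function.uncurry fun (ξ : EuclideanSpace ℝ (Fin n)) (t : ℝ) =>
      ((rexp (-t * (2 * π * ‖ξ‖) ^ 2) * rexp (-t * μ ^ 2) : ℝ) : ℂ) * g ξ)
      (volume.prod (volume.restrict (Ioi (0 : ℝ)))) := by
    refine (hgint.norm.mul_prod hexpint).mono' ?_ ?_
    · refine AEStronglyMeasurable.mul ?_ hgint.1.comp_fst
      refine Continuous.aestronglyMeasurable ?_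
      fun_prop
    · have hae : ∀ᵐ p : EuclideanSpace ℝ (Fin n) × ℝ ∂(volume.prod (volume.restrict (Ioi (0 : ℝ)))),
          p.2 ∈ Ioi (0 : ℝ) :=
        Measure.quasiMeasurePreserving_snd.ae (ae_restrict_mem measurableSet_Ioi)
      filter_upwards [hae] with p hp
      have hp0 : 0 < p.2 := hp
      simp only [Function.uncurry]
      rw [norm_mul, Complex.norm_real, Real.norm_of_nonneg (by positivity), mul_comm]
      gcongr
      refine mul_le_of_le_one_left (Real.exp_pos _).le (Real.exp_le_one_iff.2 ?_)
      have : 0 ≤ p.2 * (2 * π * ‖p.1‖) ^ 2 := by positivity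
      linarith
  have hheatnn : ∀ t ∈ Ioi (0 : ℝ), ∀ r : ℝ, 0 ≤ heatKernel n t r * rexp (-t * μ ^ 2) := by
    intro t ht r
    have ht0 : 0 < t := ht
    unfold heatKernel
    positivity
  have hinner : ∀ y, x ≠ y → ((∫ t in Ioi (0 : ℝ),
      heatKernel n t ‖x - y‖ * rexp (-t * μ ^ 2) : ℝ) : ℂ) =
      (((‖x - y‖ ^ (n - 2))⁻¹ : ℝ) : ℂ) * resolventProfile n ((μ : ℂ) * ‖x - y‖) := by
    intro y hy
    have h := (integrableOn_and_integral_heatKernel hn (norm_pos_iff.2 (sub_ne_zero.2 hy)) hμ).2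
    rw [Complex.ofReal_mul μ] at h
    exact h
  have hslit : (μ : ℂ) ∈ Complex.slitPlane := Complex.ofReal_mem_slitPlane.2 hμ
  have hfub2 : Integrable (Function.uncurry fun (y : EuclideanSpace ℝ (Fin n)) (t : ℝ) =>
      ((heatKernel n t ‖x - y‖ * rexp (-t * μ ^ 2) : ℝ) : ℂ) * f y)
      (volume.prod (volume.restrict (Ioi (0 : ℝ)))) := by
    have hmeas : AEStronglyMeasurable (Function.uncurry
        fun (y : EuclideanSpace ℝ (Fin n)) (t : ℝ) =>
          ((heatKernel n t ‖x - y‖ * rexp (-t * μ ^ 2) : ℝ) : ℂ) * f y)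
        (volume.prod (volume.restrict (Ioi (0 : ℝ)))) := by
      have hf : Measurable f := f.continuous.measurable
      refine Measurable.aestronglyMeasurable ?_
      simp only [Function.uncurry_def, heatKernel]
      fun_prop
    rw [integrable_prod_iff hmeas]
    constructor
    · filter_upwards [ae_ne (by omega) x] with y hy
      exact ((integrableOn_and_integral_heatKernel hn
        (norm_pos_iff.2 (sub_ne_zero.2 hy)) hμ).1.ofReal (𝕜 := ℂ)).mul_const (f y)
    · refine (integrable_kernel_mul hn f x hslit (by simpa using hμ.le)).norm.congr ?_
      filter_upwards [ae_ne (by omega) x] with y hy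
      rw [← hinner y hy, norm_mul, Complex.norm_real, Real.norm_of_nonneg
        (setIntegral_nonneg measurableSet_Ioi fun t ht => hheatnn t ht _), ← integral_mul_const]
      refine setIntegral_congr_fun measurableSet_Ioi fun t ht => ?_
      simp only [Function.uncurry]
      rw [norm_mul, Complex.norm_real, Real.norm_of_nonneg (hheatnn t ht _)]
  calc fourierResolvent f x μ
      = ∫ ξ, ∫ t in Ioi (0 : ℝ),
          ((rexp (-t * (2 * π * ‖ξ‖) ^ 2) * rexp (-t * μ ^ 2) : ℝ) : ℂ) * g ξ := by
        refine integral_congr_ae (Eventually.of_forall fun ξ => ?_)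
        simp only
        rw [hlaplace ξ, integral_mul_const]
    _ = ∫ t in Ioi (0 : ℝ), ∫ ξ,
          ((rexp (-t * (2 * π * ‖ξ‖) ^ 2) * rexp (-t * μ ^ 2) : ℝ) : ℂ) * g ξ :=
        integral_integral_swap hfub1
    _ = ∫ t in Ioi (0 : ℝ), ∫ y,
          ((heatKernel n t ‖x - y‖ * rexp (-t * μ ^ 2) : ℝ) : ℂ) * f y := by
        refine setIntegral_congr_fun measurableSet_Ioi fun t ht => ?_
        have h1 : ∀ ξ, ((rexp (-t * (2 * π * ‖ξ‖) ^ 2) * rexp (-t * μ ^ 2) : ℝ) : ℂ) * g ξ =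
            ((rexp (-t * μ ^ 2) : ℝ) : ℂ) * (((rexp (-t * (2 * π * ‖ξ‖) ^ 2) : ℝ) : ℂ) * g ξ) := by
          intro ξ
          push_cast
          ring
        have h2 : ∀ y, ((heatKernel n t ‖x - y‖ * rexp (-t * μ ^ 2) : ℝ) : ℂ) * f y =
            ((rexp (-t * μ ^ 2) : ℝ) : ℂ) * (((heatKernel n t ‖x - y‖ : ℝ) : ℂ) * f y) := by
          intro y
          push_cast
          ring
        simp only [h1, h2]
        rw [integral_const_mul, integral_const_mul, integral_gaussian_mul_fourier f x ht]
    _ = ∫ y, ∫ t in Ioi (0 : ℝ),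
          ((heatKernel n t ‖x - y‖ * rexp (-t * μ ^ 2) : ℝ) : ℂ) * f y :=
        (integral_integral_swap hfub2).symm
    _ = kernelResolvent f x μ := by
        refine integral_congr_ae ?_
        filter_upwards [ae_ne (by omega) x] with y hy
        rw [integral_mul_const, integral_complex_ofReal, hinner y hy]

theorem sq_re_le_norm_ofReal_sq_add_sq (p : ℝ) {μ : ℂ} (hμ : 0 ≤ μ.re) :
    μ.re ^ 2 ≤ ‖((p ^ 2 : ℝ) : ℂ) + μ ^ 2‖ := by
  have e : ((p ^ 2 : ℝ) : ℂ) + μ ^ 2 = ((p : ℂ) + Complex.I * μ) * ((p : ℂ) - Complex.I * μ) := by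
    push_cast
    linear_combination μ ^ 2 * Complex.I_sq
  rw [e, norm_mul, sq]
  have h1 := Complex.abs_im_le_norm ((p : ℂ) + Complex.I * μ)
  have h2 := Complex.abs_im_le_norm ((p : ℂ) - Complex.I * μ)
  simp [abs_of_nonneg hμ] at h1 h2
  exact mul_le_mul h1 h2 hμ (norm_nonneg _)

theorem isOpen_re_pos : IsOpen {μ : ℂ | 0 < μ.re} :=
  isOpen_lt continuous_const Complex.continuous_re

theorem differentiableOn_fourierResolvent {n : ℕ} (f : 𝓢(EuclideanSpace ℝ (Fin n), ℂ))
    (x : EuclideanSpace ℝ (Fin n)) :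
    DifferentiableOn ℂ (fourierResolvent f x) {μ : ℂ | 0 < μ.re} := by
  have hne : ∀ (p : ℝ) (μ : ℂ), 0 < μ.re → ((p ^ 2 : ℝ) : ℂ) + μ ^ 2 ≠ 0 := by
    intro p μ hμ h0
    have h := sq_re_le_norm_ofReal_sq_add_sq p hμ.le
    rw [h0, norm_zero] at h
    have : 0 < μ.re ^ 2 := by positivity
    linarith
  have hint := integrable_character_mul_fourier f x
  refine differentiableOn_integral_of_locally_dominated isOpen_re_pos ?_ ?_ ?_
  · intro μ hμ
    refine AEStronglyMeasurable.mul (Continuous.aestronglyMeasurable ?_) hint.1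
    exact Continuous.inv₀ (by fun_prop) fun ξ => hne (2 * π * ‖ξ‖) μ hμ
  · refine Eventually.of_forall fun ξ μ hμ => ?_
    refine DifferentiableAt.differentiableWithinAt ?_
    have hd : DifferentiableAt ℂ
        (fun μ : ℂ => (((2 * π * ‖ξ‖) ^ 2 : ℝ) : ℂ) + μ ^ 2) μ := by fun_prop
    exact (hd.fun_inv (hne (2 * π * ‖ξ‖) μ hμ)).mul_const _
  · intro μ hμ
    have hμ0 : 0 < μ.re := hμ
    refine ⟨μ.re / 2, by positivity, fun ξ => ((μ.re / 2) ^ 2)⁻¹ *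
      ‖Complex.exp (((2 * π * inner ℝ ξ x : ℝ) : ℂ) * Complex.I) *
        FourierTransform.fourier (f : EuclideanSpace ℝ (Fin n) → ℂ) ξ‖, hint.norm.const_mul _,
      Eventually.of_forall fun ξ w hw hd => ?_⟩
    rw [norm_mul, norm_inv]
    have h1 : μ.re / 2 ≤ w.re := by
      have h2 := Complex.abs_re_le_norm (w - μ)
      rw [← dist_eq_norm, Complex.sub_re] at h2
      have := neg_abs_le (w.re - μ.re)
      linarith
    have h2 := sq_re_le_norm_ofReal_sq_add_sq (2 * π * ‖ξ‖) (le_of_lt hw)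
    have h3 : (μ.re / 2) ^ 2 ≤ w.re ^ 2 := by gcongr
    have h4 : 0 < (μ.re / 2) ^ 2 := by positivity
    exact mul_le_mul_of_nonneg_right (inv_anti₀ h4 (h3.trans h2)) (norm_nonneg _)

theorem differentiableOn_kernelResolvent {n : ℕ} (hn : 3 ≤ n)
    (f : 𝓢(EuclideanSpace ℝ (Fin n), ℂ)) (x : EuclideanSpace ℝ (Fin n)) :
    DifferentiableOn ℂ (kernelResolvent f x) {μ : ℂ | 0 < μ.re} := by
  have hslit : ∀ μ : ℂ, 0 < μ.re → μ ∈ Complex.slitPlane := fun μ h => Or.inl h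
  obtain ⟨C, _, hC⟩ := exists_norm_kernel_mul_le hn
  refine differentiableOn_integral_of_locally_dominated isOpen_re_pos ?_ ?_ ?_
  · exact fun μ hμ => aestronglyMeasurable_kernel_mul hn f x (hslit μ hμ)
  · filter_upwards [ae_ne (by omega) x] with y hy μ hμ
    refine DifferentiableAt.differentiableWithinAt ?_
    refine DifferentiableAt.mul_const (DifferentiableAt.const_mul ?_ _) _
    have h1 : DifferentiableAt ℂ (fun μ : ℂ => μ * (‖x - y‖ : ℂ)) μ := by fun_prop
    exact ((differentiableOn_resolventProfile hn).differentiableAt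
      (Complex.isOpen_slitPlane.mem_nhds (mul_norm_sub_mem_slitPlane (hslit μ hμ) hy))).comp μ h1
  · intro μ _
    refine ⟨1, one_pos, _, (integrable_singular_mul_schwartz hn f x (M := ‖μ‖ + 1) (by positivity)
      (profileExponent_nonneg hn)).const_mul C, Eventually.of_forall fun y w hw hd => ?_⟩
    refine hC f x y _ w (le_of_lt hw) ?_
    have := norm_le_norm_add_norm_sub' w μ
    rw [← dist_eq_norm] at this
    linarith

/-- Both sides are holomorphic in the right half-plane and agree on the positive half-line. -/
theorem fourierResolvent_eq_kernelResolvent {n : ℕ} (hn : 3 ≤ n)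
    (f : 𝓢(EuclideanSpace ℝ (Fin n), ℂ)) (x : EuclideanSpace ℝ (Fin n)) {μ : ℂ} (hμ : 0 < μ.re) :
    fourierResolvent f x μ = kernelResolvent f x μ := by
  have h1 := (differentiableOn_fourierResolvent f x).analyticOnNhd isOpen_re_pos
  have h2 := (differentiableOn_kernelResolvent hn f x).analyticOnNhd isOpen_re_pos
  have hconn : IsPreconnected {μ : ℂ | 0 < μ.re} := (convex_halfSpace_re_gt 0).isPreconnected
  have h0 : (1 : ℂ) ∈ {μ : ℂ | 0 < μ.re} := by simp
  refine h1.eqOn_of_preconnected_of_frequently_eq h2 hconn h0 ?_ hμ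
  have hlim : Tendsto (fun s : ℝ => (s : ℂ)) (𝓝[≠] 1) (𝓝[≠] 1) := by
    refine tendsto_nhdsWithin_iff.2 ⟨?_, ?_⟩
    · exact (Complex.continuous_ofReal.tendsto' 1 1 Complex.ofReal_one).mono_left nhdsWithin_le_nhds
    · filter_upwards [self_mem_nhdsWithin] with s hs
      have : s ≠ 1 := hs
      exact fun h => this (by simpa using h)
  refine hlim.frequently (Eventually.frequently ?_)
  filter_upwards [nhdsWithin_le_nhds (Ioi_mem_nhds (zero_lt_one' ℝ))] with s hs
  exact fourierResolvent_eq_kernelResolvent_ofReal hn f x hs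

/-! ### Partial fractions and the limiting kernel -/

/-- The `2m`-th root of unity `e^{iπk/m}`, whose square is an `m`-th root of unity. -/
noncomputable def halfRoot (m k : ℕ) : ℂ :=
  Complex.exp (((π * k / m : ℝ) : ℂ) * Complex.I)

theorem norm_halfRoot (m k : ℕ) : ‖halfRoot m k‖ = 1 :=
  Complex.norm_exp_ofReal_mul_I _

theorem halfRoot_sq {m : ℕ} (hm : m ≠ 0) (k : ℕ) :
    halfRoot m k ^ 2 = Complex.exp (2 * π * Complex.I / m) ^ k := by
  have hm' : (m : ℂ) ≠ 0 := by exact_mod_cast hm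
  rw [halfRoot, ← Complex.exp_nat_mul, ← Complex.exp_nat_mul]
  congr 1
  push_cast
  field_simp

theorem sum_halfRoot_sq_pow {m : ℕ} (hm : m ≠ 0) (j : ℕ) :
    ∑ k ∈ Finset.range m, (halfRoot m k ^ 2) ^ j = if m ∣ j then (m : ℂ) else 0 := by
  have hprim := Complex.isPrimitiveRoot_exp m hm
  set η := Complex.exp (2 * π * Complex.I / m) with hη
  have e : ∀ k, (halfRoot m k ^ 2) ^ j = (η ^ j) ^ k := by
    intro k
    rw [halfRoot_sq hm, ← pow_mul, ← pow_mul, mul_comm k j]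
  simp only [e]
  split_ifs with h
  · rw [(hprim.pow_eq_one_iff_dvd j).2 h]
    simp
  · have h1 : η ^ j ≠ 1 := fun h1 => h ((hprim.pow_eq_one_iff_dvd j).1 h1)
    rw [geom_sum_eq h1, ← pow_mul, mul_comm, pow_mul, hprim.pow_eq_one, one_pow, sub_self, zero_div]

theorem mul_halfRoot_sq_pow {m : ℕ} (hm : m ≠ 0) (ζ : ℂ) (k : ℕ) :
    ((ζ * halfRoot m k) ^ 2) ^ m = ζ ^ (2 * m) := by
  have h : (halfRoot m k ^ 2) ^ m = 1 := by
    rw [halfRoot_sq hm, ← pow_mul, mul_comm k m, pow_mul, (Complex.isPrimitiveRoot_exp m hm).pow_eq_one,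
      one_pow]
  rw [mul_pow, mul_pow, h, mul_one, ← pow_mul]

/-- The partial fraction decomposition of `(s^m - ζ^{2m})⁻¹` over the roots `(ζ e^{iπk/m})²`. -/
theorem inv_pow_sub_pow_eq_sum {m : ℕ} (hm : m ≠ 0) {ζ s : ℂ} (hζ : ζ ≠ 0)
    (hs : s ^ m ≠ ζ ^ (2 * m)) :
    (s ^ m - ζ ^ (2 * m))⁻¹ = ((m : ℂ) * ζ ^ (2 * m))⁻¹ *
      ∑ k ∈ Finset.range m, (ζ * halfRoot m k) ^ 2 * (s - (ζ * halfRoot m k) ^ 2)⁻¹ := by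
  have hm' : (m : ℂ) ≠ 0 := by exact_mod_cast hm
  have hne : ∀ k, s - (ζ * halfRoot m k) ^ 2 ≠ 0 := by
    intro k h
    apply hs
    rw [sub_eq_zero.1 h, mul_halfRoot_sq_pow hm]
  have hdiff : s ^ m - ζ ^ (2 * m) ≠ 0 := sub_ne_zero.2 hs
  have hsum : (∑ k ∈ Finset.range m, (ζ * halfRoot m k) ^ 2 * (s - (ζ * halfRoot m k) ^ 2)⁻¹) *
      (s ^ m - ζ ^ (2 * m)) = m * ζ ^ (2 * m) := by
    have h1 : ∀ k, (ζ * halfRoot m k) ^ 2 * (s - (ζ * halfRoot m k) ^ 2)⁻¹ *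
        (s ^ m - ζ ^ (2 * m)) = ∑ i ∈ Finset.range m,
          s ^ i * ζ ^ (2 * (m - i)) * (halfRoot m k ^ 2) ^ (m - i) := by
      intro k
      rw [← mul_halfRoot_sq_pow hm ζ k, ← geom_sum₂_mul, mul_comm (∑ i ∈ Finset.range m, _),
        ← mul_assoc, mul_assoc (_ ^ 2), inv_mul_cancel₀ (hne k), mul_one, Finset.mul_sum]
      refine Finset.sum_congr rfl fun i hi => ?_
      have hi' : m - i = (m - 1 - i) + 1 := by have := Finset.mem_range.1 hi; omega
      rw [hi']
      ring
    rw [Finset.sum_mul, Finset.sum_congr rfl fun k _ => h1 k, Finset.sum_comm]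
    simp only [← Finset.mul_sum, sum_halfRoot_sq_pow hm]
    rw [Finset.sum_eq_single 0]
    · simp
      ring
    · intro i hi hi0
      have : ¬ m ∣ m - i := by
        intro hd
        have := Nat.le_of_dvd (by have := Finset.mem_range.1 hi; omega) hd
        omega
      rw [if_neg this, mul_zero]
    · intro h
      exact absurd (Finset.mem_range.2 (Nat.pos_of_ne_zero hm)) h
  generalize ∑ k ∈ Finset.range m, (ζ * halfRoot m k) ^ 2 * (s - (ζ * halfRoot m k) ^ 2)⁻¹ = S
    at hsum ⊢
  have h2 : (m : ℂ) * ζ ^ (2 * m) ≠ 0 := mul_ne_zero hm' (pow_ne_zero _ hζ)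
  field_simp
  linear_combination -hsum

theorem freeResolvent_apply {n : ℕ} (m : ℕ) {z : ℂ} (hz : z.im ≠ 0)
    (f : 𝓢(EuclideanSpace ℝ (Fin n), ℂ)) (x : EuclideanSpace ℝ (Fin n)) :
    freeResolvent m z f x = ∫ ξ, ((((2 * π * ‖ξ‖) ^ (2 * m) : ℝ) : ℂ) - z)⁻¹ *
      (Complex.exp (((2 * π * inner ℝ ξ x : ℝ) : ℂ) * Complex.I) *
        FourierTransform.fourier (f : EuclideanSpace ℝ (Fin n) → ℂ) ξ) := by
  rw [freeResolvent, SchwartzMap.fourierMultiplierCLM_apply, SchwartzMap.fourierInv_coe,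
    Real.fourierInv_eq']
  refine integral_congr_ae (Eventually.of_forall fun ξ => ?_)
  simp only
  rw [SchwartzMap.smulLeftCLM_apply_apply (hasTemperateGrowth_freeSymbol_inv m z hz),
    SchwartzMap.fourier_coe, smul_eq_mul, smul_eq_mul]
  ring

theorem freeResolvent_eq_sum_kernelResolvent {m n : ℕ} (hm : m ≠ 0) (hn : 3 ≤ n) {ζ : ℂ}
    (hz : (ζ ^ (2 * m)).im ≠ 0) (hζ : ∀ k < m, 0 < (-Complex.I * (ζ * halfRoot m k)).re)
    (f : 𝓢(EuclideanSpace ℝ (Fin n), ℂ)) (x : EuclideanSpace ℝ (Fin n)) :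
    freeResolvent m (ζ ^ (2 * m)) f x = ((m : ℂ) * ζ ^ (2 * m))⁻¹ *
      ∑ k ∈ Finset.range m, (ζ * halfRoot m k) ^ 2 *
        kernelResolvent f x (-Complex.I * (ζ * halfRoot m k)) := by
  have hζ0 : ζ ≠ 0 := by
    rintro rfl
    simp [hm] at hz
  have hint := integrable_character_mul_fourier f x
  have hsq : ∀ k, (-Complex.I * (ζ * halfRoot m k)) ^ 2 = -(ζ * halfRoot m k) ^ 2 := by
    intro k
    rw [mul_pow, neg_sq, Complex.I_sq]
    ring
  have hterm : ∀ k ∈ Finset.range m, Integrable fun ξ : EuclideanSpace ℝ (Fin n) =>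
      ((m : ℂ) * ζ ^ (2 * m))⁻¹ * (ζ * halfRoot m k) ^ 2 *
      (((((2 * π * ‖ξ‖) ^ 2 : ℝ) : ℂ) + (-Complex.I * (ζ * halfRoot m k)) ^ 2)⁻¹ *
      (Complex.exp (((2 * π * inner ℝ ξ x : ℝ) : ℂ) * Complex.I) *
        FourierTransform.fourier (f : EuclideanSpace ℝ (Fin n) → ℂ) ξ)) := by
    intro k hk
    refine Integrable.const_mul ?_ _
    have hre := hζ k (Finset.mem_range.1 hk)
    set μ := -Complex.I * (ζ * halfRoot m k)
    have hb : ∀ p : ℝ, μ.re ^ 2 ≤ ‖((p ^ 2 : ℝ) : ℂ) + μ ^ 2‖ :=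
      fun p => sq_re_le_norm_ofReal_sq_add_sq p hre.le
    have hpos : 0 < μ.re ^ 2 := by positivity
    refine (hint.norm.const_mul ((μ.re ^ 2)⁻¹)).mono' (AEStronglyMeasurable.mul
      (Measurable.aestronglyMeasurable (by fun_prop)) hint.1) (Eventually.of_forall fun ξ => ?_)
    rw [norm_mul, norm_inv]
    exact mul_le_mul_of_nonneg_right (inv_anti₀ hpos (hb _)) (norm_nonneg _)
  rw [freeResolvent_apply m hz]
  calc _ = ∫ ξ, ∑ k ∈ Finset.range m, ((m : ℂ) * ζ ^ (2 * m))⁻¹ * (ζ * halfRoot m k) ^ 2 *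
      (((((2 * π * ‖ξ‖) ^ 2 : ℝ) : ℂ) + (-Complex.I * (ζ * halfRoot m k)) ^ 2)⁻¹ *
      (Complex.exp (((2 * π * inner ℝ ξ x : ℝ) : ℂ) * Complex.I) *
        FourierTransform.fourier (f : EuclideanSpace ℝ (Fin n) → ℂ) ξ)) := by
        refine integral_congr_ae (Eventually.of_forall fun ξ => ?_)
        have hpow : (((2 * π * ‖ξ‖) ^ (2 * m) : ℝ) : ℂ) = (((2 * π * ‖ξ‖) ^ 2 : ℝ) : ℂ) ^ m := by
          rw [pow_mul, Complex.ofReal_pow _ m]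
        have hs : (((2 * π * ‖ξ‖) ^ 2 : ℝ) : ℂ) ^ m ≠ ζ ^ (2 * m) := by
          intro h
          apply hz
          rw [← h, ← Complex.ofReal_pow, Complex.ofReal_im]
        simp only
        rw [hpow, inv_pow_sub_pow_eq_sum hm hζ0 hs, mul_assoc, Finset.sum_mul, Finset.mul_sum]
        refine Finset.sum_congr rfl fun k _ => ?_
        rw [hsq, ← sub_eq_add_neg]
        ring
    _ = _ := by
        rw [integral_finsetSum _ hterm, Finset.mul_sum]
        refine Finset.sum_congr rfl fun k hk => ?_
        rw [integral_const_mul, mul_assoc,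
          ← fourierResolvent_eq_kernelResolvent hn f x (hζ k (Finset.mem_range.1 hk))]
        rfl

theorem tendsto_kernelResolvent {n : ℕ} (hn : 3 ≤ n) (f : 𝓢(EuclideanSpace ℝ (Fin n), ℂ))
    (x : EuclideanSpace ℝ (Fin n)) {ι : Type*} {l : Filter ι} [l.IsCountablyGenerated]
    {μ : ι → ℂ} {μ₀ : ℂ} (hμ₀ : μ₀ ∈ Complex.slitPlane) (hμ : ∀ᶠ i in l, 0 < (μ i).re)
    (hlim : Tendsto μ l (𝓝 μ₀)) :
    Tendsto (fun i => kernelResolvent f x (μ i)) l (𝓝 (kernelResolvent f x μ₀)) := by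
  obtain ⟨C, _, hC⟩ := exists_norm_kernel_mul_le hn
  refine tendsto_integral_filter_of_dominated_convergence _ ?_ ?_
    ((integrable_singular_mul_schwartz hn f x (M := ‖μ₀‖ + 1) (by positivity)
      (profileExponent_nonneg hn)).const_mul C) ?_
  · filter_upwards [hμ] with i hi
    exact aestronglyMeasurable_kernel_mul hn f x (Or.inl hi)
  · have hb : ∀ᶠ i in l, ‖μ i‖ < ‖μ₀‖ + 1 := hlim.norm.eventually_lt_const (by linarith)
    filter_upwards [hμ, hb] with i hi hb
    exact Eventually.of_forall fun y => hC f x y _ (μ i) hi.le hb.le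
  · filter_upwards [ae_ne (by omega) x] with y hy
    have hcont : ContinuousAt (resolventProfile n) (μ₀ * ‖x - y‖) :=
      ((differentiableOn_resolventProfile hn).differentiableAt
        (Complex.isOpen_slitPlane.mem_nhds (mul_norm_sub_mem_slitPlane hμ₀ hy))).continuousAt
    exact ((hcont.tendsto.comp (hlim.mul_const _)).const_mul _).mul_const _

/-- The kernel of the limiting resolvent `((-Δ)^m - ζ^{2m})⁻¹` at distance `r`. -/
noncomputable def limitingKernel (m n : ℕ) (ζ : ℂ) (r : ℝ) : ℂ :=
  (((r ^ (n - 2))⁻¹ : ℝ) : ℂ) * (((m : ℂ) * ζ ^ (2 * m))⁻¹ *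
    ∑ k ∈ Finset.range m, (ζ * halfRoot m k) ^ 2 *
      resolventProfile n (-Complex.I * (ζ * halfRoot m k) * r))

/-- For `Re ζ > 0` the arguments of the profile avoid the negative half-line, since `-iζe^{iφ}` with
`0 ≤ φ < π` lies in it only if `ζ` has argument `3π/2 - φ` modulo `2π`. -/
theorem neg_I_mul_halfRoot_mem_slitPlane {m k : ℕ} (hk : k < m) {ζ : ℂ} (hζ : 0 < ζ.re) :
    -Complex.I * (ζ * halfRoot m k) ∈ Complex.slitPlane := by
  have hm : (0 : ℝ) < m := by exact_mod_cast (Nat.zero_le k).trans_lt hk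
  set φ : ℝ := π * k / m with hφ
  have hφ0 : 0 ≤ φ := by positivity
  have hφπ : φ < π := by
    rw [hφ, div_lt_iff₀ hm]
    have : (k : ℝ) < m := by exact_mod_cast hk
    exact mul_lt_mul_of_pos_left this Real.pi_pos
  have hre : (-Complex.I * (ζ * halfRoot m k)).re = ζ.re * Real.sin φ + ζ.im * Real.cos φ := by
    rw [halfRoot, ← hφ]
    simp [Complex.exp_ofReal_mul_I_re, Complex.exp_ofReal_mul_I_im]
  have him : (-Complex.I * (ζ * halfRoot m k)).im = -(ζ.re * Real.cos φ - ζ.im * Real.sin φ) := by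
    rw [halfRoot, ← hφ]
    simp [Complex.exp_ofReal_mul_I_re, Complex.exp_ofReal_mul_I_im]
  rw [Complex.mem_slitPlane_iff, hre, him]
  by_contra! hcon
  obtain ⟨h1, h2⟩ := hcon
  have hsin : 0 ≤ Real.sin φ := Real.sin_nonneg_of_nonneg_of_le_pi hφ0 hφπ.le
  have hsc := Real.sin_sq_add_cos_sq φ
  have h3 : (ζ.re * Real.sin φ + ζ.im * Real.cos φ) * Real.sin φ = ζ.re := by
    linear_combination ζ.re * hsc + Real.cos φ * h2
  have h4 : (ζ.re * Real.sin φ + ζ.im * Real.cos φ) * Real.sin φ ≤ 0 :=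
    mul_nonpos_of_nonpos_of_nonneg h1 hsin
  linarith

theorem re_neg_I_mul_halfRoot_nonneg {m k : ℕ} (hk : k < m) {lam : ℝ} (hlam : 0 < lam) :
    0 ≤ (-Complex.I * ((lam : ℂ) * halfRoot m k)).re := by
  have hm : (0 : ℝ) < m := by exact_mod_cast (Nat.zero_le k).trans_lt hk
  have hφπ : π * k / m ≤ π := by
    rw [div_le_iff₀ hm]
    have : (k : ℝ) ≤ m := by exact_mod_cast hk.le
    exact mul_le_mul_of_nonneg_left this Real.pi_pos.le
  have hre : (-Complex.I * ((lam : ℂ) * halfRoot m k)).re = lam * Real.sin (π * k / m) := by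
    rw [halfRoot]
    simp [Complex.exp_ofReal_mul_I_im, -Complex.ofReal_div, -Complex.ofReal_mul]
  rw [hre]
  exact mul_nonneg hlam.le (Real.sin_nonneg_of_nonneg_of_le_pi (by positivity) hφπ)

theorem re_neg_I_mul_cpow_halfRoot_pos {m k : ℕ} (hk : k < m) {z : ℂ} (hz : 0 < z.im) :
    0 < (-Complex.I * (z ^ (((2 * m : ℕ) : ℂ)⁻¹) * halfRoot m k)).re := by
  have hm : (0 : ℝ) < m := by exact_mod_cast (Nat.zero_le k).trans_lt hk
  have hz0 : z ≠ 0 := by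
    rintro rfl
    simp at hz
  have harg0 : 0 < z.arg := by
    refine lt_of_le_of_ne (Complex.arg_nonneg_iff.2 hz.le) fun h => ?_
    have := (Complex.arg_eq_zero_iff.1 h.symm).2
    linarith
  have hargπ : z.arg ≤ π := Complex.arg_le_pi z
  have hexp : z ^ (((2 * m : ℕ) : ℂ)⁻¹) * halfRoot m k =
      Complex.exp (((Real.log ‖z‖ / (2 * m) : ℝ) : ℂ) +
        ((z.arg / (2 * m) + π * k / m : ℝ) : ℂ) * Complex.I) := by
    have hm' : (m : ℂ) ≠ 0 := by exact_mod_cast hm.ne'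
    rw [halfRoot, Complex.cpow_def_of_ne_zero hz0, ← Complex.exp_add]
    congr 1
    rw [Complex.log]
    push_cast
    field_simp
    ring
  have hre : (-Complex.I * (z ^ (((2 * m : ℕ) : ℂ)⁻¹) * halfRoot m k)).re =
      rexp (Real.log ‖z‖ / (2 * m)) * Real.sin (z.arg / (2 * m) + π * k / m) := by
    rw [hexp]
    have : ∀ w : ℂ, (-Complex.I * w).re = w.im := fun w => by simp
    rw [this, Complex.exp_im, Complex.add_re, Complex.add_im, Complex.re_ofReal_mul,
      Complex.im_ofReal_mul, Complex.ofReal_re, Complex.ofReal_im, Complex.I_re, Complex.I_im]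
    simp only [mul_zero, add_zero, mul_one, zero_add]
  rw [hre]
  refine mul_pos (Real.exp_pos _) (Real.sin_pos_of_pos_of_lt_pi ?_ ?_)
  · have : 0 < z.arg / (2 * m) := by positivity
    have : 0 ≤ π * k / m := by positivity
    linarith
  · have h1 : (k : ℝ) + 1 ≤ m := by exact_mod_cast hk
    have e : z.arg / (2 * m) + π * k / m = (z.arg + 2 * (π * k)) / (2 * m) := by field_simp
    rw [e, div_lt_iff₀ (by positivity)]
    have h2 : π * (k + 1) ≤ π * m := mul_le_mul_of_nonneg_left h1 Real.pi_pos.le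
    have := Real.pi_pos
    linarith

theorem continuousOn_limitingKernel {m n : ℕ} (hn : 3 ≤ n) {lam : ℝ} (hlam : 0 < lam) :
    ContinuousOn (fun p : EuclideanSpace ℝ (Fin n) × EuclideanSpace ℝ (Fin n) =>
      limitingKernel m n lam ‖p.1 - p.2‖) {p | p.1 ≠ p.2} := by
  unfold limitingKernel
  refine ContinuousOn.mul ?_ (ContinuousOn.mul continuousOn_const (continuousOn_finsetSum _
    fun k hk => ContinuousOn.mul continuousOn_const ?_))
  · refine Complex.continuous_ofReal.comp_continuousOn (ContinuousOn.inv₀ (by fun_prop) ?_)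
    intro p hp
    exact pow_ne_zero _ (norm_ne_zero_iff.2 (sub_ne_zero.2 hp))
  · refine (differentiableOn_resolventProfile hn).continuousOn.comp (by fun_prop) ?_
    intro p hp
    exact mul_norm_sub_mem_slitPlane (neg_I_mul_halfRoot_mem_slitPlane (Finset.mem_range.1 hk)
      (by simpa using hlam)) hp

/-- The limit is taken along `ζ = (λ^{2m} + iδ)^{1/(2m)}`, for which all the points
`-iζe^{iπk/m}`, `k < m`, lie in the open right half-plane. -/
theorem isFreeResolventKernel_limitingKernel {m n : ℕ} (hm : m ≠ 0) (hn : 3 ≤ n) {lam : ℝ}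
    (hlam : 0 < lam) :
    IsFreeResolventKernel (n := n) m lam (fun x y => limitingKernel m n lam ‖x - y‖) := by
  have hslit : ∀ k ∈ Finset.range m, -Complex.I * ((lam : ℂ) * halfRoot m k) ∈ Complex.slitPlane :=
    fun k hk => neg_I_mul_halfRoot_mem_slitPlane (Finset.mem_range.1 hk) (by simpa using hlam)
  have hsplit : ∀ (f : 𝓢(EuclideanSpace ℝ (Fin n), ℂ)) (x y : EuclideanSpace ℝ (Fin n)),
      limitingKernel m n lam ‖x - y‖ * f y = ∑ k ∈ Finset.range m,
        (((m : ℂ) * (lam : ℂ) ^ (2 * m))⁻¹ * ((lam : ℂ) * halfRoot m k) ^ 2) *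
          ((((‖x - y‖ ^ (n - 2))⁻¹ : ℝ) : ℂ) *
            resolventProfile n (-Complex.I * ((lam : ℂ) * halfRoot m k) * ‖x - y‖) * f y) := by
    intro f x y
    rw [limitingKernel, Finset.mul_sum, Finset.mul_sum, Finset.sum_mul]
    refine Finset.sum_congr rfl fun k _ => ?_
    ring
  have hterm : ∀ (f : 𝓢(EuclideanSpace ℝ (Fin n), ℂ)) (x : EuclideanSpace ℝ (Fin n)),
      ∀ k ∈ Finset.range m, Integrable fun y =>
        (((m : ℂ) * (lam : ℂ) ^ (2 * m))⁻¹ * ((lam : ℂ) * halfRoot m k) ^ 2) *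
          ((((‖x - y‖ ^ (n - 2))⁻¹ : ℝ) : ℂ) *
            resolventProfile n (-Complex.I * ((lam : ℂ) * halfRoot m k) * ‖x - y‖) * f y) :=
    fun f x k hk => (integrable_kernel_mul hn f x (hslit k hk)
      (re_neg_I_mul_halfRoot_nonneg (Finset.mem_range.1 hk) hlam)).const_mul _
  refine ⟨continuousOn_limitingKernel hn hlam, fun f x => ?_, fun f x => ?_⟩
  · simp only [hsplit f x]
    exact integrable_finsetSum _ (hterm f x)
  · have hval : ∫ y, limitingKernel m n lam ‖x - y‖ * f y =
        ((m : ℂ) * (lam : ℂ) ^ (2 * m))⁻¹ * ∑ k ∈ Finset.range m,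
          ((lam : ℂ) * halfRoot m k) ^ 2 *
            kernelResolvent f x (-Complex.I * ((lam : ℂ) * halfRoot m k)) := by
      simp only [hsplit f x]
      rw [integral_finsetSum _ (hterm f x), Finset.mul_sum]
      refine Finset.sum_congr rfl fun k _ => ?_
      rw [integral_const_mul, kernelResolvent, mul_assoc]
    set Z : ℝ → ℂ := fun δ => ((lam ^ (2 * m) : ℝ) : ℂ) + δ * Complex.I with hZ
    set ζ : ℝ → ℂ := fun δ => Z δ ^ (((2 * m : ℕ) : ℂ)⁻¹) with hζ
    have h2m : 2 * m ≠ 0 := by omega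
    have hZim : ∀ δ, (Z δ).im = δ := by
      intro δ
      simp only [hZ, Complex.add_im, Complex.ofReal_im, zero_add, Complex.im_ofReal_mul,
        Complex.I_im, mul_one]
    have hpow : ∀ δ, ζ δ ^ (2 * m) = Z δ := fun δ => Complex.cpow_nat_inv_pow _ h2m
    have hlim : Tendsto ζ (𝓝[>] 0) (𝓝 (lam : ℂ)) := by
      have h0 : ζ 0 = (lam : ℂ) := by
        simp only [hζ, hZ]
        rw [Complex.ofReal_zero, zero_mul, add_zero, Complex.ofReal_pow]
        refine Complex.pow_cpow_nat_inv h2m ?_ ?_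
        · rw [Complex.arg_ofReal_of_nonneg hlam.le]
          have : 0 < π / ((2 * m : ℕ) : ℝ) := by
            have : (0 : ℝ) < ((2 * m : ℕ) : ℝ) := by exact_mod_cast Nat.pos_of_ne_zero h2m
            positivity
          linarith
        · rw [Complex.arg_ofReal_of_nonneg hlam.le]
          positivity
      have hc : ContinuousAt ζ 0 := by
        refine ContinuousAt.cpow (by fun_prop) continuousAt_const ?_
        left
        simp [hZ]
        norm_cast
        positivity
      rw [← h0]
      exact hc.tendsto.mono_left nhdsWithin_le_nhds
    rw [hval]
    have hmain : Tendsto (fun δ => ((m : ℂ) * ζ δ ^ (2 * m))⁻¹ * ∑ k ∈ Finset.range m,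
        (ζ δ * halfRoot m k) ^ 2 * kernelResolvent f x (-Complex.I * (ζ δ * halfRoot m k)))
        (𝓝[>] 0) (𝓝 (((m : ℂ) * (lam : ℂ) ^ (2 * m))⁻¹ * ∑ k ∈ Finset.range m,
          ((lam : ℂ) * halfRoot m k) ^ 2 *
            kernelResolvent f x (-Complex.I * ((lam : ℂ) * halfRoot m k)))) := by
      refine Tendsto.mul (Tendsto.inv₀ ((hlim.pow _).const_mul _) ?_)
        (tendsto_finsetSum _ fun k hk => Tendsto.mul ((hlim.mul_const _).pow _) ?_)
      · exact mul_ne_zero (by exact_mod_cast hm) (pow_ne_zero _ (by exact_mod_cast hlam.ne'))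
      · refine tendsto_kernelResolvent hn f x (hslit k hk) ?_ ((hlim.mul_const _).const_mul _)
        filter_upwards [self_mem_nhdsWithin] with δ hδ
        exact re_neg_I_mul_cpow_halfRoot_pos (Finset.mem_range.1 hk) (by rw [hZim]; exact hδ)
    refine hmain.congr' ?_
    filter_upwards [self_mem_nhdsWithin] with δ hδ
    have hδ0 : 0 < δ := hδ
    rw [← freeResolvent_eq_sum_kernelResolvent hm hn (by rw [hpow, hZim]; exact hδ0.ne')
      (fun k hk => re_neg_I_mul_cpow_halfRoot_pos hk (by rw [hZim]; exact hδ0)), hpow]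

/-! ### Uniqueness of the kernel -/

/-- The kernel is unique off the diagonal: the difference of two kernels is continuous away from `x`
and integrates to zero against every test function. -/
theorem IsFreeResolventKernel.eq_of_ne {n m : ℕ} {lam : ℝ}
    {K K' : EuclideanSpace ℝ (Fin n) → EuclideanSpace ℝ (Fin n) → ℂ}
    (h : IsFreeResolventKernel m lam K) (h' : IsFreeResolventKernel m lam K')
    {x y : EuclideanSpace ℝ (Fin n)} (hxy : x ≠ y) : K x y = K' x y := by
  have hcont : ∀ {L : EuclideanSpace ℝ (Fin n) → EuclideanSpace ℝ (Fin n) → ℂ},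
      IsFreeResolventKernel m lam L → ContinuousOn (fun y => L x y) {x}ᶜ := by
    intro L hL
    refine hL.continuousOn.comp (f := fun y => (x, y)) (by fun_prop) ?_
    intro y hy hxy
    exact hy hxy.symm
  have hopen : IsOpen ({x}ᶜ : Set (EuclideanSpace ℝ (Fin n))) := isOpen_compl_singleton
  have hsub : ContinuousOn (fun y => K x y - K' x y) {x}ᶜ := (hcont h).sub (hcont h')
  have hae := hopen.ae_eq_zero_of_integral_contDiff_smul_eq_zero (μ := volume)
    (hsub.locallyIntegrableOn hopen.measurableSet) (by
      intro g hg hgs _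
      have hgc : ContDiff ℝ ((⊤ : ℕ∞) : WithTop ℕ∞) (fun y => (g y : ℂ)) :=
        Complex.ofRealCLM.contDiff.comp hg
      have hgcs : HasCompactSupport (fun y => (g y : ℂ)) :=
        hgs.comp_left (g := fun t : ℝ => (t : ℂ)) Complex.ofReal_zero
      set f : 𝓢(EuclideanSpace ℝ (Fin n), ℂ) := hgcs.toSchwartzMap hgc with hf
      have hfg : ∀ y, f y = (g y : ℂ) := fun y => rfl
      have heq : ∫ y, K x y * f y = ∫ y, K' x y * f y :=
        tendsto_nhds_unique (h.tendsto f x) (h'.tendsto f x)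
      have e : ∀ y, g y • (K x y - K' x y) = K x y * f y - K' x y * f y := by
        intro y
        rw [hfg, Complex.real_smul]
        ring
      simp only [e]
      rw [integral_sub (h.integrable f x) (h'.integrable f x), heq, sub_self])
  have hres : (fun y => K x y - K' x y) =ᵐ[volume.restrict {x}ᶜ] fun _ => 0 :=
    (ae_restrict_iff' hopen.measurableSet).2 hae
  have := Measure.eqOn_open_of_ae_eq hres hopen hsub continuousOn_const
  exact sub_eq_zero.1 (this (x := y) fun hy => hxy hy.symm)

/-! ### Cauchy estimates on the positive half-line -/

theorem iteratedDeriv_ofReal_eq {F : ℂ → ℂ} (hF : DifferentiableOn ℂ F {z : ℂ | 0 < z.re})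
    (l : ℕ) : ∀ t : ℝ, 0 < t →
      iteratedDeriv l (fun s : ℝ => F s) t = iteratedDeriv l F (t : ℂ) := by
  induction l with
  | zero => simp
  | succ l ih =>
    intro t ht
    rw [iteratedDeriv_succ, iteratedDeriv_succ]
    have h1 : iteratedDeriv l (fun s : ℝ => F s) =ᶠ[𝓝 t] fun s : ℝ => iteratedDeriv l F (s : ℂ) := by
      filter_upwards [Ioi_mem_nhds ht] with s hs using ih s hs
    rw [h1.deriv_eq]
    have h2 : AnalyticAt ℂ F (t : ℂ) :=
      hF.analyticAt (isOpen_re_pos.mem_nhds (by simpa using ht))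
    have h3 : AnalyticAt ℂ (iteratedDeriv l F) (t : ℂ) := by
      rw [iteratedDeriv_eq_iterate]
      exact h2.iterated_deriv l
    exact h3.differentiableAt.hasDerivAt.comp_ofReal.deriv

theorem contDiffOn_comp_ofReal {F : ℂ → ℂ} (hF : DifferentiableOn ℂ F {z : ℂ | 0 < z.re})
    (N : WithTop ℕ∞) : ContDiffOn ℝ N (fun s : ℝ => F s) (Ioi 0) := by
  have h1 : ContDiffOn ℝ N F {z : ℂ | 0 < z.re} :=
    (hF.contDiffOn isOpen_re_pos).restrict_scalars ℝ
  refine h1.comp (Complex.ofRealCLM.contDiff.contDiffOn) ?_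
  intro s hs
  simpa using hs

theorem re_pos_of_norm_sub_le {lam R : ℝ} (hR : R < lam) {z : ℂ} (hz : ‖z - lam‖ ≤ R) :
    0 < z.re := by
  have h1 := (Complex.abs_re_le_norm (z - lam)).trans hz
  rw [Complex.sub_re, Complex.ofReal_re] at h1
  have := neg_abs_le (z.re - lam)
  linarith

theorem norm_iteratedDeriv_ofReal_le {F : ℂ → ℂ} (hF : DifferentiableOn ℂ F {z : ℂ | 0 < z.re})
    {lam R B : ℝ} (hR : 0 < R) (hRlam : R < lam) (l : ℕ)
    (hB : ∀ z : ℂ, ‖z - lam‖ ≤ R → ‖F z‖ ≤ B) :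
    ‖iteratedDeriv l (fun s : ℝ => F s) lam‖ ≤ l.factorial * B / R ^ l := by
  rw [iteratedDeriv_ofReal_eq hF l lam (hR.trans hRlam)]
  refine Complex.norm_iteratedDeriv_le_of_forall_mem_sphere_norm_le l hR ?_ ?_
  · refine DifferentiableOn.diffContOnCl_ball hF ?_
    intro z hz
    rw [Metric.mem_closedBall, dist_eq_norm] at hz
    exact re_pos_of_norm_sub_le hRlam hz
  · intro z hz
    rw [mem_sphere_iff_norm] at hz
    exact hB z hz.le

/-! ### Bounds for the error term -/

/-- The constant in front of `|x-y|^{s-n}` in `rieszKernel s x y`. -/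
noncomputable def rieszConst (n : ℕ) (s : ℝ) : ℝ :=
  Real.Gamma (((n : ℝ) - s) / 2) / (2 ^ s * π ^ ((n : ℝ) / 2) * Real.Gamma (s / 2))

theorem neg_one_pow_mul_profileCoeff (n j : ℕ) :
    (-1) ^ j * profileCoeff n j = rieszConst n (2 * ((j : ℝ) + 1)) := by
  have h1 : ((-1 : ℝ) ^ j) * (-1) ^ j = 1 := by rw [← mul_pow]; norm_num
  have hG : Real.Gamma (2 * ((j : ℝ) + 1) / 2) = (j.factorial : ℝ) := by
    rw [mul_div_cancel_left₀ _ (two_ne_zero), Real.Gamma_nat_eq_factorial]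
  have hg : ((n : ℝ) - 2 * ((j : ℝ) + 1)) / 2 = (n : ℝ) / 2 - j - 1 := by ring
  have h4 : (4 * π : ℝ) ^ (-((n : ℝ) / 2)) * 4 ^ ((n : ℝ) / 2 - j - 1) =
      (2 ^ (2 * ((j : ℝ) + 1)) * π ^ ((n : ℝ) / 2))⁻¹ := by
    have h2 : (2 : ℝ) ^ (2 * ((j : ℝ) + 1)) = 4 ^ ((j : ℝ) + 1) := by
      rw [Real.rpow_mul (by norm_num)]
      norm_num
    have e : -((n : ℝ) / 2) + ((n : ℝ) / 2 - j - 1) = -((j : ℝ) + 1) := by ring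
    rw [Real.mul_rpow (by norm_num) Real.pi_pos.le, mul_right_comm, ← Real.rpow_add (by norm_num),
      h2, e, Real.rpow_neg (by norm_num), Real.rpow_neg Real.pi_pos.le, mul_inv]
  rw [rieszConst, profileCoeff, hG, hg]
  set G := Real.Gamma ((n : ℝ) / 2 - j - 1)
  calc _ = ((-1 : ℝ) ^ j * (-1) ^ j) * ((4 * π : ℝ) ^ (-((n : ℝ) / 2)) *
        4 ^ ((n : ℝ) / 2 - j - 1)) * G / (j.factorial : ℝ) := by ring
    _ = _ := by
      rw [h1, h4]
      field_simp

/-- The two explicit terms `G₀ + ζ^{2m} G₁` of the expansion, at distance `r`. -/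
noncomputable def leadingPart (m n : ℕ) (ζ : ℂ) (r : ℝ) : ℂ :=
  ((rieszConst n (2 * (m : ℝ)) * r ^ (2 * (m : ℝ) - n) : ℝ) : ℂ) +
    ζ ^ (2 * m) * ((rieszConst n (4 * (m : ℝ)) * r ^ (4 * (m : ℝ) - n) : ℝ) : ℂ)

/-- Summation over the `m`-th roots of unity keeps only the powers `w^{2m-2}` and `w^{4m-2}` of
the Taylor polynomial of the profile. -/
theorem leadingPart_eq {m n : ℕ} (hm : 1 ≤ m) (hn : 3 ≤ n) {ζ : ℂ} (hζ : ζ ≠ 0) {r : ℝ}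
    (hr : 0 < r) :
    leadingPart m n ζ r = (((r ^ (n - 2))⁻¹ : ℝ) : ℂ) * (((m : ℂ) * ζ ^ (2 * m))⁻¹ *
      ∑ k ∈ Finset.range m, (ζ * halfRoot m k) ^ 2 * ∑ j ∈ Finset.range (2 * m),
        (profileCoeff n j : ℂ) * (-Complex.I * (ζ * halfRoot m k) * r) ^ (2 * j)) := by
  have hm0 : m ≠ 0 := by omega
  have hmC : (m : ℂ) ≠ 0 := by exact_mod_cast hm0
  have hterm : ∀ k j : ℕ, (ζ * halfRoot m k) ^ 2 *
      ((profileCoeff n j : ℂ) * (-Complex.I * (ζ * halfRoot m k) * r) ^ (2 * j)) =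
      (((-1) ^ j * profileCoeff n j : ℝ) : ℂ) * (ζ ^ (2 * (j + 1)) * (r : ℂ) ^ (2 * j)) *
        (halfRoot m k ^ 2) ^ (j + 1) := by
    intro k j
    have h1 : (-Complex.I * (ζ * halfRoot m k) * r) ^ (2 * j) =
        (-1) ^ j * ζ ^ (2 * j) * (halfRoot m k ^ 2) ^ j * (r : ℂ) ^ (2 * j) := by
      rw [mul_pow, mul_pow, mul_pow, pow_mul (-Complex.I), neg_sq, Complex.I_sq, ← pow_mul]
      ring
    rw [h1]
    push_cast
    ring
  have hsum : ∑ k ∈ Finset.range m, (ζ * halfRoot m k) ^ 2 * ∑ j ∈ Finset.range (2 * m),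
        (profileCoeff n j : ℂ) * (-Complex.I * (ζ * halfRoot m k) * r) ^ (2 * j) =
      ∑ j ∈ Finset.range (2 * m), (((-1) ^ j * profileCoeff n j : ℝ) : ℂ) *
        (ζ ^ (2 * (j + 1)) * (r : ℂ) ^ (2 * j)) * (if m ∣ j + 1 then (m : ℂ) else 0) := by
    simp only [Finset.mul_sum, hterm]
    rw [Finset.sum_comm]
    simp only [← Finset.mul_sum, sum_halfRoot_sq_pow hm0]
  have htwo : ∑ j ∈ Finset.range (2 * m), (((-1) ^ j * profileCoeff n j : ℝ) : ℂ) *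
        (ζ ^ (2 * (j + 1)) * (r : ℂ) ^ (2 * j)) * (if m ∣ j + 1 then (m : ℂ) else 0) =
      (((-1) ^ (m - 1) * profileCoeff n (m - 1) : ℝ) : ℂ) *
        (ζ ^ (2 * (m - 1 + 1)) * (r : ℂ) ^ (2 * (m - 1))) * m +
      (((-1) ^ (2 * m - 1) * profileCoeff n (2 * m - 1) : ℝ) : ℂ) *
        (ζ ^ (2 * (2 * m - 1 + 1)) * (r : ℂ) ^ (2 * (2 * m - 1))) * m := by
    have hsub : ({m - 1, 2 * m - 1} : Finset ℕ) ⊆ Finset.range (2 * m) := by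
      intro j hj
      simp only [Finset.mem_insert, Finset.mem_singleton] at hj
      rw [Finset.mem_range]
      omega
    rw [← Finset.sum_subset hsub, Finset.sum_pair (by omega), if_pos, if_pos]
    · rw [Nat.sub_add_cancel (by omega)]
      exact dvd_mul_left m 2
    · rw [Nat.sub_add_cancel hm]
    · intro j hj hj'
      have hnd : ¬ m ∣ j + 1 := by
        rintro ⟨c, hc⟩
        rw [Finset.mem_range] at hj
        simp only [Finset.mem_insert, Finset.mem_singleton, not_or] at hj'
        have hc2 : c ≤ 2 := by
          by_contra hcon
          have : m * 3 ≤ m * c := Nat.mul_le_mul_left m (by omega)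
          omega
        interval_cases c <;> omega
      rw [if_neg hnd, mul_zero]
  have hm1 : m - 1 + 1 = m := by omega
  have hm2 : 2 * m - 1 + 1 = 2 * m := by omega
  have hc1 : 2 * (((m - 1 : ℕ) : ℝ) + 1) = 2 * (m : ℝ) := by
    rw [← Nat.cast_add_one, hm1]
  have hc2 : 2 * (((2 * m - 1 : ℕ) : ℝ) + 1) = 4 * (m : ℝ) := by
    rw [← Nat.cast_add_one, hm2]
    push_cast
    ring
  rw [hsum, htwo, neg_one_pow_mul_profileCoeff, neg_one_pow_mul_profileCoeff, hm1, hm2, hc1, hc2,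
    leadingPart]
  have hn2 : ((n - 2 : ℕ) : ℝ) = (n : ℝ) - 2 := by
    rw [Nat.cast_sub (by omega)]
    norm_num
  have hr1 : r ^ (2 * (m : ℝ) - n) = (r ^ (n - 2))⁻¹ * r ^ (2 * (m - 1)) := by
    rw [← Real.rpow_natCast, ← Real.rpow_natCast, ← Real.rpow_neg hr.le, ← Real.rpow_add hr, hn2]
    congr 1
    push_cast [Nat.cast_sub hm]
    ring
  have hr2 : r ^ (4 * (m : ℝ) - n) = (r ^ (n - 2))⁻¹ * r ^ (2 * (2 * m - 1)) := by
    rw [← Real.rpow_natCast, ← Real.rpow_natCast, ← Real.rpow_neg hr.le, ← Real.rpow_add hr, hn2]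
    congr 1
    push_cast [Nat.cast_sub (show 1 ≤ 2 * m by omega)]
    ring
  rw [hr1, hr2]
  have hζ2 : ζ ^ (2 * (2 * m)) = ζ ^ (2 * m) * ζ ^ (2 * m) := by rw [← pow_add]; congr 1; omega
  have hζp : ζ ^ (2 * m) ≠ 0 := pow_ne_zero _ hζ
  rw [hζ2]
  push_cast
  field_simp

theorem limitingKernel_sub_leadingPart {m n : ℕ} (hm : 1 ≤ m) (hn : 3 ≤ n) {ζ : ℂ} (hζ : ζ ≠ 0)
    {r : ℝ} (hr : 0 < r) :
    limitingKernel m n ζ r - leadingPart m n ζ r =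
      (((r ^ (n - 2))⁻¹ : ℝ) : ℂ) * (((m : ℂ) * ζ ^ (2 * m))⁻¹ *
      ∑ k ∈ Finset.range m, (ζ * halfRoot m k) ^ 2 *
        (resolventProfile n (-Complex.I * (ζ * halfRoot m k) * r) -
          ∑ j ∈ Finset.range (2 * m),
            (profileCoeff n j : ℂ) * (-Complex.I * (ζ * halfRoot m k) * r) ^ (2 * j))) := by
  rw [leadingPart_eq hm hn hζ hr, limitingKernel, ← mul_sub, ← mul_sub, ← Finset.sum_sub_distrib]
  simp only [mul_sub]

theorem norm_neg_I_mul_halfRoot (m k : ℕ) (ζ : ℂ) {r : ℝ} (hr : 0 < r) :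
    ‖-Complex.I * (ζ * halfRoot m k) * r‖ = ‖ζ‖ * r := by
  rw [norm_mul, norm_mul, norm_mul, norm_neg, Complex.norm_I, norm_halfRoot, Complex.norm_real,
    Real.norm_of_nonneg hr.le, one_mul, mul_one]

/-- An average over the roots of unity is bounded by the largest of its terms. -/
theorem norm_rootAverage_le {m n : ℕ} (hm : 1 ≤ m) {ζ : ℂ} {r : ℝ} (hr : 0 < r)
    {A : ℕ → ℂ} {B : ℝ} (hA : ∀ k < m, ‖A k‖ ≤ B) :
    ‖(((r ^ (n - 2))⁻¹ : ℝ) : ℂ) * (((m : ℂ) * ζ ^ (2 * m))⁻¹ *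
      ∑ k ∈ Finset.range m, (ζ * halfRoot m k) ^ 2 * A k)‖ ≤
      (r ^ (n - 2))⁻¹ * ((‖ζ‖ ^ (2 * m))⁻¹ * ‖ζ‖ ^ 2 * B) := by
  have hm0 : (0 : ℝ) < m := by exact_mod_cast hm
  have h1 : ‖∑ k ∈ Finset.range m, (ζ * halfRoot m k) ^ 2 * A k‖ ≤ m * (‖ζ‖ ^ 2 * B) := by
    refine (norm_sum_le_of_le (f := fun k => (ζ * halfRoot m k) ^ 2 * A k)
      (n := fun _ => ‖ζ‖ ^ 2 * B) _ fun k hk => ?_).trans (by simp)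
    rw [norm_mul, norm_pow, norm_mul, norm_halfRoot, mul_one]
    exact mul_le_mul_of_nonneg_left (hA k (Finset.mem_range.1 hk)) (by positivity)
  rw [norm_mul, norm_mul, Complex.norm_real, Real.norm_of_nonneg (by positivity), norm_inv,
    norm_mul, norm_pow, Complex.norm_natCast]
  refine mul_le_mul_of_nonneg_left ?_ (by positivity)
  refine (mul_le_mul_of_nonneg_left h1 (by positivity)).trans (le_of_eq ?_)
  field_simp

theorem inv_pow_mul_sq {m : ℕ} (x : ℝ) (hx : 0 < x) :
    (x ^ (2 * m))⁻¹ * x ^ 2 = x ^ (2 - 2 * (m : ℝ)) := by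
  rw [← Real.rpow_natCast, ← Real.rpow_natCast, ← Real.rpow_neg hx.le, ← Real.rpow_add hx]
  congr 1
  push_cast
  ring

theorem inv_pow_eq_rpow {n : ℕ} (hn : 2 ≤ n) {r : ℝ} (hr : 0 < r) :
    (r ^ (n - 2))⁻¹ = r ^ (2 - (n : ℝ)) := by
  rw [← Real.rpow_natCast, ← Real.rpow_neg hr.le]
  congr 1
  push_cast [Nat.cast_sub hn]
  ring

theorem exists_norm_limitingKernel_sub_leadingPart_le {m n : ℕ} (hm : 1 ≤ m) (hn : 4 * m < n)
    {ε : ℝ} (hε : 0 < ε) (hε1 : ε < 1) :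
    ∃ C : ℝ, 0 < C ∧ ∀ (ζ : ℂ) (r : ℝ), ζ ≠ 0 → 0 < r → ‖ζ‖ * r ≤ 2 →
      ‖limitingKernel m n ζ r - leadingPart m n ζ r‖ ≤
        C * ‖ζ‖ ^ (2 * (m : ℝ) + ε) * r ^ (4 * (m : ℝ) - n + ε) := by
  obtain ⟨C, hC, h⟩ := exists_norm_resolventProfile_sub_le hm hn hε hε1
  refine ⟨C, hC, fun ζ r hζ hr hζr => ?_⟩
  have hζ0 : 0 < ‖ζ‖ := norm_pos_iff.2 hζ
  rw [limitingKernel_sub_leadingPart hm (by omega) hζ hr]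
  refine (norm_rootAverage_le hm hr (B := C * (‖ζ‖ * r) ^ (4 * (m : ℝ) - 2 + ε))
    fun k _ => ?_).trans (le_of_eq ?_)
  · have h1 := h (-Complex.I * (ζ * halfRoot m k) * r)
    rw [norm_neg_I_mul_halfRoot m k ζ hr] at h1
    exact h1 hζr
  · rw [inv_pow_mul_sq _ hζ0, inv_pow_eq_rpow (by omega) hr, Real.mul_rpow hζ0.le hr.le]
    have e1 : ‖ζ‖ ^ (2 * (m : ℝ) + ε) = ‖ζ‖ ^ (2 - 2 * (m : ℝ)) * ‖ζ‖ ^ (4 * (m : ℝ) - 2 + ε) := by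
      rw [← Real.rpow_add hζ0]
      congr 1
      ring
    have e2 : r ^ (4 * (m : ℝ) - n + ε) = r ^ (2 - (n : ℝ)) * r ^ (4 * (m : ℝ) - 2 + ε) := by
      rw [← Real.rpow_add hr]
      congr 1
      ring
    rw [e1, e2]
    ring

/-- At high frequency the limiting kernel is bounded in a complex neighbourhood of `λ` of radius
comparable to `1/r`, where `e^{iζr}` stays bounded. -/
theorem exists_norm_limitingKernel_le {m n : ℕ} (hm : 1 ≤ m) (hn : 4 * m < n) :
    ∃ C : ℝ, 0 < C ∧ ∀ (ζ : ℂ) (lam r : ℝ), 0 < r → 1 ≤ lam * r → ‖ζ - lam‖ ≤ 1 / (4 * r) →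
      ‖limitingKernel m n ζ r‖ ≤ C * r ^ (2 - (n : ℝ)) * lam ^ (2 - 2 * (m : ℝ)) *
        (lam * r) ^ (((n : ℝ) - 3) / 2) := by
  have hn3 : 3 ≤ n := by omega
  have ha := profileExponent_nonneg hn3
  obtain ⟨C, hC, h⟩ := exists_norm_resolventProfile_le hn3
  set a : ℝ := ((n : ℝ) - 3) / 2 with ha'
  have hm' : (1 : ℝ) ≤ m := by exact_mod_cast hm
  refine ⟨(1 / 2) ^ (2 - 2 * (m : ℝ)) * (C * rexp 1 * 3 ^ a), by positivity,
    fun ζ lam r hr hlr hζ => ?_⟩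
  have hlam : 0 < lam := by
    by_contra hcon
    have : lam * r ≤ 0 := mul_nonpos_of_nonpos_of_nonneg (not_lt.1 hcon) hr.le
    linarith
  have hrad : 1 / (4 * r) ≤ lam / 4 := by
    rw [div_le_div_iff₀ (by positivity) (by norm_num)]
    linarith
  have hlamn : ‖(lam : ℂ)‖ = lam := by rw [Complex.norm_real, Real.norm_of_nonneg hlam.le]
  have hup : ‖ζ‖ ≤ 2 * lam := by
    have := norm_le_norm_add_norm_sub' ζ (lam : ℂ)
    rw [hlamn] at this
    linarith
  have hlow : 1 / 2 * lam ≤ ‖ζ‖ := by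
    have := norm_sub_norm_le (lam : ℂ) ζ
    rw [hlamn, norm_sub_rev] at this
    linarith
  have hζ0 : 0 < ‖ζ‖ := lt_of_lt_of_le (by positivity) hlow
  rw [limitingKernel]
  refine (norm_rootAverage_le hm hr (B := C * rexp 1 * (3 ^ a * (lam * r) ^ a))
    fun k hk => ?_).trans ?_
  · refine (h _).trans ?_
    rw [norm_neg_I_mul_halfRoot m k ζ hr]
    have hre : -(-Complex.I * (ζ * halfRoot m k) * r).re ≤ 1 := by
      have e : -Complex.I * (ζ * halfRoot m k) * r =
          -Complex.I * ((lam : ℂ) * halfRoot m k) * r +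
            -Complex.I * ((ζ - lam) * halfRoot m k) * r := by ring
      have h1 : 0 ≤ (-Complex.I * ((lam : ℂ) * halfRoot m k) * r).re := by
        rw [Complex.re_mul_ofReal]
        exact mul_nonneg (re_neg_I_mul_halfRoot_nonneg hk hlam) hr.le
      have h2 := neg_le_of_abs_le (Complex.abs_re_le_norm
        (-Complex.I * ((ζ - lam) * halfRoot m k) * r))
      rw [norm_neg_I_mul_halfRoot m k _ hr] at h2
      have h3 : ‖ζ - lam‖ * r ≤ 1 / (4 * r) * r := by gcongr
      have h4 : 1 / (4 * r) * r = 1 / 4 := by field_simp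
      rw [e, Complex.add_re]
      linarith
    have h5 : (1 + ‖ζ‖ * r) ^ a ≤ 3 ^ a * (lam * r) ^ a := by
      rw [← Real.mul_rpow (by norm_num) (by positivity)]
      refine Real.rpow_le_rpow (by positivity) ?_ ha
      have : ‖ζ‖ * r ≤ 2 * lam * r := by gcongr
      linarith
    gcongr
  · rw [inv_pow_mul_sq _ hζ0, inv_pow_eq_rpow (by omega) hr]
    have h6 : ‖ζ‖ ^ (2 - 2 * (m : ℝ)) ≤ (1 / 2) ^ (2 - 2 * (m : ℝ)) * lam ^ (2 - 2 * (m : ℝ)) := by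
      rw [← Real.mul_rpow (by norm_num) hlam.le]
      exact Real.rpow_le_rpow_of_nonpos (by positivity) hlow (by linarith)
    calc r ^ (2 - (n : ℝ)) * (‖ζ‖ ^ (2 - 2 * (m : ℝ)) * (C * rexp 1 * (3 ^ a * (lam * r) ^ a)))
        ≤ r ^ (2 - (n : ℝ)) * ((1 / 2) ^ (2 - 2 * (m : ℝ)) * lam ^ (2 - 2 * (m : ℝ)) *
            (C * rexp 1 * (3 ^ a * (lam * r) ^ a))) := by gcongr
      _ = _ := by ring

theorem norm_leadingPart_le {m n : ℕ} {ε : ℝ} (hε : 0 < ε) {ζ : ℂ} {lam r : ℝ}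
    (hr : 0 < r) (hlr : 1 ≤ lam * r) (hζ : ‖ζ‖ ≤ 2 * lam) :
    ‖leadingPart m n ζ r‖ ≤
      (|rieszConst n (2 * (m : ℝ))| + 2 ^ (2 * m) * |rieszConst n (4 * (m : ℝ))|) *
        lam ^ (2 * (m : ℝ) + ε) * r ^ (4 * (m : ℝ) - n + ε) := by
  have hlam : 0 < lam := by
    by_contra hcon
    have : lam * r ≤ 0 := mul_nonpos_of_nonpos_of_nonneg (not_lt.1 hcon) hr.le
    linarith
  have h0 : r ^ (2 * (m : ℝ) - n) ≤ lam ^ (2 * (m : ℝ) + ε) * r ^ (4 * (m : ℝ) - n + ε) := by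
    have h1 : 1 ≤ (lam * r) ^ (2 * (m : ℝ) + ε) := Real.one_le_rpow hlr (by positivity)
    have e : r ^ (4 * (m : ℝ) - n + ε) = r ^ (2 * (m : ℝ) + ε) * r ^ (2 * (m : ℝ) - n) := by
      rw [← Real.rpow_add hr]
      congr 1
      ring
    rw [Real.mul_rpow hlam.le hr.le] at h1
    rw [e, ← mul_assoc]
    exact le_mul_of_one_le_left (by positivity) h1
  have h1 : ‖ζ‖ ^ (2 * m) * r ^ (4 * (m : ℝ) - n) ≤
      2 ^ (2 * m) * (lam ^ (2 * (m : ℝ) + ε) * r ^ (4 * (m : ℝ) - n + ε)) := by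
    have h2 : 1 ≤ (lam * r) ^ ε := Real.one_le_rpow hlr hε.le
    rw [Real.mul_rpow hlam.le hr.le] at h2
    have e1 : lam ^ (2 * (m : ℝ) + ε) = lam ^ (2 * m) * lam ^ ε := by
      rw [Real.rpow_add hlam, ← Real.rpow_natCast]
      push_cast
      rfl
    calc ‖ζ‖ ^ (2 * m) * r ^ (4 * (m : ℝ) - n) ≤ (2 * lam) ^ (2 * m) * r ^ (4 * (m : ℝ) - n) := by
          gcongr
      _ ≤ (2 * lam) ^ (2 * m) * r ^ (4 * (m : ℝ) - n) * (lam ^ ε * r ^ ε) :=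
          le_mul_of_one_le_right (by positivity) h2
      _ = _ := by
          rw [e1, Real.rpow_add hr, mul_pow]
          ring
  rw [leadingPart]
  refine (norm_add_le _ _).trans ?_
  rw [norm_mul, norm_pow, Complex.norm_real, Complex.norm_real, norm_mul, norm_mul,
    Real.norm_of_nonneg (Real.rpow_nonneg hr.le (2 * (m : ℝ) - n)),
    Real.norm_of_nonneg (Real.rpow_nonneg hr.le (4 * (m : ℝ) - n)),
    Real.norm_eq_abs, Real.norm_eq_abs]
  have h2 := mul_le_mul_of_nonneg_left h0 (abs_nonneg (rieszConst n (2 * (m : ℝ))))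
  have h3 := mul_le_mul_of_nonneg_left h1 (abs_nonneg (rieszConst n (4 * (m : ℝ))))
  linarith

theorem differentiableOn_limitingKernel {m n : ℕ} (hm : 1 ≤ m) (hn : 3 ≤ n) {r : ℝ} (hr : 0 < r) :
    DifferentiableOn ℂ (fun ζ => limitingKernel m n ζ r) {z : ℂ | 0 < z.re} := by
  have hmC : (m : ℂ) ≠ 0 := by exact_mod_cast (by omega : m ≠ 0)
  intro ζ hζ
  have hζ' : 0 < ζ.re := hζ
  have hζ0 : ζ ≠ 0 := by
    rintro rfl
    simp at hζ'
  refine DifferentiableAt.differentiableWithinAt ?_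
  unfold limitingKernel
  refine DifferentiableAt.const_mul (DifferentiableAt.mul ?_ (DifferentiableAt.fun_sum fun k hk =>
    DifferentiableAt.mul (by fun_prop) ?_)) _
  · have h1 : DifferentiableAt ℂ (fun ζ : ℂ => (m : ℂ) * ζ ^ (2 * m)) ζ := by fun_prop
    exact h1.fun_inv (mul_ne_zero hmC (pow_ne_zero _ hζ0))
  · have h1 : DifferentiableAt ℂ (fun ζ : ℂ => -Complex.I * (ζ * halfRoot m k) * r) ζ := by
      fun_prop
    have hmem : -Complex.I * (ζ * halfRoot m k) * r ∈ Complex.slitPlane := by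
      have h2 := neg_I_mul_halfRoot_mem_slitPlane (Finset.mem_range.1 hk) hζ'
      rw [Complex.mem_slitPlane_iff] at h2 ⊢
      rw [Complex.re_mul_ofReal, Complex.im_mul_ofReal]
      exact h2.imp (fun h => mul_pos h hr) fun h => mul_ne_zero h hr.ne'
    exact ((differentiableOn_resolventProfile hn).differentiableAt
      (Complex.isOpen_slitPlane.mem_nhds hmem)).comp ζ h1

theorem differentiable_leadingPart (m n : ℕ) (r : ℝ) :
    Differentiable ℂ fun ζ => leadingPart m n ζ r := by
  unfold leadingPart
  fun_prop

/-- Cauchy's estimate on the disc of radius `λ / (4s)` about `λ`: each application of `λ ∂_λ` costs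
a factor `4s`. -/
theorem pow_mul_norm_iteratedDeriv_ofReal_le {F : ℂ → ℂ}
    (hF : DifferentiableOn ℂ F {z : ℂ | 0 < z.re}) {lam s B : ℝ} (hlam : 0 < lam) (hs : 1 ≤ s)
    {l N : ℕ} (hl : l ≤ N) (hB : ∀ z : ℂ, ‖z - lam‖ ≤ lam / (4 * s) → ‖F z‖ ≤ B) :
    lam ^ l * ‖iteratedDeriv l (fun t : ℝ => F t) lam‖ ≤ N.factorial * 4 ^ N * (s ^ N * B) := by
  have hR : 0 < lam / (4 * s) := by positivity
  have hRlam : lam / (4 * s) < lam := div_lt_self hlam (by linarith)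
  have hB0 : 0 ≤ B := (norm_nonneg _).trans (hB lam (by simpa using hR.le))
  have h := norm_iteratedDeriv_ofReal_le hF hR hRlam l hB
  calc lam ^ l * ‖iteratedDeriv l (fun t : ℝ => F t) lam‖
      ≤ lam ^ l * (l.factorial * B / (lam / (4 * s)) ^ l) := by gcongr
    _ = l.factorial * 4 ^ l * (s ^ l * B) := by
        rw [div_pow, mul_pow]
        field_simp
    _ ≤ _ := by
        have h1 : (l.factorial : ℝ) ≤ N.factorial := by exact_mod_cast Nat.factorial_le hl
        gcongr
        norm_num

/-- The derivative bounds, in terms of `r = |x - y|`. For `λr ≤ 1` Cauchy's estimate is applied to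
the difference on a disc of radius `λ/4`. For `λr ≥ 1` the kernel and its leading part are treated
separately: the kernel oscillates at scale `1/r` in `λ` and is only controlled on discs of that
radius, so that each `λ ∂_λ` costs a factor `λr`. With the maximal number
`⌈n/2⌉ + 1` of derivatives this gives exactly the power of `r` in the first term on the right. -/
theorem exists_pow_mul_norm_iteratedDeriv_le {m n : ℕ} (hm : 1 ≤ m) (hn : 4 * m < n)
    {lam₀ ε : ℝ} (hlam₀ : 0 < lam₀) (hε : 0 < ε) (hε1 : ε < 1) :
    ∃ C : ℝ, ∀ l : ℕ, l ≤ ⌈(n : ℝ) / 2⌉₊ + 1 → ∀ lam : ℝ, 0 < lam → lam < lam₀ →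
      ∀ r : ℝ, 0 < r →
        lam ^ l * ‖iteratedDeriv l
          (fun t : ℝ => limitingKernel m n t r - leadingPart m n t r) lam‖ ≤
          C * lam ^ (2 * (m : ℝ) + ε) *
            (r ^ (((⌈(n : ℝ) / 2⌉₊ : ℝ) - (n : ℝ) / 2) + 3 / 2) +
              r ^ (4 * (m : ℝ) - (n : ℝ) + ε)) := by
  have hn3 : 3 ≤ n := by omega
  have hn' : 4 * (m : ℝ) + 1 ≤ n := by exact_mod_cast hn
  obtain ⟨C₁, hC₁, h₁⟩ := exists_norm_limitingKernel_sub_leadingPart_le hm hn hε hε1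
  obtain ⟨C₂, hC₂, h₂⟩ := exists_norm_limitingKernel_le hm hn
  set C₃ : ℝ := |rieszConst n (2 * (m : ℝ))| + 2 ^ (2 * m) * |rieszConst n (4 * (m : ℝ))| with hC₃
  have hC₃0 : 0 ≤ C₃ := by positivity
  set N : ℕ := ⌈(n : ℝ) / 2⌉₊ + 1 with hN
  have hNn : (n : ℝ) / 2 + 1 ≤ N := by
    have := Nat.le_ceil ((n : ℝ) / 2)
    rw [hN]
    push_cast
    linarith
  -- The power of `λ` produced by the large-argument bound.
  set p : ℝ := 2 - 2 * (m : ℝ) + N + ((n : ℝ) - 3) / 2 with hp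
  have hpε : 0 ≤ p - (2 * (m : ℝ) + ε) := by linarith
  set A : ℝ := N.factorial * 4 ^ N with hA
  have hA0 : 0 ≤ A := by positivity
  set D : ℝ := C₁ * 2 ^ (2 * (m : ℝ) + ε) + C₂ * lam₀ ^ (p - (2 * (m : ℝ) + ε)) + C₃ with hD
  refine ⟨A * D, fun l hl lam hlam hlam' r hr => ?_⟩
  set θ : ℝ := ((⌈(n : ℝ) / 2⌉₊ : ℝ) - (n : ℝ) / 2) + 3 / 2 with hθ
  have hKd := differentiableOn_limitingKernel hm hn3 hr
  have hPd : DifferentiableOn ℂ (fun ζ => leadingPart m n ζ r) {z : ℂ | 0 < z.re} :=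
    (differentiable_leadingPart m n r).differentiableOn
  set X : ℝ := lam ^ (2 * (m : ℝ) + ε) with hX
  set Y : ℝ := r ^ θ with hY
  set W : ℝ := r ^ (4 * (m : ℝ) - (n : ℝ) + ε) with hW
  have hX0 : 0 ≤ X := by positivity
  have hY0 : 0 ≤ Y := by positivity
  have hW0 : 0 ≤ W := by positivity
  have hd1 : 0 ≤ C₁ * 2 ^ (2 * (m : ℝ) + ε) := by positivity
  have hd2 : 0 ≤ C₂ * lam₀ ^ (p - (2 * (m : ℝ) + ε)) := by positivity
  have hlamn : ‖(lam : ℂ)‖ = lam := by rw [Complex.norm_real, Real.norm_of_nonneg hlam.le]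
  have hnear : ∀ z : ℂ, ‖z - lam‖ ≤ lam / (4 * 1) → ‖z‖ ≤ 5 / 4 * lam := by
    intro z hz
    have := norm_le_norm_add_norm_sub' z (lam : ℂ)
    rw [hlamn] at this
    linarith
  have hne : ∀ z : ℂ, ‖z - lam‖ ≤ lam / (4 * 1) → z ≠ 0 := by
    rintro z hz rfl
    rw [zero_sub, norm_neg, hlamn] at hz
    linarith
  rcases le_total (lam * r) 1 with hlr | hlr
  · have hB : ∀ z : ℂ, ‖z - lam‖ ≤ lam / (4 * 1) →
        ‖limitingKernel m n z r - leadingPart m n z r‖ ≤ C₁ * 2 ^ (2 * (m : ℝ) + ε) * X * W := by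
      intro z hz
      have hz' := hnear z hz
      have hzr : ‖z‖ * r ≤ 5 / 4 * lam * r := by gcongr
      refine (h₁ z r (hne z hz) hr (by linarith)).trans ?_
      have h3 : ‖z‖ ^ (2 * (m : ℝ) + ε) ≤ 2 ^ (2 * (m : ℝ) + ε) * X := by
        rw [hX, ← Real.mul_rpow (by norm_num) hlam.le]
        exact Real.rpow_le_rpow (norm_nonneg z) (by linarith) (by positivity)
      rw [mul_assoc C₁ (2 ^ _)]
      gcongr
    refine (pow_mul_norm_iteratedDeriv_ofReal_le (hKd.sub hPd) hlam le_rfl hl hB).trans ?_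
    rw [one_pow, one_mul, mul_assoc A]
    refine (mul_le_mul_of_nonneg_left ?_ hA0).trans_eq (mul_assoc A _ _).symm
    have h4 : C₁ * 2 ^ (2 * (m : ℝ) + ε) ≤ D := by rw [hD]; linarith
    have h5 : W ≤ Y + W := by linarith
    have hD0 : 0 ≤ D := hd1.trans h4
    gcongr
  · have hsub : iteratedDeriv l
        (fun t : ℝ => limitingKernel m n t r - leadingPart m n t r) lam =
        iteratedDeriv l (fun t : ℝ => limitingKernel m n t r) lam -
          iteratedDeriv l (fun t : ℝ => leadingPart m n t r) lam :=
      iteratedDeriv_fun_sub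
        ((contDiffOn_comp_ofReal hKd l).contDiffAt (Ioi_mem_nhds hlam))
        ((contDiffOn_comp_ofReal hPd l).contDiffAt (Ioi_mem_nhds hlam))
    have hradius : lam / (4 * (lam * r)) = 1 / (4 * r) := by field_simp
    have hK := pow_mul_norm_iteratedDeriv_ofReal_le hKd hlam hlr hl
      (fun z hz => h₂ z lam r hr hlr (by rwa [hradius] at hz))
    have hP := pow_mul_norm_iteratedDeriv_ofReal_le hPd hlam le_rfl hl (fun z hz =>
      norm_leadingPart_le (m := m) (n := n) hε hr hlr (by have := hnear z hz; linarith))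
    have hK' : (lam * r) ^ N * (C₂ * r ^ (2 - (n : ℝ)) * lam ^ (2 - 2 * (m : ℝ)) *
        (lam * r) ^ (((n : ℝ) - 3) / 2)) ≤ C₂ * lam₀ ^ (p - (2 * (m : ℝ) + ε)) * X * Y := by
      have e1 : (lam * r) ^ N * (C₂ * r ^ (2 - (n : ℝ)) * lam ^ (2 - 2 * (m : ℝ)) *
          (lam * r) ^ (((n : ℝ) - 3) / 2)) = C₂ * lam ^ p * Y := by
        have e2 : lam ^ p = lam ^ (2 - 2 * (m : ℝ)) * lam ^ (N : ℝ) * lam ^ (((n : ℝ) - 3) / 2) := by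
          rw [← Real.rpow_add hlam, ← Real.rpow_add hlam]
        have e3 : Y = r ^ (2 - (n : ℝ)) * r ^ (N : ℝ) * r ^ (((n : ℝ) - 3) / 2) := by
          rw [hY, ← Real.rpow_add hr, ← Real.rpow_add hr]
          congr 1
          rw [hθ, hN]
          push_cast
          ring
        rw [e2, e3, Real.mul_rpow hlam.le hr.le, mul_pow, Real.rpow_natCast, Real.rpow_natCast]
        ring
      have e4 : lam ^ p ≤ lam₀ ^ (p - (2 * (m : ℝ) + ε)) * X := by
        have e5 : lam ^ p = lam ^ (p - (2 * (m : ℝ) + ε)) * X := by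
          rw [hX, ← Real.rpow_add hlam, sub_add_cancel]
        rw [e5]
        gcongr
      rw [e1, mul_assoc C₂ (lam₀ ^ _)]
      gcongr
    rw [hsub]
    calc lam ^ l * ‖iteratedDeriv l (fun t : ℝ => limitingKernel m n t r) lam -
          iteratedDeriv l (fun t : ℝ => leadingPart m n t r) lam‖
        ≤ lam ^ l * ‖iteratedDeriv l (fun t : ℝ => limitingKernel m n t r) lam‖ +
          lam ^ l * ‖iteratedDeriv l (fun t : ℝ => leadingPart m n t r) lam‖ := by
          rw [← mul_add]
          gcongr
          exact norm_sub_le _ _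
      _ ≤ A * (C₂ * lam₀ ^ (p - (2 * (m : ℝ) + ε)) * X * Y) + A * (C₃ * X * W) := by
          refine add_le_add (hK.trans (mul_le_mul_of_nonneg_left hK' hA0)) (hP.trans_eq ?_)
          rw [one_pow, one_mul]
      _ ≤ A * D * X * (Y + W) := by
          have h6 : 0 ≤ A * (X * Y) := by positivity
          have h7 : 0 ≤ A * (X * W) := by positivity
          have h8 := mul_le_mul_of_nonneg_right
            (show C₂ * lam₀ ^ (p - (2 * (m : ℝ) + ε)) ≤ D by rw [hD]; linarith) h6
          have h9 := mul_le_mul_of_nonneg_right (show C₃ ≤ D by rw [hD]; linarith) h7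
          linarith

/-- Off the diagonal, every kernel of the limiting resolvent is the explicit one, so the error term
is the explicit kernel minus its leading part. -/
theorem errorKernel_eq {m n : ℕ} (hm : 1 ≤ m) (hn : 3 ≤ n)
    {K : ℝ → EuclideanSpace ℝ (Fin n) → EuclideanSpace ℝ (Fin n) → ℂ}
    (hK : ∀ lam : ℝ, 0 < lam → IsFreeResolventKernel m lam (K lam))
    {x y : EuclideanSpace ℝ (Fin n)} (hxy : x ≠ y) {lam : ℝ} (hlam : 0 < lam) :
    errorKernel m K lam x y =
      limitingKernel m n lam ‖x - y‖ - leadingPart m n lam ‖x - y‖ := by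
  rw [errorKernel, (hK lam hlam).eq_of_ne
    (isFreeResolventKernel_limitingKernel (by omega) hn hlam) hxy, leadingPart, kernelG0, kernelG1,
    rieszKernel, rieszKernel, rieszConst, rieszConst, Complex.ofReal_pow, sub_sub]

theorem lemma3p1 (m n : ℕ) (hm : 1 ≤ m) (hn : 4 * m < n) :
    -- the limiting free resolvent has an integral kernel
    (∃ K : ℝ → EuclideanSpace ℝ (Fin n) → EuclideanSpace ℝ (Fin n) → ℂ,
      ∀ lam : ℝ, 0 < lam → IsFreeResolventKernel m lam (K lam)) ∧
    -- and the kernel satisfies the expansion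
    ∀ K : ℝ → EuclideanSpace ℝ (Fin n) → EuclideanSpace ℝ (Fin n) → ℂ,
      (∀ lam : ℝ, 0 < lam → IsFreeResolventKernel m lam (K lam)) →
      (∀ x y : EuclideanSpace ℝ (Fin n), x ≠ y →
        ContDiffOn ℝ ((⌈(n : ℝ) / 2⌉₊ + 1 : ℕ) : WithTop ℕ∞)
          (fun lam : ℝ => errorKernel m K lam x y) (Ioi 0)) ∧
      ∀ lam₀ : ℝ, 0 < lam₀ → ∀ ε : ℝ, 0 < ε → ε < 1 →
        ∃ C : ℝ, ∀ l : ℕ, l ≤ ⌈(n : ℝ) / 2⌉₊ + 1 →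
          ∀ lam : ℝ, 0 < lam → lam < lam₀ →
            ∀ x y : EuclideanSpace ℝ (Fin n), x ≠ y →
              lam ^ l * ‖iteratedDeriv l (fun t : ℝ => errorKernel m K t x y) lam‖ ≤
                C * lam ^ (2 * (m : ℝ) + ε) *
                  (‖x - y‖ ^ (((⌈(n : ℝ) / 2⌉₊ : ℝ) - (n : ℝ) / 2) + 3 / 2) +
                    ‖x - y‖ ^ (4 * (m : ℝ) - (n : ℝ) + ε)) := by
  have hn3 : 3 ≤ n := by omega
  have hpos : ∀ {x y : EuclideanSpace ℝ (Fin n)}, x ≠ y → 0 < ‖x - y‖ :=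
    fun h => norm_pos_iff.2 (sub_ne_zero.2 h)
  refine ⟨⟨fun lam x y => limitingKernel m n lam ‖x - y‖, fun lam hlam =>
    isFreeResolventKernel_limitingKernel (by omega) hn3 hlam⟩, fun K hK => ⟨fun x y hxy => ?_,
    fun lam₀ hlam₀ ε hε hε1 => ?_⟩⟩
  · refine (contDiffOn_comp_ofReal ((differentiableOn_limitingKernel hm hn3 (hpos hxy)).sub
      (differentiable_leadingPart m n ‖x - y‖).differentiableOn) _).congr fun lam hlam => ?_
    exact errorKernel_eq hm hn3 hK hxy hlam
  · obtain ⟨C, hC⟩ := exists_pow_mul_norm_iteratedDeriv_le hm hn hlam₀ hε hε1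
    refine ⟨C, fun l hl lam hlam hlam' x y hxy => ?_⟩
    have heq : (fun t : ℝ => errorKernel m K t x y) =ᶠ[𝓝 lam]
        fun t : ℝ => limitingKernel m n t ‖x - y‖ - leadingPart m n t ‖x - y‖ := by
      filter_upwards [Ioi_mem_nhds hlam] with t ht using errorKernel_eq hm hn3 hK hxy ht
    rw [heq.iteratedDeriv_eq l]
    exact hC l hl lam hlam hlam' _ (hpos hxy)
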